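/- **Setting.** $K$ sources generate random vectors $X_n=(X_n^1,\dots,X_n^K)$, $n\ge 1$, independent over time, with $X_n\sim F$ for $n\le\nu$ and $X_n\sim G$ for $n>\nu$, where $\nu\in\{0,1,\dots\}$ is unknown and deterministic, $F$ is known and $G$ belongs to a family $\mathcal G$ of probability distributions. Write $P_\infty$ for the law without change and $P_\nu^G$ for the law with change at $\nu$ to $G$. For $E\subseteq[K]$ let $F^E,G^E$ be the distributions of $X_n^E=(X_n^k)_{k\in E}$ under $F,G$. Fix $m$, let $\mathcal K_m=\{E\subseteq [K]:|E|=m\}$, $\mathcal A(G)=\{E\in\mathcal K_m: G^E\ne F^E\}$ and $\mathcal G^E=\{G^E: G\in\mathcal G,\ G^E\neq F^E\}$, and assume that $G^E$ and $F^E$ are mutually absolutely continuous for all $G\in\mathcal G$, $E\in\mathcal A(G)$; put $\mathcal I_0^E(G)=\int\log\frac{dG^E}{dF^E}\,dG^E$. A *policy* is a pair $(S,T)$: at each time $n$ the sources in $S_n\in\mathcal K_m$ are sampled, $S_n$ is $\mathcal F^S_{n-1}$-measurable, and $T$ is a positive integer-valued stopping time of $(\mathcal F_n^S)$, where $\mathcal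 F_n^S=\sigma(\mathcal F_{n-1}^S,X_n^{S_n})$ and $\mathcal F_0^S$ is generated by a randomization variable independent of the observations. Let $\Delta(\gamma)$ be the class of policies with $E_\infty[T]\ge\gamma$, and let $$D^G(S,T)=\sup_{\nu\ge0}\ \operatorname{ess\,sup}\ E_\nu^G\big[T-\nu\,\big|\,\mathcal F_\nu^S(G),\,T>\nu\big],\qquad \mathcal F_\nu^S(G)=\sigma\big(S_t,X_t^{S_t}: t\le\nu,\ S_t\in\mathcal A(G)\big).$$ *Round Robin CUSUM.* Fix a non-empty $U\subseteq\mathcal K_m$ (the units) such that $\mathcal G^E$ is non-empty and finite for every $E\in U$, and let $H^E=|\mathcal G^E|^{-1}\sum_{P\in\mathcal G^E}P$. Fix an arbitrary cyclic ordering of $U$ with a first unit, and $\gamma>1$. Sample the first unit at time $1$; let $Y_0=0$ and $Y_n=\max\{Y_{n-1},0\}+\log\frac{dH^{E}}{dF^{E}}(X_n^{E})$, where $E$ is the unit sampled at time $n$. If $Y_n\le 0$, move to the next unit in the cyclic order; if $0<Y_n<\log\gamma$, keep sampling the same unit; stop at $\tilde T=\inf\{n\ge1: Y_n\ge\log\gamma\}$.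 Denote this policy by $(\tilde S,\tilde T)$. For $G \in \mathcal G$ define $$\mathsf{ARE}^G(\tilde S,\tilde T)=\limsup_{\gamma\to\infty}\frac{D^G(\tilde S,\tilde T)}{\inf\{D^G(S,T):(S,T)\in\Delta(\gamma)\}},$$ and call $(\tilde S,\tilde T)$ asymptotically optimal under $G$ if the quotient converges to $1$ as $\gamma\to\infty$. **Theorem.** Let $G\in\mathcal G$. Suppose that $\int\big(\log\frac{dG^E}{dF^E}\big)^2dG^E<\infty$ for every $E\in\mathcal A(G)$, that $\mathcal A(G)\cap U\neq\emptyset$, that $\int\log\frac{dF^E}{dH^E}\,dF^E\in(0,\infty)$ for every $E\in U$, and that $\mathcal J_0^E(G)=\int\log\frac{dH^E}{dF^E}\,dG^E\in(0,\infty)$ for every $E\in\mathcal A(G)\cap U$. (i) For all large $\gamma$ the numerator of the quotient in the definition of $\mathsf{ARE}^G(\tilde S,\tilde T)$ is finite and its denominator is positive, and $$\mathsf{ARE}^G(\tilde S,\tilde T)\le\frac{\max\{\mathcal I_0^E(G):E\in\mathcal A(G)\}}{\min\{\mathcal J_0^E(G):E\in\mathcal A(G)\cap U\}}.$$ (ii)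 If, also, $\mathcal G^E$ is a singleton for every $E\in\mathcal A(G)\cap U$ and $\max_{E\in\mathcal A(G)}\mathcal I_0^E(G)=\min_{E\in\mathcal A(G)\cap U}\mathcal I_0^E(G)$, then $(\tilde S,\tilde T)$ is asymptotically optimal under $G$. -/

import Mathlib

open MeasureTheory ProbabilityTheory Filter Topology
open scoped ENNReal

namespace QuickestDetection

noncomputable section

section LocalDistributions

variable {K : ℕ} {X : Fin K → Type*} [∀ k, MeasurableSpace (X k)]

/-- The local distribution on the sources in `E` of a global distribution `P` of all sources. -/
def localLaw (P : Measure (∀ k, X k)) (E : Finset (Fin K)) : Measure (∀ k : E, X k) :=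
  P.map E.restrict

/-- The plausible post-change local distributions of `E`: all `G^E` with `G` in the family `𝒢`
that differ from the pre-change local distribution `F^E`. -/
def localFamily (F : Measure (∀ k, X k)) (𝒢 : Set (Measure (∀ k, X k))) (E : Finset (Fin K)) :
    Set (Measure (∀ k : E, X k)) :=
  {P | ∃ G ∈ 𝒢, localLaw G E = P ∧ localLaw G E ≠ localLaw F E}

open scoped Classical in
/-- The sets of exactly `m` sources whose local distributions differ under `F` and `G`. -/
def affected (F G : Measure (∀ k, X k)) (m : ℕ) : Finset (Finset (Fin K)) :=
  {E ∈ (Finset.univ : Finset (Fin K)).powersetCard m | localLaw G E ≠ localLaw F E}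

/-- Kullback-Leibler information number of `G^E` versus `F^E`. -/
def infoNumber (F G : Measure (∀ k, X k)) (E : Finset (Fin K)) : ℝ :=
  ∫ x, llr (localLaw G E) (localLaw F E) x ∂(localLaw G E)

/-- The uniform mixture over the plausible post-change local distributions of `E`. -/
def mixture (F : Measure (∀ k, X k)) (𝒢 : Set (Measure (∀ k, X k))) (E : Finset (Fin K)) :
    Measure (∀ k : E, X k) :=
  ((localFamily F 𝒢 E).ncard : ℝ≥0∞)⁻¹ •
    Measure.sum (fun P : localFamily F 𝒢 E => (P : Measure (∀ k : E, X k)))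

/-- The log-likelihood ratio of the mixture versus `F^E`. -/
def mixLLR (F : Measure (∀ k, X k)) (𝒢 : Set (Measure (∀ k, X k))) (E : Finset (Fin K)) :
    (∀ k : E, X k) → ℝ :=
  llr (mixture F 𝒢 E) (localLaw F E)

/-- The negated pre-change drift `∫ log (dF^E / dH^E) dF^E`, where `H^E` is the mixture. -/
def preDrift (F : Measure (∀ k, X k)) (𝒢 : Set (Measure (∀ k, X k))) (E : Finset (Fin K)) : ℝ :=
  ∫ x, llr (localLaw F E) (mixture F 𝒢 E) x ∂(localLaw F E)

/-- The post-change drift `∫ log (dH^E / dF^E) dG^E`, where `H^E` is the mixture. -/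
def postDrift (F : Measure (∀ k, X k)) (𝒢 : Set (Measure (∀ k, X k)))
    (G : Measure (∀ k, X k)) (E : Finset (Fin K)) : ℝ :=
  ∫ x, mixLLR F 𝒢 E x ∂(localLaw G E)

end LocalDistributions

/-- The sample space: a value of an auxiliary randomization variable, together with the sequence
of vectors generated by the `K` sources. The coordinate with index `n` of the sequence is the
vector generated at time `n + 1`. -/
abbrev Sample (R : Type*) {K : ℕ} (X : Fin K → Type*) : Type _ := R × (ℕ → ∀ k, X k)

section Laws

variable {R : Type*} [MeasurableSpace R]
  {K : ℕ} {X : Fin K → Type*} [∀ k, MeasurableSpace (X k)]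

/-- The law when there is no change: the vectors are independent with distribution `F`, and
independent of the randomization variable, which has distribution `ρ`. -/
def noChangeLaw (ρ : Measure R) (F : Measure (∀ k, X k)) : Measure (Sample R X) :=
  ρ.prod (Measure.infinitePi (fun _ : ℕ => F))

/-- The law when the change happens at time `ν` and the post-change distribution is `G`: the
vectors at times `1, …, ν` have distribution `F`, those at later times distribution `G`. -/
def changeLaw (ρ : Measure R) (F G : Measure (∀ k, X k)) (ν : ℕ) : Measure (Sample R X) :=
  ρ.prod (Measure.infinitePi (fun n : ℕ => if n < ν then F else G))

/-- What is observed at time `n + 1` under the sampling rule `S`, where `S n` is the set of sources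
sampled at time `n + 1`: this set, and the values of the sources in it. -/
def observed (S : ℕ → Sample R X → Finset (Fin K)) (n : ℕ) (ω : Sample R X) :
    Σ E : Finset (Fin K), ∀ k : E, X k :=
  ⟨S n ω, (S n ω).restrict (ω.2 n)⟩

/-- The filtration of the collected observations. -/
def obsFiltration (S : ℕ → Sample R X → Finset (Fin K)) : ℕ → MeasurableSpace (Sample R X)
  | 0 => MeasurableSpace.comap Prod.fst inferInstance
  | n + 1 => obsFiltration S n ⊔ MeasurableSpace.comap (observed S n) inferInstance

/-- Joint sequential sampling rules and change-detection policies: at every time `m` sources,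
chosen on the basis of the past observations, are sampled, and `T` is a positive integer-valued
stopping time of the filtration of the collected observations. As for every stopping time, being
integer-valued is understood almost surely, under every law of the model. -/
structure IsPolicy (ρ : Measure R) (F : Measure (∀ k, X k)) (𝒢 : Set (Measure (∀ k, X k)))
    (m : ℕ) (S : ℕ → Sample R X → Finset (Fin K)) (T : Sample R X → ℕ∞) : Prop where
  card_eq : ∀ n ω, (S n ω).card = m
  adapted : ∀ n E, MeasurableSet[obsFiltration S n] {ω | S n ω = E}
  one_le : ∀ ω, 1 ≤ T ω
  stopping : ∀ n : ℕ, MeasurableSet[obsFiltration S n] {ω | T ω = n}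
  finite_noChange : ∀ᵐ ω ∂(noChangeLaw ρ F), T ω ≠ ⊤
  finite_change : ∀ G ∈ 𝒢, ∀ ν : ℕ, ∀ᵐ ω ∂(changeLaw ρ F G ν), T ω ≠ ⊤

/-- The expected time until an alarm is raised when there is no change. -/
def expNoChange (ρ : Measure R) (F : Measure (∀ k, X k)) (T : Sample R X → ℕ∞) : ℝ≥0∞ :=
  ∫⁻ ω, (T ω : ℝ≥0∞) ∂(noChangeLaw ρ F)

/-- The sigma-algebra generated by the observations up to time `ν` from those sampled sets that
are affected by the change, i.e. by `S_t, X_t^{S_t}` for the `t ≤ ν` such that `S_t` is affected. -/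
def affectedHistory (F G : Measure (∀ k, X k)) (m : ℕ)
    (S : ℕ → Sample R X → Finset (Fin K)) (ν : ℕ) : MeasurableSpace (Sample R X) :=
  MeasurableSpace.generateFrom
    {s | ∃ t < ν, ∃ B : Set (Σ E : Finset (Fin K), ∀ k : E, X k), MeasurableSet B ∧
      s = {ω | S t ω ∈ affected F G m ∧ observed S t ω ∈ B}}

/-- The worst-case (over change-points and over histories from the affected sampled sets)
conditional expected detection delay when the post-change distribution is `G`. -/
def delay (ρ : Measure R) (F G : Measure (∀ k, X k)) (m : ℕ)
    (S : ℕ → Sample R X → Finset (Fin K)) (T : Sample R X → ℕ∞) : ℝ≥0∞ :=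
  ⨆ ν : ℕ,
    let P : Measure (Sample R X) := cond (changeLaw ρ F G ν) {ω | (ν : ℕ∞) < T ω}
    essSup (condLExp (affectedHistory F G m S ν) P (fun ω => (T ω : ℝ≥0∞) - (ν : ℝ≥0∞))) P

/-- The optimal delay among all policies whose expected time to alarm when there is no change is
at least `γ`. -/
def optimalDelay (ρ : Measure R) (F : Measure (∀ k, X k)) (𝒢 : Set (Measure (∀ k, X k)))
    (G : Measure (∀ k, X k)) (m : ℕ) (γ : ℝ) : ℝ≥0∞ :=
  ⨅ (S : ℕ → Sample R X → Finset (Fin K)) (T : Sample R X → ℕ∞)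
    (_ : IsPolicy ρ F 𝒢 m S T ∧ ENNReal.ofReal γ ≤ expNoChange ρ F T), delay ρ F G m S T

end Laws

section RoundRobin

variable {R : Type*} {K : ℕ} {X : Fin K → Type*} [∀ k, MeasurableSpace (X k)]
  {U : Finset (Finset (Fin K))} {N : ℕ} [NeZero N]

/-- State of Round Robin CUSUM after `n` observations: the label of the unit to be sampled next,
in the cyclic order given by the enumeration `e` of the units, and the statistic `Y_n`. The
addition in `Fin N` is cyclic. -/
def rrState (F : Measure (∀ k, X k)) (𝒢 : Set (Measure (∀ k, X k))) (e : Fin N ≃ U) :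
    ℕ → Sample R X → Fin N × ℝ
  | 0, _ => (0, 0)
  | n + 1, ω =>
    let d := (rrState F 𝒢 e n ω).1
    let Y := max (rrState F 𝒢 e n ω).2 0
      + mixLLR F 𝒢 (e d : Finset (Fin K)) ((e d : Finset (Fin K)).restrict (ω.2 n))
    (if Y ≤ 0 then d + 1 else d, Y)

/-- The sampling rule of Round Robin CUSUM (the set sampled at time `n + 1`). -/
def rrS (F : Measure (∀ k, X k)) (𝒢 : Set (Measure (∀ k, X k))) (e : Fin N ≃ U)
    (n : ℕ) (ω : Sample R X) : Finset (Fin K) :=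
  (e (rrState F 𝒢 e n ω).1 : Finset (Fin K))

/-- The alarm time of Round Robin CUSUM with threshold `A`: the first `n ≥ 1` with `Y_n ≥ A`. -/
def rrT (F : Measure (∀ k, X k)) (𝒢 : Set (Measure (∀ k, X k))) (e : Fin N ≃ U)
    (A : ℝ) (ω : Sample R X) : ℕ∞ :=
  sInf {t : ℕ∞ | ∃ n : ℕ, 1 ≤ n ∧ A ≤ (rrState F 𝒢 e n ω).2 ∧ t = n}

/-- The delay of Round Robin CUSUM with threshold `log γ`. -/
def rrDelay [MeasurableSpace R] (ρ : Measure R) (F : Measure (∀ k, X k))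
    (𝒢 : Set (Measure (∀ k, X k))) (G : Measure (∀ k, X k)) (m : ℕ) (e : Fin N ≃ U)
    (γ : ℝ) : ℝ≥0∞ :=
  delay ρ F G m (rrS F 𝒢 e) (rrT F 𝒢 e (Real.log γ))

/-- The asymptotic relative efficiency of Round Robin CUSUM under `G`. -/
def rrARE [MeasurableSpace R] (ρ : Measure R) (F : Measure (∀ k, X k))
    (𝒢 : Set (Measure (∀ k, X k))) (G : Measure (∀ k, X k)) (m : ℕ) (e : Fin N ≃ U) : ℝ≥0∞ :=
  limsup (fun γ : ℝ => rrDelay ρ F 𝒢 G m e γ / optimalDelay ρ F 𝒢 G m γ) atTop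

/-- Asymptotic optimality of Round Robin CUSUM under `G`: its delay and the optimal delay are
asymptotically equivalent. -/
def rrAsymptoticallyOptimal [MeasurableSpace R] (ρ : Measure R) (F : Measure (∀ k, X k))
    (𝒢 : Set (Measure (∀ k, X k))) (G : Measure (∀ k, X k)) (m : ℕ) (e : Fin N ≃ U) : Prop :=
  Tendsto (fun γ : ℝ => rrDelay ρ F 𝒢 G m e γ / optimalDelay ρ F 𝒢 G m γ) atTop (𝓝 1)

end RoundRobin

end

end QuickestDetection

open QuickestDetection

/-! Write a = log γ, I for the largest information number of an affected set, J for the smallest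
post-change drift of an affected unit. Two bounds give the result: Round Robin has delay at most (1
+ o(1)) a / J (`eventually_delay_rr_le`), and every policy in Δ(γ) has delay at least (1 - o(1)) a /
I (`eventually_le_optimalDelay`). Under the additional assumptions I = J, and the quotient is also
at least 1 because Round Robin itself belongs to Δ(γ): without a change exp(max(Y, 0)) grows in the
mean by at most one per step, as the likelihood ratio has mean one, so the mean time until Y reaches
a is at least exp(a) (`le_tsum_alive`).

Upper bound. After the change, the pair (unit, Y) is a Markov chain. A potential Φ that loses at
least one in the mean per step bounds the expected remaining time by its value at the change-point
(`tsum_alive_le_potential`, `exists_potential`). While an affected unit is sampled, Φ ≤ a / J' +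
O(1) for every value of Y, where J' < J is arbitrary. While an unaffected unit is sampled, Y must
first fall back to zero, so Φ may exceed this by a multiple of Y, which can be of order a. Here the
choice of the conditioning matters: the history omits the observations from unaffected sets, so,
given it and the absence of an alarm, Y is a random walk with negative drift, started at 0 and
conditioned to have stayed in (0, a). Its mean is o(a), uniformly in the duration
(`conditioned_mean_le`).

For that estimate the walk is tilted exponentially, with parameter θ, to a centered one. By the
central limit theorem, a centered walk can be steered below κ a without leaving (0, a) at a cost of
only exp(-2 κ a) (`centered_survival_le`). Undoing the tilt, the conditioned walk has exponential
moment of order θ at most exp(κ (2 + θ) a); as κ is arbitrary, its mean is below any given multiple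
of a.

Lower bound. If E_∞[T] ≥ γ and k < δ γ, some ν satisfies P_∞(ν < T ≤ ν + k) < δ P_∞(T > ν)
(`exists_unlikely_alarm`). A change of measure at ν transfers this to the post-change law, up to the
likelihood ratio of k observations (`lintegral_changeSeq_eq`). Its logarithm has centered increments
up to a drift of at most I per step, so by Chebyshev it rarely exceeds slightly more than k I. Hence
an alarm within k ≈ a / I steps of the change is unlikely (`le_delay_of_policy`). -/

namespace QuickestDetection

set_option linter.unusedSectionVars false

/-! ### Product laws, and integration of one observation at a time. -/

section ProductLaws

/-- Resampling one coordinate of a product measure does not change it. -/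
lemma infinitePi_map_update {ι : Type*} [DecidableEq ι] {V : ι → Type*}
    [∀ i, MeasurableSpace (V i)] (μ : ∀ i, Measure (V i)) [∀ i, IsProbabilityMeasure (μ i)]
    (i : ι) :
    ((Measure.infinitePi μ).prod (μ i)).map (fun p => Function.update p.1 i p.2) =
      Measure.infinitePi μ := by
  refine Measure.eq_infinitePi μ fun s t ht => ?_
  have hm : Measurable (fun p : (∀ j, V j) × V i => Function.update p.1 i p.2) := by
    fun_prop
  rw [Measure.map_apply hm (MeasurableSet.pi s.countable_toSet fun i _ => ht i)]
  by_cases hi : i ∈ s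
  · have : (fun p : (∀ j, V j) × V i => Function.update p.1 i p.2) ⁻¹' (Set.pi s t) =
        (Set.pi (s.erase i : Finset ι) t) ×ˢ t i := by
      ext p
      simp only [Set.mem_preimage, Set.mem_pi, Set.mem_prod, Finset.coe_erase, Set.mem_sdiff,
        Set.mem_singleton_iff, Finset.mem_coe]
      constructor
      · intro h
        refine ⟨fun j hj => ?_, ?_⟩
        · simpa [Function.update_of_ne hj.2] using h j hj.1
        · simpa using h i hi
      · rintro ⟨h1, h2⟩ j hj
        by_cases hji : j = i
        · subst hji; simpa using h2
        · simpa [Function.update_of_ne hji] using h1 j ⟨hj, hji⟩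
    rw [this, Measure.prod_prod, Measure.infinitePi_pi μ (fun i _ => ht i), mul_comm,
      Finset.mul_prod_erase s (fun i => μ i (t i)) hi]
  · have : (fun p : (∀ j, V j) × V i => Function.update p.1 i p.2) ⁻¹' (Set.pi s t) =
        (Set.pi s t) ×ˢ Set.univ := by
      ext p
      simp only [Set.mem_preimage, Set.mem_pi, Set.mem_prod, Set.mem_univ, and_true,
        Finset.mem_coe]
      refine forall₂_congr fun j hj => ?_
      have hji : j ≠ i := fun h => hi (h ▸ hj)
      simp [Function.update_of_ne hji]
    rw [this, Measure.prod_prod, Measure.infinitePi_pi μ (fun i _ => ht i)]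
    simp

/-- Since `f` ignores coordinate `i` of its first argument, `x i` may be replaced by an independent
copy. This form of Fubini takes the place of conditional expectations given the past. -/
lemma lintegral_infinitePi_step {ι : Type*} [DecidableEq ι] {V : ι → Type*}
    [∀ i, MeasurableSpace (V i)] (μ : ∀ i, Measure (V i)) [∀ i, IsProbabilityMeasure (μ i)]
    (i : ι) {f : (∀ j, V j) → V i → ℝ≥0∞} (hf : Measurable (Function.uncurry f))
    (hdep : ∀ x v w, f (Function.update x i v) w = f x w) :
    ∫⁻ x, f x (x i) ∂Measure.infinitePi μ = ∫⁻ x, ∫⁻ v, f x v ∂μ i ∂Measure.infinitePi μ := by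
  have hm : Measurable (fun p : (∀ j, V j) × V i => Function.update p.1 i p.2) := by
    fun_prop
  have hg : Measurable fun x : ∀ j, V j => f x (x i) :=
    hf.comp (measurable_id.prodMk (measurable_pi_apply i))
  conv_lhs => rw [← infinitePi_map_update μ i]
  rw [lintegral_map hg hm]
  refine (lintegral_prod _ (hg.comp hm).aemeasurable).trans ?_
  simp [hdep]

variable {R : Type*} [MeasurableSpace R] {K : ℕ} {X : Fin K → Type*} [∀ k, MeasurableSpace (X k)]

/-- The law under which the vectors are independent with distributions `μ 0, μ 1, …`. -/
noncomputable def seqLaw (ρ : Measure R) (μ : ℕ → Measure (∀ k, X k)) : Measure (Sample R X) :=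
  ρ.prod (Measure.infinitePi μ)

instance (ρ : Measure R) [IsProbabilityMeasure ρ] (μ : ℕ → Measure (∀ k, X k))
    [∀ n, IsProbabilityMeasure (μ n)] : IsProbabilityMeasure (seqLaw ρ μ) := by
  unfold seqLaw; infer_instance

/-- The sample with the vector number `n` replaced. -/
def resample (ω : Sample R X) (n : ℕ) (x : ∀ k, X k) : Sample R X :=
  (ω.1, Function.update ω.2 n x)

/-- Two samples agree on the randomization and the first `n` vectors. -/
def Agree (n : ℕ) (ω ω' : Sample R X) : Prop := ω.1 = ω'.1 ∧ ∀ i < n, ω.2 i = ω'.2 i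

lemma agree_resample (n : ℕ) (ω : Sample R X) (x : ∀ k, X k) : Agree n (resample ω n x) ω :=
  ⟨rfl, fun i hi => by simp [resample, Function.update_of_ne hi.ne]⟩

lemma Agree.mono {n k : ℕ} (h : n ≤ k) {ω ω' : Sample R X} (H : Agree k ω ω') : Agree n ω ω' :=
  ⟨H.1, fun i hi => H.2 i (hi.trans_le h)⟩

/-- The sigma-algebra of the events that depend on the randomization and the first `n` vectors. -/
@[reducible] def past (n : ℕ) : MeasurableSpace (Sample R X) where
  MeasurableSet' A := MeasurableSet A ∧ ∀ ω ω', Agree n ω ω' → ω ∈ A → ω' ∈ A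
  measurableSet_empty := ⟨MeasurableSet.empty, fun _ _ _ h => h⟩
  measurableSet_compl A hA := ⟨hA.1.compl, fun ω ω' h hω hω' =>
    hω (hA.2 ω' ω ⟨h.1.symm, fun i hi => (h.2 i hi).symm⟩ hω')⟩
  measurableSet_iUnion A hA := ⟨MeasurableSet.iUnion fun i => (hA i).1, fun ω ω' h hω => by
    obtain ⟨i, hi⟩ := Set.mem_iUnion.1 hω
    exact Set.mem_iUnion.2 ⟨i, (hA i).2 ω ω' h hi⟩⟩

lemma past_le (n : ℕ) : past (R := R) (X := X) n ≤ (inferInstance : MeasurableSpace (Sample R X)) := fun _ h => h.1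

lemma past_mono {n k : ℕ} (h : n ≤ k) : past (R := R) (X := X) n ≤ past k :=
  fun _ hA => ⟨hA.1, fun ω ω' H => hA.2 ω ω' (H.mono h)⟩

lemma mem_iff_of_agree {n : ℕ} {A : Set (Sample R X)} (hA : MeasurableSet[past n] A)
    {ω ω' : Sample R X} (h : Agree n ω ω') : ω ∈ A ↔ ω' ∈ A :=
  ⟨hA.2 _ _ h, hA.2 _ _ ⟨h.1.symm, fun i hi => (h.2 i hi).symm⟩⟩

lemma mem_resample {n : ℕ} {A : Set (Sample R X)} (hA : MeasurableSet[past n] A)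
    (ω : Sample R X) (x : ∀ k, X k) : resample ω n x ∈ A ↔ ω ∈ A :=
  mem_iff_of_agree hA (agree_resample n ω x)

lemma measurable_past {β : Type*} [MeasurableSpace β] {n : ℕ} {f : Sample R X → β}
    (hf : Measurable f) (h : ∀ ω ω', Agree n ω ω' → f ω = f ω') : Measurable[past n] f :=
  fun _ hs => ⟨hf hs, fun ω ω' H hω => by
    simp only [Set.mem_preimage] at hω ⊢; rwa [← h ω ω' H]⟩

lemma eq_of_agree {β : Type*} [MeasurableSpace β] [MeasurableSingletonClass β] {n : ℕ}
    {f : Sample R X → β} (hf : Measurable[past n] f) {ω ω' : Sample R X} (h : Agree n ω ω') :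
    f ω = f ω' :=
  ((hf (measurableSet_singleton (f ω))).2 ω ω' h rfl).symm

lemma eq_resample {β : Type*} [MeasurableSpace β] [MeasurableSingletonClass β] {n : ℕ}
    {f : Sample R X → β} (hf : Measurable[past n] f) (ω : Sample R X) (x : ∀ k, X k) :
    f (resample ω n x) = f ω :=
  eq_of_agree hf (agree_resample n ω x)

variable (ρ : Measure R) [IsProbabilityMeasure ρ] (μ μ' : ℕ → Measure (∀ k, X k))
  [∀ n, IsProbabilityMeasure (μ n)] [∀ n, IsProbabilityMeasure (μ' n)]

/-- Integrating out the vector number `n` when the rest does not depend on it. -/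
lemma lintegral_seqLaw_step (n : ℕ) {f : Sample R X → (∀ k, X k) → ℝ≥0∞}
    (hf : Measurable (Function.uncurry f)) (hdep : ∀ ω x y, f (resample ω n x) y = f ω y) :
    ∫⁻ ω, f ω (ω.2 n) ∂seqLaw ρ μ = ∫⁻ ω, ∫⁻ x, f ω x ∂μ n ∂seqLaw ρ μ := by
  have h1 : Measurable fun ω : Sample R X => f ω (ω.2 n) :=
    hf.comp (measurable_id.prodMk ((measurable_pi_apply n).comp measurable_snd))
  have h2 : Measurable fun ω : Sample R X => ∫⁻ x, f ω x ∂μ n := hf.lintegral_prod_right'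
  unfold seqLaw
  rw [lintegral_prod _ h1.aemeasurable, lintegral_prod _ h2.aemeasurable]
  refine lintegral_congr fun r => ?_
  refine lintegral_infinitePi_step μ n (f := fun x v => f (r, x) v) ?_ ?_
  · exact hf.comp ((measurable_const.prodMk measurable_fst).prodMk measurable_snd)
  · intro x v w
    exact hdep (r, x) v w

/-- An event of the past is not affected when all coordinates from `n` on are replaced by a fixed
point `x₀`, and this replacement maps both product laws to the same product law. -/
lemma seqLaw_congr_apply {n : ℕ} (h : ∀ i < n, μ i = μ' i) {A : Set (Sample R X)}
    (hA : MeasurableSet[past n] A) : seqLaw ρ μ A = seqLaw ρ μ' A := by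
  obtain ⟨x₀⟩ : Nonempty (∀ k, X k) := (μ 0).nonempty_of_neZero
  let c : ∀ i : ℕ, (∀ k, X k) → (∀ k, X k) := fun i x => if i < n then x else x₀
  have hc : ∀ i, Measurable (c i) := fun i => by
    by_cases hi : i < n
    · have : c i = id := by funext x; simp [c, hi]
      rw [this]; exact measurable_id
    · simp [c, hi]
  have hcm : Measurable fun x : ℕ → ∀ k, X k => fun i => c i (x i) :=
    measurable_pi_lambda _ fun i => (hc i).comp (measurable_pi_apply i)
  have hA' : ∀ ω : Sample R X, ω ∈ A ↔ ((ω.1, fun i => c i (ω.2 i)) : Sample R X) ∈ A :=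
    fun ω => mem_iff_of_agree hA ⟨rfl, fun i hi => by simp [c, hi]⟩
  have key : ∀ (κ : ℕ → Measure (∀ k, X k)) [∀ n, IsProbabilityMeasure (κ n)],
      seqLaw ρ κ A = (ρ.prod (Measure.infinitePi fun i => (κ i).map (c i))) A := by
    intro κ _
    have e := Measure.infinitePi_map_pi (μ := κ) (f := fun i => c i) hc
    rw [← e]
    have e2 := Measure.map_prod_map ρ (Measure.infinitePi κ) measurable_id hcm
    rw [Measure.map_id] at e2
    rw [e2, Measure.map_apply (by fun_prop) hA.1]
    unfold seqLaw
    congr 1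
    ext ω
    exact hA' ω
  rw [key μ, key μ']
  congr 3
  funext i
  by_cases hi : i < n
  · rw [h i hi]
  · simp only [c, hi, if_false]
    rw [Measure.map_const, Measure.map_const]
    simp

lemma lintegral_seqLaw_congr {n : ℕ} (h : ∀ i < n, μ i = μ' i) {f : Sample R X → ℝ≥0∞}
    (hf : Measurable[past n] f) : ∫⁻ ω, f ω ∂seqLaw ρ μ = ∫⁻ ω, f ω ∂seqLaw ρ μ' := by
  rw [← lintegral_trim (past_le n) hf, ← lintegral_trim (past_le n) hf]
  congr 1
  refine @Measure.ext _ (past n) _ _ fun A hA => ?_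
  rw [trim_measurableSet_eq _ hA, trim_measurableSet_eq _ hA, seqLaw_congr_apply ρ μ μ' h hA]

end ProductLaws

/-! ### Random walks killed on leaving an interval. -/

section KilledWalk

/-- The transition operator of the random walk with step distribution `μ`, killed when it leaves
the interval `(0, a)`. -/
noncomputable def killed (μ : Measure ℝ) (a : ℝ) (f : ℝ → ℝ≥0∞) (y : ℝ) : ℝ≥0∞ :=
  ∫⁻ x, (Set.Ioo 0 a).indicator f (y + x) ∂μ

variable {μ : Measure ℝ} {a : ℝ}

lemma measurable_killed [SFinite μ] {f : ℝ → ℝ≥0∞} (hf : Measurable f) :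
    Measurable (killed μ a f) := by
  unfold killed
  have : Measurable fun p : ℝ × ℝ => (Set.Ioo 0 a).indicator f (p.1 + p.2) :=
    (hf.indicator measurableSet_Ioo).comp (measurable_fst.add measurable_snd)
  exact this.lintegral_prod_right'

lemma measurable_killed_iterate [SFinite μ] {f : ℝ → ℝ≥0∞} (hf : Measurable f) (n : ℕ) :
    Measurable ((killed μ a)^[n] f) := by
  induction n generalizing f with
  | zero => exact hf
  | succ n ih => exact ih (measurable_killed hf)

lemma killed_mono {f g : ℝ → ℝ≥0∞} (h : f ≤ g) : killed μ a f ≤ killed μ a g := fun y =>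
  lintegral_mono fun x => Set.indicator_le_indicator (h (y + x))

lemma killed_iterate_mono {f g : ℝ → ℝ≥0∞} (h : f ≤ g) (n : ℕ) :
    (killed μ a)^[n] f ≤ (killed μ a)^[n] g := by
  induction n generalizing f g with
  | zero => exact h
  | succ n ih => exact ih (killed_mono h)

lemma killed_const_mul {f : ℝ → ℝ≥0∞} (c : ℝ≥0∞) (hc : c ≠ ∞) :
    killed μ a (fun y => c * f y) = fun y => c * killed μ a f y := by
  funext y
  unfold killed
  rw [← lintegral_const_mul' _ _ hc]
  refine lintegral_congr fun x => ?_
  by_cases h : y + x ∈ Set.Ioo 0 a <;> simp [h]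

lemma killed_iterate_const_mul {f : ℝ → ℝ≥0∞} (c : ℝ≥0∞) (hc : c ≠ ∞) (n : ℕ) :
    (killed μ a)^[n] (fun y => c * f y) = fun y => c * (killed μ a)^[n] f y := by
  induction n generalizing f with
  | zero => rfl
  | succ n ih => simp only [Function.iterate_succ_apply, killed_const_mul c hc, ih]

lemma killed_add [SFinite μ] {f g : ℝ → ℝ≥0∞} (hf : Measurable f) :
    killed μ a (fun y => f y + g y) = fun y => killed μ a f y + killed μ a g y := by
  funext y
  unfold killed
  have hm : Measurable fun x => (Set.Ioo 0 a).indicator f (y + x) :=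
    (hf.indicator measurableSet_Ioo).comp (measurable_const.add measurable_id)
  rw [← lintegral_add_left hm]
  refine lintegral_congr fun x => ?_
  by_cases h : y + x ∈ Set.Ioo 0 a <;> simp [h]

lemma killed_iterate_add [SFinite μ] {f g : ℝ → ℝ≥0∞} (hf : Measurable f) (n : ℕ) :
    (killed μ a)^[n] (fun y => f y + g y) =
      fun y => (killed μ a)^[n] f y + (killed μ a)^[n] g y := by
  induction n generalizing f g with
  | zero => rfl
  | succ n ih => simp only [Function.iterate_succ_apply, killed_add hf, ih (measurable_killed hf)]

lemma killed_le_one [IsProbabilityMeasure μ] : killed μ a 1 ≤ 1 := fun y => by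
  unfold killed
  calc ∫⁻ x, (Set.Ioo 0 a).indicator 1 (y + x) ∂μ
      ≤ ∫⁻ _, 1 ∂μ := lintegral_mono fun x => Set.indicator_le_self _ _ _
    _ = 1 := by simp

lemma killed_iterate_le_one [IsProbabilityMeasure μ] (n : ℕ) : (killed μ a)^[n] 1 ≤ 1 := by
  induction n with
  | zero => exact le_rfl
  | succ n ih => exact (killed_iterate_mono killed_le_one n).trans ih

/-- If all steps into `S` lead from `y` to points of `(0, a)` where `f ≥ s`, then
`μ S * s` bounds the operator from below. -/
lemma le_killed {f : ℝ → ℝ≥0∞} {y : ℝ} {S : Set ℝ} (hS : MeasurableSet S) {s : ℝ≥0∞}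
    (h : ∀ x ∈ S, y + x ∈ Set.Ioo 0 a ∧ s ≤ f (y + x)) : μ S * s ≤ killed μ a f y := by
  unfold killed
  calc μ S * s = ∫⁻ _ in S, s ∂μ := by simp [mul_comm]
    _ ≤ ∫⁻ x in S, (Set.Ioo 0 a).indicator f (y + x) ∂μ :=
        setLIntegral_mono' hS fun x hx => by simp [(h x hx).1, (h x hx).2]
    _ ≤ _ := setLIntegral_le_lintegral _ _

/-- Iterated steps of size between `c` and `C`. -/
lemma pow_mul_le_killed_iterate {c C : ℝ} (n : ℕ) {f : ℝ → ℝ≥0∞} {y : ℝ}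
    {s : ℝ≥0∞} (h0 : ∀ k ≤ n, 1 ≤ k → 0 < y + k * c ∧ y + k * C < a)
    (h : ∀ z, y + n * c ≤ z → z ≤ y + n * C → s ≤ f z) :
    μ (Set.Icc c C) ^ n * s ≤ (killed μ a)^[n] f y := by
  induction n generalizing f s with
  | zero => simpa using h y (by simp) (by simp)
  | succ n ih =>
    rw [Function.iterate_succ_apply, pow_succ, mul_assoc]
    refine ih (fun k hk => h0 k (by omega)) fun z hz1 hz2 => ?_
    refine le_killed measurableSet_Icc fun x hx => ?_
    have h1 := h0 (n + 1) le_rfl (by omega)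
    push_cast at h1 h
    exact ⟨⟨by linarith [hx.1, h1.1], by linarith [hx.2, h1.2]⟩,
      h _ (by linarith [hx.1]) (by linarith [hx.2])⟩

/-- The walk with truncated steps, without killing, bounds the killed walk from below as long as
it cannot leave the interval. -/
lemma lintegral_le_killed_iterate [IsProbabilityMeasure μ] {C : ℝ} (hC : 0 ≤ C) (M : ℕ)
    {f : ℝ → ℝ≥0∞} (hf : Measurable f) {y : ℝ} (h1 : M * C < y) (h2 : y + M * C < a) :
    ∫⁻ x in {x : ℕ → ℝ | ∀ i < M, |x i| ≤ C}, f (y + ∑ i ∈ Finset.range M, x i)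
      ∂Measure.infinitePi (fun _ => μ) ≤ (killed μ a)^[M] f y := by
  induction M generalizing f with
  | zero => simp
  | succ M ih =>
    push_cast at h1 h2
    have hms : ∀ M : ℕ, MeasurableSet {x : ℕ → ℝ | ∀ i < M, |x i| ≤ C} := fun M => by
      have : {x : ℕ → ℝ | ∀ i < M, |x i| ≤ C} = ⋂ i, ⋂ (_ : i < M), {x | |x i| ≤ C} := by
        ext; simp
      rw [this]
      exact MeasurableSet.iInter fun i => MeasurableSet.iInter fun _ =>
        measurableSet_le (by fun_prop) measurable_const
    have hm1 : Measurable fun p : (ℕ → ℝ) × ℝ => f (y + (∑ i ∈ Finset.range M, p.1 i + p.2)) :=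
      hf.comp (by fun_prop)
    rw [← lintegral_indicator (hms _), Function.iterate_succ_apply]
    -- The innermost application of the operator is the last step of the walk, so coordinate `M` is
    -- split off and integrated out.
    let g : (ℕ → ℝ) → ℝ → ℝ≥0∞ := fun x v =>
      ({x : ℕ → ℝ | ∀ i < M, |x i| ≤ C} ×ˢ {v : ℝ | |v| ≤ C}).indicator
          (fun p => f (y + (∑ i ∈ Finset.range M, p.1 i + p.2))) (x, v)
    have e : ∀ x : ℕ → ℝ, ({x : ℕ → ℝ | ∀ i < M + 1, |x i| ≤ C}).indicator
        (fun x => f (y + ∑ i ∈ Finset.range (M + 1), x i)) x = g x (x M) := by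
      intro x
      simp only [g, Set.indicator, Set.mem_ofPred_eq, Set.mem_prod, Finset.sum_range_succ]
      congr 1
      apply propext
      constructor
      · intro h; exact ⟨fun i hi => h i (by omega), h M (by omega)⟩
      · rintro ⟨h, h'⟩ i hi
        rcases Nat.lt_succ_iff_lt_or_eq.1 hi with hi | rfl
        exacts [h i hi, h']
    rw [lintegral_congr e, lintegral_infinitePi_step (fun _ : ℕ => μ) M (f := g)]
    · refine le_trans ?_ (ih (measurable_killed hf) (by nlinarith) (by nlinarith))
      rw [← lintegral_indicator (hms _)]
      refine lintegral_mono fun x => ?_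
      by_cases hx : x ∈ {x : ℕ → ℝ | ∀ i < M, |x i| ≤ C}
      · rw [Set.indicator_of_mem hx]
        unfold killed
        refine lintegral_mono fun v => ?_
        by_cases hv : |v| ≤ C
        · have hs : |∑ i ∈ Finset.range M, x i| ≤ M * C := by
            refine (Finset.abs_sum_le_sum_abs _ _).trans ?_
            refine (Finset.sum_le_sum fun i hi => hx i (Finset.mem_range.1 hi)).trans ?_
            simp
          have := abs_le.1 hs
          have := abs_le.1 hv
          simp only [g]
          have hmem : (x, v) ∈ {x : ℕ → ℝ | ∀ i < M, |x i| ≤ C} ×ˢ {v : ℝ | |v| ≤ C} :=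
            Set.mem_prod.2 ⟨hx, hv⟩
          rw [Set.indicator_of_mem hmem, Set.indicator_of_mem, add_assoc]
          constructor <;> linarith
        · simp only [g]
          rw [Set.indicator_of_notMem fun h => hv h.2]
          exact zero_le
      · have : ∀ v, (x, v) ∉ {x : ℕ → ℝ | ∀ i < M, |x i| ≤ C} ×ˢ {v : ℝ | |v| ≤ C} :=
          fun v h => hx h.1
        simp [g, Set.indicator_of_notMem (this _)]
    · exact hm1.indicator ((hms M).prod (measurableSet_le (by fun_prop) measurable_const))
    · intro x v w
      have e1 : (Function.update x M v ∈ {x : ℕ → ℝ | ∀ i < M, |x i| ≤ C}) =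
          (x ∈ {x : ℕ → ℝ | ∀ i < M, |x i| ≤ C}) := by
        refine propext (forall₂_congr fun i hi => ?_)
        rw [Function.update_of_ne hi.ne]
      have e2 : ∑ i ∈ Finset.range M, Function.update x M v i = ∑ i ∈ Finset.range M, x i :=
        Finset.sum_congr rfl fun i hi => Function.update_of_ne (Finset.mem_range.1 hi).ne _ _
      simp only [g, Set.indicator, Set.mem_prod, e1, e2]

end KilledWalk

/-! ### Cheap moves of a centered walk over large distances. -/

section CenteredWalk

variable {μ : Measure ℝ} [IsProbabilityMeasure μ]

/-- Central limit theorem and portmanteau: the Gaussian limit has positive variance, hence charges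
every non-empty open set. -/
lemma exists_pos_le_scaled_sum (h2 : MemLp id 2 μ) (h0 : ∫ x, x ∂μ = 0) (hv : Var[id; μ] ≠ 0)
    {G : Set ℝ} (hG : IsOpen G) (hne : G.Nonempty) :
    ∃ p : ℝ≥0∞, p ≠ 0 ∧ ∀ᶠ M : ℕ in atTop, p ≤ Measure.infinitePi (fun _ : ℕ => μ)
      {x | (√(M : ℝ))⁻¹ * ∑ i ∈ Finset.range M, x i ∈ G} := by
  set P := Measure.infinitePi (fun _ : ℕ => μ)
  have hident : ∀ i : ℕ, IdentDistrib (fun x : ℕ → ℝ => x i) (fun x : ℕ → ℝ => x 0) P P := fun i =>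
    ⟨(measurable_pi_apply i).aemeasurable, (measurable_pi_apply 0).aemeasurable, by
      simp only [P]
      rw [Measure.infinitePi_map_eval, Measure.infinitePi_map_eval]⟩
  have hmp : MeasurePreserving (fun x : ℕ → ℝ => x 0) P μ :=
    measurePreserving_eval_infinitePi (fun _ : ℕ => μ) 0
  have hvar : Var[fun x : ℕ → ℝ => x 0; P] = Var[id; μ] := by
    rw [← hmp.map_eq, variance_map aemeasurable_id hmp.measurable.aemeasurable]
    rfl
  have hint : ∫ x : ℕ → ℝ, x 0 ∂P = 0 := by
    have := integral_map (μ := P) (φ := fun x : ℕ → ℝ => x 0) (f := fun x : ℝ => x)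
      (measurable_pi_apply 0).aemeasurable (by fun_prop)
    rw [← this, hmp.map_eq, h0]
  have hclt := tendstoInDistribution_inv_sqrt_mul_sum_sub (P := P)
    (P' := gaussianReal 0 (Var[fun x : ℕ → ℝ => x 0; P]).toNNReal) (X := fun i x => x i) (Y := id)
    ⟨by fun_prop, by simp⟩
    (by
      have := h2.comp_measurePreserving hmp
      exact this)
    (iIndepFun_infinitePi (X := fun _ ω => ω) (by fun_prop)) hident
  have hl := ProbabilityMeasure.le_liminf_measure_open_of_tendsto hclt.tendsto hG
  set q := gaussianReal 0 (Var[fun x : ℕ → ℝ => x 0; P]).toNNReal G with hq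
  have hvne : (Var[fun x : ℕ → ℝ => x 0; P]).toNNReal ≠ 0 := by
    rw [hvar]
    have := variance_nonneg id μ
    intro h
    exact hv (le_antisymm (Real.toNNReal_eq_zero.1 h) this)
  have hq0 : q ≠ 0 := fun h =>
    (hG.measure_pos volume hne).ne' (gaussianReal_absolutelyContinuous' 0 hvne h)
  have hqt : q ≠ ∞ := measure_ne_top _ _
  refine ⟨q / 2, (ENNReal.half_pos hq0).ne', ?_⟩
  have hlt : q / 2 < q := ENNReal.half_lt_self hq0 hqt
  simp only [ProbabilityMeasure.coe_mk, Measure.map_id] at hl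
  have := eventually_lt_of_lt_liminf (hlt.trans_le hl)
  filter_upwards [this] with M hM
  refine hM.le.trans (le_of_eq ?_)
  rw [Measure.map_apply (by fun_prop) hG.measurableSet]
  congr 1
  ext x
  simp [hint]

/-- Continuity from below. Truncated steps give a deterministic bound on how far the walk strays
within a block, which keeps it inside the interval. -/
lemma exists_truncation {M : ℕ} {S : Set (ℕ → ℝ)} {p : ℝ≥0∞}
    (h : p < Measure.infinitePi (fun _ : ℕ => μ) S) :
    ∀ᶠ C : ℕ in atTop, p < Measure.infinitePi (fun _ : ℕ => μ)
      (S ∩ {x | ∀ i < M, |x i| ≤ C}) := by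
  have hmono : Monotone fun C : ℕ => S ∩ {x : ℕ → ℝ | ∀ i < M, |x i| ≤ C} := by
    intro C D hCD x hx
    exact ⟨hx.1, fun i hi => (hx.2 i hi).trans (by exact_mod_cast hCD)⟩
  have hU : ⋃ C : ℕ, S ∩ {x : ℕ → ℝ | ∀ i < M, |x i| ≤ C} = S := by
    ext x
    simp only [Set.mem_iUnion, Set.mem_inter_iff]
    refine ⟨fun ⟨C, h⟩ => h.1, fun hx => ?_⟩
    obtain ⟨C, hC⟩ := exists_nat_ge (∑ i ∈ Finset.range M, |x i|)
    exact ⟨C, hx, fun i hi => (Finset.single_le_sum (f := fun i => |x i|)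
      (fun _ _ => abs_nonneg _) (Finset.mem_range.2 hi)).trans hC⟩
  have := tendsto_measure_iUnion_atTop (μ := Measure.infinitePi (fun _ : ℕ => μ)) hmono
  rw [hU] at this
  exact this.eventually_const_lt h

/-- A centered random walk makes moves of a large size `B`, upwards and downwards, at a cost
that is exponentially small with an arbitrarily small rate. -/
lemma exists_block (h2 : MemLp id 2 μ) (h0 : ∫ x, x ∂μ = 0) (hv : Var[id; μ] ≠ 0)
    {κ : ℝ} (hκ : 0 < κ) :
    ∃ (M : ℕ) (B C : ℝ), 0 < M ∧ 0 < B ∧ 0 < C ∧ B ≤ M * C ∧ μ (Set.Icc (-C) C) ≠ 0 ∧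
      ∀ (a : ℝ) (f : ℝ → ℝ≥0∞) (_ : Measurable f) (y : ℝ) (s : ℝ≥0∞),
        M * C < y → y + M * C < a →
        ((∀ z, y - M * C ≤ z → z ≤ y - B → s ≤ f z) →
          ENNReal.ofReal (Real.exp (-κ * B)) * s ≤ (killed μ a)^[M] f y) ∧
        ((∀ z, y + B ≤ z → z ≤ y + M * C → s ≤ f z) →
          ENNReal.ofReal (Real.exp (-κ * B)) * s ≤ (killed μ a)^[M] f y) := by
  obtain ⟨p1, hp1, H1⟩ := exists_pos_le_scaled_sum h2 h0 hv (isOpen_Iio (a := (-1 : ℝ)))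
    Set.nonempty_Iio
  obtain ⟨p2, hp2, H2⟩ := exists_pos_le_scaled_sum h2 h0 hv (isOpen_Ioi (a := (1 : ℝ)))
    Set.nonempty_Ioi
  -- A block of `M` steps moves by `B = √M` with a probability bounded away from zero, while exp(-κ
  -- √M) tends to zero.
  have hlim : Tendsto (fun M : ℕ => ENNReal.ofReal (Real.exp (-κ * √(M : ℝ)))) atTop (𝓝 0) := by
    rw [← ENNReal.ofReal_zero]
    refine ENNReal.tendsto_ofReal (Real.tendsto_exp_atBot.comp ?_)
    exact (Real.tendsto_sqrt_atTop.comp tendsto_natCast_atTop_atTop).const_mul_atTop_of_neg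
      (by linarith)
  obtain ⟨M, hM1, hM2, hM3, hM4, hM5⟩ := (H1.and (H2.and
    ((hlim.eventually_lt_const (pos_iff_ne_zero.2 hp1)).and
    ((hlim.eventually_lt_const (pos_iff_ne_zero.2 hp2)).and (eventually_ge_atTop 1))))).exists
  have hMpos : (0 : ℝ) < √(M : ℝ) := Real.sqrt_pos.2 (by exact_mod_cast hM5)
  have e1 := exists_truncation (M := M) (hM3.trans_le hM1)
  have e2 := exists_truncation (M := M) (hM4.trans_le hM2)
  -- A truncation level above √M ensures `B ≤ M * C`.
  obtain ⟨n, hn⟩ := exists_nat_ge √(M : ℝ)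
  obtain ⟨C, hC1, hC2, hC3⟩ := (e1.and (e2.and (eventually_ge_atTop (max 1 n)))).exists
  have hCpos : (0 : ℝ) < C := by
    have : 1 ≤ C := (le_max_left _ _).trans hC3
    exact_mod_cast this
  have hM1' : (1 : ℝ) ≤ M := by exact_mod_cast hM5
  have hBC : √(M : ℝ) ≤ M * C := by
    have : (n : ℝ) ≤ C := by exact_mod_cast (le_max_right _ _).trans hC3
    nlinarith
  refine ⟨M, √(M : ℝ), C, hM5, hMpos, hCpos, hBC, ?_, ?_⟩
  · intro h
    -- If no single step could lie in [-C, C], the truncated event, which has positive probability,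
    -- would be null.
    refine (zero_le.trans_lt hC1).ne' (measure_mono_null
      (t := (fun x : ℕ → ℝ => x 0) ⁻¹' Set.Icc (-(C : ℝ)) C) ?_ ?_)
    · intro x hx
      exact abs_le.1 (hx.2 0 hM5)
    · rw [(measurePreserving_eval_infinitePi (fun _ : ℕ => μ) 0).measure_preimage
        measurableSet_Icc.nullMeasurableSet]
      exact h
  · intro a f hf y s hy1 hy2
    have key := lintegral_le_killed_iterate (μ := μ) hCpos.le M hf hy1 hy2
    have main : ∀ S : Set (ℕ → ℝ), MeasurableSet S →
        ENNReal.ofReal (Real.exp (-κ * √(M : ℝ))) < Measure.infinitePi (fun _ : ℕ => μ)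
          (S ∩ {x | ∀ i < M, |x i| ≤ C}) →
        (∀ x ∈ S ∩ {x : ℕ → ℝ | ∀ i < M, |x i| ≤ C}, s ≤ f (y + ∑ i ∈ Finset.range M, x i)) →
        ENNReal.ofReal (Real.exp (-κ * √(M : ℝ))) * s ≤ (killed μ a)^[M] f y := by
      intro S hS hlt hs
      refine le_trans ?_ key
      have hms : MeasurableSet {x : ℕ → ℝ | ∀ i < M, |x i| ≤ C} := by
        have : {x : ℕ → ℝ | ∀ i < M, |x i| ≤ C} = ⋂ i, ⋂ (_ : i < M), {x | |x i| ≤ (C : ℝ)} := by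
          ext; simp
        rw [this]
        exact MeasurableSet.iInter fun i => MeasurableSet.iInter fun _ =>
          measurableSet_le (by fun_prop) measurable_const
      calc ENNReal.ofReal (Real.exp (-κ * √(M : ℝ))) * s
          ≤ Measure.infinitePi (fun _ : ℕ => μ) (S ∩ {x | ∀ i < M, |x i| ≤ C}) * s := by
            gcongr
        _ = ∫⁻ _ in S ∩ {x | ∀ i < M, |x i| ≤ C}, s ∂Measure.infinitePi (fun _ : ℕ => μ) := by
            simp [mul_comm]
        _ ≤ ∫⁻ x in S ∩ {x | ∀ i < M, |x i| ≤ C}, f (y + ∑ i ∈ Finset.range M, x i)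
              ∂Measure.infinitePi (fun _ : ℕ => μ) := setLIntegral_mono' (hS.inter hms) hs
        _ ≤ _ := lintegral_mono_set Set.inter_subset_right
    have hsum : ∀ x ∈ {x : ℕ → ℝ | ∀ i < M, |x i| ≤ C},
        |∑ i ∈ Finset.range M, x i| ≤ M * C := fun x hx => by
      refine (Finset.abs_sum_le_sum_abs _ _).trans ?_
      refine (Finset.sum_le_sum fun i hi => hx i (Finset.mem_range.1 hi)).trans ?_
      simp
    have hsum_meas : Measurable fun x : ℕ → ℝ => (√(M : ℝ))⁻¹ * ∑ i ∈ Finset.range M, x i := by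
      fun_prop
    constructor
    · intro hs
      refine main _ (hsum_meas measurableSet_Iio) hC1 fun x hx => ?_
      have h1 := abs_le.1 (hsum x hx.2)
      have h2 : (√(M : ℝ))⁻¹ * ∑ i ∈ Finset.range M, x i < -1 := hx.1
      rw [inv_mul_lt_iff₀ hMpos] at h2
      exact hs _ (by linarith) (by linarith)
    · intro hs
      refine main _ (hsum_meas measurableSet_Ioi) hC2 fun x hx => ?_
      have h1 := abs_le.1 (hsum x hx.2)
      have h2 : 1 < (√(M : ℝ))⁻¹ * ∑ i ∈ Finset.range M, x i := hx.1
      rw [lt_inv_mul_iff₀ hMpos] at h2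
      exact hs _ (by linarith) (by linarith)

end CenteredWalk

/-! ### Steering a centered walk to low levels inside the interval. -/

section CenteredChain

variable {μ : Measure ℝ} [IsProbabilityMeasure μ]

/-- Blocks of moves towards a level `h` bring the walk below `h + D`. -/
lemma pow_mul_le_killed_iterate_blocks {a B D h : ℝ} {q : ℝ≥0∞} {M : ℕ} (hB : 0 < B) (hBD : B ≤ D)
    (hDh : 3 * D ≤ h) (hha : h + 3 * D ≤ a)
    (hblock : ∀ (f : ℝ → ℝ≥0∞) (_ : Measurable f) (y : ℝ) (s : ℝ≥0∞), D < y → y + D < a →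
        ((∀ z, y - D ≤ z → z ≤ y - B → s ≤ f z) → q * s ≤ (killed μ a)^[M] f y) ∧
        ((∀ z, y + B ≤ z → z ≤ y + D → s ≤ f z) → q * s ≤ (killed μ a)^[M] f y))
    (k : ℕ) {f : ℝ → ℝ≥0∞} (hf : Measurable f) {y u : ℝ} {s : ℝ≥0∞} (hy1 : 2 * D ≤ y)
    (hyu : y ≤ u) (hu : u ≤ a - 2 * D)
    (hs : ∀ z, 2 * D ≤ z → z ≤ max (u - k * B) (h + D) → s ≤ f z) :
    q ^ k * s ≤ (killed μ a)^[M * k] f y := by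
  induction k generalizing y u with
  | zero => simpa using hs y hy1 (by simp [hyu])
  | succ k ih =>
    have hblk := hblock ((killed μ a)^[M * k] f) (measurable_killed_iterate hf _) y (q ^ k * s)
      (by linarith) (by linarith)
    have e : (killed μ a)^[M * (k + 1)] f y = (killed μ a)^[M] ((killed μ a)^[M * k] f) y := by
      rw [← Function.iterate_add_apply, Nat.mul_succ, Nat.add_comm]
    rw [e, pow_succ', mul_assoc]
    have hs' : ∀ z, 2 * D ≤ z → z ≤ max (max (u - B) (h + D) - k * B) (h + D) → s ≤ f z := by
      intro z hz1 hz2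
      refine hs z hz1 (hz2.trans (max_le ?_ (le_max_right _ _)))
      rw [sub_le_iff_le_add]
      push_cast
      have : 0 ≤ k * B := by positivity
      refine max_le ?_ ?_
      · have := le_max_left (u - (k + 1) * B) (h + D)
        linarith
      · have := le_max_right (u - (k + 1) * B) (h + D)
        linarith
    have hstep : ∀ z, 2 * D ≤ z → z ≤ max (u - B) (h + D) →
        q ^ k * s ≤ (killed μ a)^[M * k] f z := fun z hz1 hz2 =>
      ih hz1 hz2 (max_le (by linarith) (by linarith)) hs'
    -- From above `h` the block goes down, from below it goes up. In both cases the walk stays above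
    -- `2 * D`, and its upper bound falls by `B` unless it is already of size `h + D`.
    rcases le_or_gt h y with hhy | hhy
    · refine hblk.1 fun z hz1 hz2 => hstep z (by linarith) ?_
      exact (show z ≤ u - B by linarith).trans (le_max_left _ _)
    · refine hblk.2 fun z hz1 hz2 => hstep z (by linarith) ?_
      exact (show z ≤ h + D by linarith).trans (le_max_right _ _)

/-- A non-degenerate centered law charges both half-lines, and these are exhausted by the intervals
with ends 1 / (n + 1) and n + 1, up to sign. -/
lemma exists_Icc_pos (h0 : ∫ x, x ∂μ = 0) (hint : Integrable id μ) (hv : Var[id; μ] ≠ 0) :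
    ∃ c C : ℝ, 0 < c ∧ c ≤ C ∧ μ (Set.Icc c C) ≠ 0 ∧ μ (Set.Icc (-C) (-c)) ≠ 0 := by
  have hne : ¬ (id : ℝ → ℝ) =ᵐ[μ] 0 := fun h => hv (by
    rw [variance_congr h]; exact variance_zero μ)
  have hpos : μ (Set.Ioi 0) ≠ 0 := fun h => by
    refine hne ?_
    have h1 : 0 ≤ᵐ[μ] fun x : ℝ => -x := by
      have : ∀ᵐ x ∂μ, x ∉ Set.Ioi (0 : ℝ) := measure_eq_zero_iff_ae_notMem.1 h
      filter_upwards [this] with x hx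
      simpa using hx
    have h2 := (integral_eq_zero_iff_of_nonneg_ae h1 hint.neg).1 (by rw [integral_neg, h0, neg_zero])
    filter_upwards [h2] with x hx
    simpa using hx
  have hneg : μ (Set.Iio 0) ≠ 0 := fun h => by
    refine hne ?_
    have h1 : 0 ≤ᵐ[μ] fun x : ℝ => x := by
      have : ∀ᵐ x ∂μ, x ∉ Set.Iio (0 : ℝ) := measure_eq_zero_iff_ae_notMem.1 h
      filter_upwards [this] with x hx
      simpa using hx
    exact (integral_eq_zero_iff_of_nonneg_ae h1 hint).1 h0
  have hm : Monotone fun n : ℕ => Set.Icc ((n : ℝ) + 1)⁻¹ ((n : ℝ) + 1) := fun i j hij => by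
    have : (i : ℝ) ≤ j := by exact_mod_cast hij
    exact Set.Icc_subset_Icc (inv_anti₀ (by positivity) (by linarith)) (by linarith)
  have hm' : Monotone fun n : ℕ => Set.Icc (-((n : ℝ) + 1)) (-((n : ℝ) + 1)⁻¹) := fun i j hij => by
    have : (i : ℝ) ≤ j := by exact_mod_cast hij
    exact Set.Icc_subset_Icc (by linarith) (neg_le_neg (inv_anti₀ (by positivity) (by linarith)))
  have hbig : ∀ x : ℝ, 0 < x → ∃ n : ℕ, ((n : ℝ) + 1)⁻¹ ≤ x ∧ x ≤ (n : ℝ) + 1 := fun x hx => by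
    obtain ⟨n, hn⟩ := exists_nat_ge (max x x⁻¹)
    have h1 := (le_max_left _ _).trans hn
    have h2 := (le_max_right _ _).trans hn
    refine ⟨n, ?_, by linarith⟩
    rw [inv_le_comm₀ (by positivity) hx]
    linarith
  have hU : Set.Ioi (0 : ℝ) ⊆ ⋃ n : ℕ, Set.Icc ((n : ℝ) + 1)⁻¹ ((n : ℝ) + 1) := fun x hx => by
    obtain ⟨n, hn⟩ := hbig x hx
    exact Set.mem_iUnion.2 ⟨n, hn⟩
  have hU' : Set.Iio (0 : ℝ) ⊆ ⋃ n : ℕ, Set.Icc (-((n : ℝ) + 1)) (-((n : ℝ) + 1)⁻¹) := fun x hx => by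
    obtain ⟨n, hn⟩ := hbig (-x) (by simpa using hx)
    exact Set.mem_iUnion.2 ⟨n, by linarith [hn.2], by linarith [hn.1]⟩
  have t1 := (tendsto_measure_iUnion_atTop (μ := μ) hm).eventually_const_lt
    ((pos_iff_ne_zero.2 hpos).trans_le (measure_mono hU))
  have t2 := (tendsto_measure_iUnion_atTop (μ := μ) hm').eventually_const_lt
    ((pos_iff_ne_zero.2 hneg).trans_le (measure_mono hU'))
  obtain ⟨n, h1, h2⟩ := (t1.and t2).exists
  refine ⟨((n : ℝ) + 1)⁻¹, (n : ℝ) + 1, by positivity, ?_, h1.ne', h2.ne'⟩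
  have : ((n : ℝ) + 1)⁻¹ ≤ 1 := inv_le_one_of_one_le₀ (by linarith [n.cast_nonneg (α := ℝ)])
  linarith [n.cast_nonneg (α := ℝ)]

/-- From every point of `(0, a)`, a centered walk gets, without leaving `(0, a)`, to a point below
`κ a` at a cost that is at most exponential in `a` with rate `2 κ`. -/
lemma exists_killed_iterate_lower (h2 : MemLp id 2 μ) (h0 : ∫ x, x ∂μ = 0) (hv : Var[id; μ] ≠ 0)
    {κ : ℝ} (hκ : 0 < κ) (hκ1 : κ < 1) :
    ∃ a₀ : ℝ, ∀ a ≥ a₀, ∃ n₀ : ℕ,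
      (∀ y, 0 ≤ y → y < a → ENNReal.ofReal (Real.exp (-(2 * κ * a))) ≤
        (killed μ a)^[n₀] ((Set.Iic (κ * a)).indicator 1) y) ∧
      (∀ j ≤ n₀, ENNReal.ofReal (Real.exp (-(2 * κ * a))) ≤
        (killed μ a)^[j] ((Set.Iic (κ * a)).indicator 1) 0) := by
  obtain ⟨M, B, C, hM, hB, hC, hBC, hpC, hblock⟩ := exists_block h2 h0 hv hκ
  obtain ⟨c, C', hc, hcC', hp1, hp2⟩ := exists_Icc_pos h0 (h2.integrable one_le_two) hv
  set D := M * C with hD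
  have hDpos : 0 < D := hB.trans_le hBC
  have hM' : (1 : ℝ) ≤ M := by exact_mod_cast hM
  set q := ENNReal.ofReal (Real.exp (-κ * B)) with hq
  -- `k₀` steps of one sign bring the walk from the boundary to distance at least `2 * D`, where
  -- blocks are allowed.
  obtain ⟨k₀, hk₀⟩ := exists_nat_ge (2 * D / c)
  have hk₀' : 2 * D ≤ k₀ * c := by rwa [div_le_iff₀ hc] at hk₀
  have hC'pos : 0 < C' := hc.trans_le hcC'
  have hk₀C : 2 * D ≤ k₀ * C' := hk₀'.trans (by gcongr)
  set p := min (μ (Set.Icc c C')) (μ (Set.Icc (-C') (-c))) with hp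
  have hp0 : p ≠ 0 := by simp [hp, hp1, hp2]
  have hple : p ≤ 1 := (min_le_left _ _).trans prob_le_one
  set r := μ (Set.Icc (-C) C) with hr
  have hrle : r ≤ 1 := prob_le_one
  -- the constant
  obtain ⟨t, ht⟩ : ∃ t : ℝ, ENNReal.ofReal (Real.exp (-t)) ≤ p ^ k₀ * r ^ M := by
    have hne : p ^ k₀ * r ^ M ≠ 0 := mul_ne_zero (pow_ne_zero _ hp0) (pow_ne_zero _ hpC)
    have : Tendsto (fun t : ℝ => ENNReal.ofReal (Real.exp (-t))) atTop (𝓝 0) := by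
      rw [← ENNReal.ofReal_zero]
      exact ENNReal.tendsto_ofReal Real.tendsto_exp_neg_atTop_nhds_zero
    obtain ⟨t, ht⟩ := (this.eventually_lt_const (pos_iff_ne_zero.2 hne)).exists
    exact ⟨t, ht.le⟩
  -- The first entry absorbs the costs that do not depend on `a` into exp(-κ a). The second makes
  -- all moves of fixed length fit into κ a / 2, hence also into a / 2.
  refine ⟨max ((t + κ * B) / κ) (2 * (k₀ * C' + 3 * D) / κ + 2 * (k₀ * C' + 3 * D)), fun a ha => ?_⟩
  have ha1 : t + κ * B ≤ κ * a := by
    have := (le_max_left _ _).trans ha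
    rw [div_le_iff₀ hκ] at this; linarith
  have ha2 : 2 * (k₀ * C' + 3 * D) / κ + 2 * (k₀ * C' + 3 * D) ≤ a := (le_max_right _ _).trans ha
  have hW : 0 < 2 * (k₀ * C' + 3 * D) := by positivity
  have ha3 : 2 * (k₀ * C' + 3 * D) ≤ κ * a := by
    have h1 : 2 * (k₀ * C' + 3 * D) / κ ≤ a := by linarith
    rw [div_le_iff₀ hκ] at h1; linarith
  have ha4 : 2 * (k₀ * C' + 3 * D) ≤ a := by
    have : 0 < 2 * (k₀ * C' + 3 * D) / κ := by positivity
    linarith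
  have hκa : κ * a ≤ a := by nlinarith
  have hapos : 0 < a := by linarith
  set h := κ * a / 2 with hh
  set f : ℝ → ℝ≥0∞ := (Set.Iic (κ * a)).indicator 1 with hf
  have hfm : Measurable f := measurable_one.indicator measurableSet_Iic
  -- final small steps
  have hsmall : ∀ ρ ≤ M, ∀ z, 2 * D ≤ z → z ≤ κ * a - D → z + D < a →
      r ^ M ≤ (killed μ a)^[ρ] f z := by
    intro ρ hρ z hz1 hz2 hz3
    have hρ' : (ρ : ℝ) * C ≤ D := by
      have : (ρ : ℝ) ≤ M := by exact_mod_cast hρ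
      rw [hD]; gcongr
    calc r ^ M ≤ r ^ ρ * 1 := by rw [mul_one]; exact pow_le_pow_right_of_le_one' hrle hρ
      _ ≤ _ := by
        refine pow_mul_le_killed_iterate ρ (fun k hk _ => ?_) fun w _ hw2 => ?_
        · have : (k : ℝ) * C ≤ ρ * C := by gcongr
          constructor <;> linarith
        · have : w ≤ κ * a := by linarith
          simp [hf, this]
  -- blocks, then small steps
  have hmid : ∀ (k ρ : ℕ), ρ ≤ M → ∀ u, u ≤ a - 2 * D → max (u - k * B) (h + D) ≤ κ * a - D →
      ∀ z, 2 * D ≤ z → z ≤ u → q ^ k * r ^ M ≤ (killed μ a)^[M * k] ((killed μ a)^[ρ] f) z := by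
    intro k ρ hρ u hu hmax z hz1 hz2
    refine pow_mul_le_killed_iterate_blocks (h := h) hB hBC (by linarith) (by linarith)
      (fun f hf y s => hblock a f hf y s) k (measurable_killed_iterate hfm _) hz1 hz2 hu ?_
    intro w hw1 hw2
    refine hsmall ρ hρ w hw1 (hw2.trans hmax) ?_
    have : max (u - k * B) (h + D) ≤ a - 2 * D := max_le (by nlinarith [k.cast_nonneg (α := ℝ)])
      (by linarith)
    linarith
  -- Enough blocks to descend through the whole interval, and at most one more than needed.
  obtain ⟨k₁, hk₁⟩ : ∃ k₁ : ℕ, a / B ≤ k₁ ∧ (k₁ : ℝ) ≤ a / B + 1 :=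
    ⟨⌈a / B⌉₊, Nat.le_ceil _, (Nat.ceil_lt_add_one (by positivity)).le⟩
  have hk₁a : a ≤ k₁ * B := by rw [← div_le_iff₀ hB]; exact hk₁.1
  have hk₁b : k₁ * B ≤ a + B := by
    have := mul_le_mul_of_nonneg_right hk₁.2 hB.le
    rw [add_mul, div_mul_cancel₀ _ hB.ne'] at this
    linarith
  -- The blocks cost exp(-κ B k) with k B ≤ a + B, the remaining steps at most a factor exp(-t). The
  -- choice of `a` gives t + κ B ≤ κ a.
  have hconst : ∀ k ≤ k₁, ENNReal.ofReal (Real.exp (-(2 * κ * a))) ≤ p ^ k₀ * (q ^ k * r ^ M) := by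
    intro k hk
    have hk' : (k : ℝ) ≤ k₁ := by exact_mod_cast hk
    calc ENNReal.ofReal (Real.exp (-(2 * κ * a)))
        ≤ ENNReal.ofReal (Real.exp (-t) * Real.exp (-κ * B) ^ k) := by
          refine ENNReal.ofReal_le_ofReal ?_
          rw [← Real.exp_nat_mul, ← Real.exp_add]
          refine Real.exp_le_exp.2 ?_
          have h1 : k * B ≤ a + B := le_trans (by gcongr) hk₁b
          have h2 : κ * (k * B) ≤ κ * (a + B) := by gcongr
          nlinarith
      _ = ENNReal.ofReal (Real.exp (-t)) * q ^ k := by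
          rw [ENNReal.ofReal_mul (Real.exp_pos _).le, ENNReal.ofReal_pow (Real.exp_pos _).le]
      _ ≤ p ^ k₀ * r ^ M * q ^ k := by gcongr
      _ = _ := by ring
  refine ⟨k₀ + M * k₁, fun y hy1 hy2 => ?_, fun j hj => ?_⟩
  · rw [Function.iterate_add_apply]
    refine (hconst k₁ le_rfl).trans ?_
    have hmid' := hmid k₁ 0 (Nat.zero_le _) (a - 2 * D) le_rfl
      (max_le (by linarith) (by linarith))
    simp only [Function.iterate_zero, id_eq] at hmid'
    -- The start may be at, or arbitrarily close to, the boundary: first `k₀` steps away from the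
    -- nearer end, then blocks.
    rcases le_or_gt y (a / 2) with hya | hya
    · refine le_trans (mul_le_mul' (pow_le_pow_left' (min_le_left _ _) k₀) le_rfl)
        (pow_mul_le_killed_iterate k₀ (fun k hk hk1 => ?_) fun z hz1 hz2 =>
          hmid' z (by linarith) (by linarith))
      have hk' : (k : ℝ) * C' ≤ k₀ * C' := by gcongr
      have hk1' : (1 : ℝ) ≤ k := by exact_mod_cast hk1
      constructor
      · positivity
      · linarith
    · refine le_trans (mul_le_mul' (pow_le_pow_left' (min_le_right _ _) k₀) le_rfl)
        (pow_mul_le_killed_iterate k₀ (fun k hk hk1 => ?_) fun z hz1 hz2 =>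
          hmid' z (by linarith) (by linarith))
      have hk' : (k : ℝ) * C' ≤ k₀ * C' := by gcongr
      have hk1' : (1 : ℝ) ≤ k := by exact_mod_cast hk1
      have : 0 < (k : ℝ) * c := by positivity
      constructor <;> linarith
  · rcases lt_or_ge j k₀ with hjk | hjk
    · refine (hconst 0 (Nat.zero_le _)).trans ?_
      calc p ^ k₀ * (q ^ 0 * r ^ M) ≤ p ^ j * 1 := by
            refine mul_le_mul' (pow_le_pow_right_of_le_one' hple hjk.le) ?_
            simpa using pow_le_one' hrle M
        _ ≤ μ (Set.Icc c C') ^ j * 1 := by gcongr; exact min_le_left _ _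
        _ ≤ _ := by
          have hj' : (j : ℝ) * C' ≤ k₀ * C' := by gcongr
          refine pow_mul_le_killed_iterate j (fun k hk hk1 => ?_) fun z hz1 hz2 => ?_
          · have hk' : (k : ℝ) * C' ≤ j * C' := by gcongr
            have hk1' : (1 : ℝ) ≤ k := by exact_mod_cast hk1
            constructor
            · positivity
            · linarith
          · have : z ≤ κ * a := by linarith
            simp [hf, this]
    · obtain ⟨i, rfl⟩ := Nat.exists_eq_add_of_le hjk
      -- After the initial rise, the remaining time is split into whole blocks and fewer than `M`
      -- truncated steps, which cannot leave the target region once the blocks have ended at most at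
      -- κ a - D.
      have hdm := Nat.div_add_mod i M
      have hmod := (Nat.mod_lt i hM).le
      have hdiv : i / M ≤ k₁ := by
        have : i ≤ M * k₁ := by omega
        exact Nat.div_le_of_le_mul this
      refine (hconst (i / M) hdiv).trans ?_
      have e : k₀ + i = k₀ + (M * (i / M) + i % M) := by rw [hdm]
      rw [e, Function.iterate_add_apply, Function.iterate_add_apply]
      refine le_trans (mul_le_mul' (pow_le_pow_left' (min_le_left _ _) k₀) le_rfl)
        (pow_mul_le_killed_iterate k₀ (fun k hk hk1 => ?_) fun z hz1 hz2 => ?_)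
      · have hk' : (k : ℝ) * C' ≤ k₀ * C' := by gcongr
        have hk1' : (1 : ℝ) ≤ k := by exact_mod_cast hk1
        constructor
        · positivity
        · linarith
      · refine hmid (i / M) (i % M) hmod (k₀ * C') (by linarith) (max_le ?_ (by linarith)) z
          (by linarith) (by linarith)
        have : 0 ≤ ((i / M : ℕ) : ℝ) * B := by positivity
        linarith

end CenteredChain

/-! ### Exponential tilting, and the mean of a conditioned walk with negative drift. -/

section NegativeDrift

variable {μ : Measure ℝ} [IsProbabilityMeasure μ]

/-- A step distribution with negative mean and unit exponential moment can be exponentially tilted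
to a centered one. -/
lemma exists_centering_tilt (hneg : ∫ x, x ∂μ < 0)
    (hexp : Integrable (fun x => Real.exp x) μ) (hone : ∫ x, Real.exp x ∂μ = 1) :
    ∃ θ : ℝ, 0 < θ ∧ θ ∈ interior (integrableExpSet id μ) ∧
      ∫ x, x ∂(μ.tilted (θ * id ·)) = 0 := by
  have hbound : ∀ t ∈ Set.Icc (0 : ℝ) 1, ∀ x : ℝ, ‖Real.exp (t * x)‖ ≤ 1 + Real.exp x := by
    intro t ht x
    rw [Real.norm_eq_abs, abs_of_pos (Real.exp_pos _)]
    rcases le_total 0 x with hx | hx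
    · have : Real.exp (t * x) ≤ Real.exp x := Real.exp_le_exp.2 (by nlinarith [ht.2])
      linarith
    · have : Real.exp (t * x) ≤ 1 := Real.exp_le_one_iff.2 (mul_nonpos_of_nonneg_of_nonpos ht.1 hx)
      linarith [Real.exp_pos x]
  have hbi : Integrable (fun x => 1 + Real.exp x) μ := (integrable_const _).add hexp
  have hset : Set.Icc (0 : ℝ) 1 ⊆ integrableExpSet id μ := fun t ht =>
    hbi.mono' (by fun_prop) (ae_of_all _ (hbound t ht))
  have hcont : ContinuousOn (mgf id μ) (Set.Icc 0 1) := by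
    refine continuousOn_of_dominated (bound := fun x => 1 + Real.exp x) (fun t _ => by fun_prop)
      (fun t ht => ae_of_all _ (hbound t ht)) hbi (ae_of_all _ fun x => ?_)
    fun_prop
  obtain ⟨θ, hθ, hmin⟩ := isCompact_Icc.exists_isMinOn (Set.nonempty_Icc.2 zero_le_one) hcont
  have h0 : mgf id μ 0 = 1 := by simp
  have h1 : mgf id μ 1 = 1 := by simp [mgf, hone]
  -- The mean of (exp(x / 2) - 1)² is 2 - 2 mgf(1 / 2). It vanishes only if x = 0 almost surely,
  -- which the negative mean excludes. Since the mgf is 1 at both ends of [0, 1], its minimum is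
  -- then interior.
  have hhalf : mgf id μ (1 / 2) < 1 := by
    have hi2 : Integrable (fun x => Real.exp (1 / 2 * x)) μ := hset ⟨by norm_num, by norm_num⟩
    have hnn : 0 ≤ᵐ[μ] fun x => 1 + Real.exp x - 2 * Real.exp (1 / 2 * x) := ae_of_all _ fun x => by
      have : Real.exp x = Real.exp (1 / 2 * x) ^ 2 := by rw [← Real.exp_nat_mul]; congr 1; ring
      simp only [Pi.zero_apply]
      rw [this]
      nlinarith [sq_nonneg (Real.exp (1 / 2 * x) - 1)]
    have heq : ∫ x, (1 + Real.exp x - 2 * Real.exp (1 / 2 * x)) ∂μ = 2 - 2 * mgf id μ (1 / 2) := by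
      rw [integral_sub hbi (hi2.const_mul 2), integral_add (integrable_const _) hexp, hone,
        integral_const_mul]
      simp [mgf]; norm_num
    have hge := integral_nonneg_of_ae hnn
    rw [heq] at hge
    refine lt_of_le_of_ne (by linarith) fun h => ?_
    rw [h] at heq
    have hz := (integral_eq_zero_iff_of_nonneg_ae hnn (hbi.sub (hi2.const_mul 2))).1
      (heq.trans (by norm_num))
    have hx0 : (fun x : ℝ => x) =ᵐ[μ] 0 := by
      filter_upwards [hz] with x hx
      have : Real.exp x = Real.exp (1 / 2 * x) ^ 2 := by rw [← Real.exp_nat_mul]; congr 1; ring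
      simp only [Pi.zero_apply] at hx ⊢
      rw [this] at hx
      have h3 : (Real.exp (1 / 2 * x) - 1) ^ 2 = 0 := by linarith
      have h4 : Real.exp (1 / 2 * x) = 1 := by
        have := pow_eq_zero_iff (two_ne_zero) |>.1 h3
        linarith
      have := (Real.exp_eq_one_iff _).1 h4
      linarith
    rw [integral_congr_ae hx0] at hneg
    simp at hneg
  have hlt : mgf id μ θ < 1 := (hmin (show (1 / 2 : ℝ) ∈ Set.Icc (0 : ℝ) 1 from
    ⟨by norm_num, by norm_num⟩)).trans_lt hhalf
  have hθ0 : 0 < θ := lt_of_le_of_ne hθ.1 fun h => by rw [← h, h0] at hlt; exact lt_irrefl _ hlt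
  have hθ1 : θ < 1 := lt_of_le_of_ne hθ.2 fun h => by rw [h, h1] at hlt; exact lt_irrefl _ hlt
  have hint' : θ ∈ interior (integrableExpSet id μ) :=
    mem_interior.2 ⟨Set.Ioo 0 1, Set.Ioo_subset_Icc_self.trans hset, isOpen_Ioo, hθ0, hθ1⟩
  refine ⟨θ, hθ0, hint', ?_⟩
  have hloc : IsLocalMin (mgf id μ) θ := hmin.isLocalMin (Icc_mem_nhds hθ0 hθ1)
  -- The mean of the tilted law is the logarithmic derivative of the mgf at `θ`, zero at an interior
  -- minimum.
  have hd := hloc.hasDerivAt_eq_zero (hasDerivAt_mgf hint')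
  have := integral_tilted_mul_self hint'
  rw [deriv_cgf hint', hd, zero_div] at this
  exact this

lemma killed_eq_tilted {θ : ℝ} (hθ : Integrable (fun x => Real.exp (θ * x)) μ) (a : ℝ)
    (f : ℝ → ℝ≥0∞) (y : ℝ) :
    killed μ a f y = ENNReal.ofReal (mgf id μ θ) * (ENNReal.ofReal (Real.exp (θ * y)) *
      killed (μ.tilted (θ * id ·)) a (fun z => ENNReal.ofReal (Real.exp (-(θ * z))) * f z) y) := by
  have hpos : 0 < mgf id μ θ := mgf_pos hθ
  unfold killed
  rw [lintegral_tilted, ← lintegral_const_mul' _ _ ENNReal.ofReal_ne_top,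
    ← lintegral_const_mul' _ _ ENNReal.ofReal_ne_top]
  refine lintegral_congr fun x => ?_
  by_cases h : y + x ∈ Set.Ioo 0 a
  · rw [Set.indicator_of_mem h, Set.indicator_of_mem h, ← mul_assoc, ← mul_assoc, ← mul_assoc,
      ← ENNReal.ofReal_mul hpos.le, ← ENNReal.ofReal_mul (by positivity),
      ← ENNReal.ofReal_mul (by positivity)]
    have : mgf id μ θ * Real.exp (θ * y) * (Real.exp (θ * id x) / ∫ x, Real.exp (θ * id x) ∂μ) *
        Real.exp (-(θ * (y + x))) = 1 := by
      change mgf id μ θ * Real.exp (θ * y) * (Real.exp (θ * x) / mgf id μ θ) *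
        Real.exp (-(θ * (y + x))) = 1
      have e : Real.exp (θ * y) * Real.exp (θ * x) * Real.exp (-(θ * (y + x))) = 1 := by
        rw [← Real.exp_add, ← Real.exp_add, Real.exp_eq_one_iff]; ring
      field_simp
      linarith
    rw [this]; simp
  · simp [h]

/-- The exponential weights at intermediate positions telescope: only those of the starting point
and of the end point remain, with one factor mgf(θ) per step. -/
lemma killed_iterate_eq_tilted {θ : ℝ} (hθ : Integrable (fun x => Real.exp (θ * x)) μ) (a : ℝ)
    (n : ℕ) (f : ℝ → ℝ≥0∞) (y : ℝ) :
    (killed μ a)^[n] f y = ENNReal.ofReal (mgf id μ θ) ^ n * (ENNReal.ofReal (Real.exp (θ * y)) *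
      (killed (μ.tilted (θ * id ·)) a)^[n]
        (fun z => ENNReal.ofReal (Real.exp (-(θ * z))) * f z) y) := by
  induction n generalizing f y with
  | zero =>
    simp only [pow_zero, Function.iterate_zero, id_eq, one_mul]
    rw [← mul_assoc, ← ENNReal.ofReal_mul (Real.exp_pos _).le, ← Real.exp_add]
    simp
  | succ n ih =>
    rw [Function.iterate_succ_apply, ih, Function.iterate_succ_apply]
    have : (fun z => ENNReal.ofReal (Real.exp (-(θ * z))) * killed μ a f z) = fun z =>
        ENNReal.ofReal (mgf id μ θ) * killed (μ.tilted (θ * id ·)) a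
          (fun z => ENNReal.ofReal (Real.exp (-(θ * z))) * f z) z := by
      funext z
      rw [killed_eq_tilted hθ, mul_left_comm, ← mul_assoc (ENNReal.ofReal (Real.exp _)),
        ← ENNReal.ofReal_mul (Real.exp_pos _).le, ← Real.exp_add]
      simp
    rw [this, killed_iterate_const_mul _ ENNReal.ofReal_ne_top]
    rw [pow_succ]; ring

/-- For j > n₀, wherever the walk is at time j - n₀, its last n₀ steps can lead it below κ a at the
stated cost; and survival up to time j implies survival up to time j - n₀. For j ≤ n₀ the walk is
steered directly from 0. -/
lemma centered_survival_le (h2 : MemLp id 2 μ) (h0 : ∫ x, x ∂μ = 0) (hv : Var[id; μ] ≠ 0)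
    {κ : ℝ} (hκ : 0 < κ) (hκ1 : κ < 1) :
    ∃ a₀ : ℝ, ∀ a ≥ a₀, 0 < a → ∀ j : ℕ,
      ENNReal.ofReal (Real.exp (-(2 * κ * a))) * (killed μ a)^[j] 1 0 ≤
        (killed μ a)^[j] ((Set.Iic (κ * a)).indicator 1) 0 := by
  obtain ⟨a₀, H⟩ := exists_killed_iterate_lower h2 h0 hv hκ hκ1
  refine ⟨a₀, fun a ha hapos j => ?_⟩
  obtain ⟨n₀, h1, h2⟩ := H a ha
  rcases le_total j n₀ with hj | hj
  · refine le_trans ?_ (h2 j hj)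
    exact mul_le_of_le_one_right' (killed_iterate_le_one j 0)
  · obtain ⟨i, rfl⟩ := Nat.exists_eq_add_of_le' hj
    set c := ENNReal.ofReal (Real.exp (-(2 * κ * a))) with hc
    -- The bound `h1` holds on [0, a) only. Restricting to that set costs nothing: surviving
    -- positions lie in (0, a), and the starting point is 0.
    have hcongr : ∀ i : ℕ, (killed μ a)^[i] ((Set.Ico 0 a).indicator 1) 0 =
        (killed μ a)^[i] 1 0 := by
      intro i
      cases i with
      | zero => simp [hapos]
      | succ i =>
        rw [Function.iterate_succ_apply, Function.iterate_succ_apply]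
        have e : killed μ a ((Set.Ico 0 a).indicator 1) = killed μ a 1 := by
          funext y
          unfold killed
          refine lintegral_congr fun x => ?_
          by_cases h : y + x ∈ Set.Ioo 0 a
          · have h' : y + x ∈ Set.Ico 0 a := ⟨h.1.le, h.2⟩
            rw [Set.indicator_of_mem h, Set.indicator_of_mem h, Set.indicator_of_mem h']
          · simp [h]
        rw [e]
    rw [Function.iterate_add_apply, Function.iterate_add_apply]
    calc c * (killed μ a)^[i] ((killed μ a)^[n₀] 1) 0 ≤ c * (killed μ a)^[i] 1 0 := by
          gcongr
          exact killed_iterate_mono (killed_iterate_le_one n₀) i 0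
      _ = (killed μ a)^[i] (fun y => c * (Set.Ico 0 a).indicator 1 y) 0 := by
          rw [killed_iterate_const_mul c ENNReal.ofReal_ne_top]
          exact congrArg (c * ·) (hcongr i).symm
      _ ≤ _ := by
          refine killed_iterate_mono (fun y => ?_) i 0
          by_cases hy : y ∈ Set.Ico 0 a
          · rw [Set.indicator_of_mem hy, Pi.one_apply, mul_one]
            exact h1 y hy.1 hy.2
          · simp [hy]

/-- The position of a random walk with negative drift, conditioned to have stayed in `(0, a)` up
to an arbitrary time, has a mean that is small compared with `a`. -/
theorem conditioned_mean_le (hneg : ∫ x, x ∂μ < 0)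
    (hexp : Integrable (fun x => Real.exp x) μ) (hone : ∫ x, Real.exp x ∂μ = 1)
    {ε : ℝ} (hε : 0 < ε) :
    ∀ᶠ a : ℝ in atTop, ∀ j : ℕ, (killed μ a)^[j] ENNReal.ofReal 0 ≤
      ENNReal.ofReal (ε * a) * (killed μ a)^[j] 1 0 := by
  obtain ⟨θ, hθ, hθi, hmean⟩ := exists_centering_tilt hneg hexp hone
  have hθe : Integrable (fun x => Real.exp (θ * x)) μ :=
    interior_subset (s := integrableExpSet id μ) hθi
  set μ' := μ.tilted (θ * id ·) with hμ'
  have : IsProbabilityMeasure μ' := isProbabilityMeasure_tilted hθe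
  have hL2 : MemLp id 2 μ' := memLp_tilted_mul hθi 2
  -- A degenerate tilted law would be concentrated at its mean 0, and so would `μ`, whose mean is
  -- negative.
  have hvar : Var[id; μ'] ≠ 0 := by
    intro h
    have h1 := ae_eq_integral_of_variance_eq_zero hL2 h
    have h2 : (id : ℝ → ℝ) =ᵐ[μ] fun _ => 0 := by
      have h3 := (absolutelyContinuous_tilted (f := (θ * id ·)) hθe).ae_le h1
      filter_upwards [h3] with x hx
      rw [hx]; exact hmean
    have : ∫ x, x ∂μ = 0 := by
      rw [← integral_zero ℝ ℝ (μ := μ)]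
      exact integral_congr_ae h2
    linarith
  -- Chosen such that κ (2 + θ) ≤ θ ε / 4, so that exp(κ (2 + θ) a) is outweighed by exp(-θ ε a /
  -- 2).
  set κ := min (1 / 2) (θ * (ε / 2) / (2 * (2 + θ))) with hκ
  have hκ0 : 0 < κ := by positivity
  have hκ1 : κ < 1 := (min_le_left _ _).trans_lt (by norm_num)
  have hκ2 : κ * (2 + θ) ≤ θ * (ε / 2) / 2 := by
    have := min_le_right (1 / 2) (θ * (ε / 2) / (2 * (2 + θ)))
    rw [← hκ, le_div_iff₀ (by positivity)] at this
    linarith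
  obtain ⟨a₀, H⟩ := centered_survival_le hL2 hmean hvar hκ0 hκ1
  have hlarge : ∀ᶠ a : ℝ in atTop, 1 / θ ≤ ε / 2 * a := by
    have : Tendsto (fun a : ℝ => ε / 2 * a) atTop atTop :=
      tendsto_id.const_mul_atTop (by positivity)
    exact this.eventually_ge_atTop _
  filter_upwards [eventually_ge_atTop a₀, eventually_gt_atTop 0, hlarge] with a ha hapos hla j
  have hQ := H a ha hapos j
  set u := (killed μ a)^[j] 1 0 with hu
  set b := (killed μ a)^[j] (fun y => ENNReal.ofReal (Real.exp (θ * y))) 0 with hb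
  -- compare the exponential moment with the survival probability
  have hbu : b ≤ ENNReal.ofReal (Real.exp (κ * (2 + θ) * a)) * u := by
    -- Under the tilt, `b` becomes a survival probability and `u` the mean of exp(-θ z) on survival.
    -- The factor mgf(θ) ^ j is common to both, whence the uniformity in `j`.
    have eb : b = ENNReal.ofReal (mgf id μ θ) ^ j * (killed μ' a)^[j] 1 0 := by
      have e : (fun z => ENNReal.ofReal (Real.exp (-(θ * z))) * ENNReal.ofReal (Real.exp (θ * z))) =
          (1 : ℝ → ℝ≥0∞) := by
        funext z
        rw [← ENNReal.ofReal_mul (Real.exp_pos _).le, ← Real.exp_add]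
        simp
      rw [hb, killed_iterate_eq_tilted hθe, e]
      simp only [mul_zero, Real.exp_zero, ENNReal.ofReal_one, one_mul, hμ']
    have eu : u = ENNReal.ofReal (mgf id μ θ) ^ j *
        (killed μ' a)^[j] (fun z => ENNReal.ofReal (Real.exp (-(θ * z)))) 0 := by
      rw [hu, killed_iterate_eq_tilted hθe]
      simp only [mul_zero, Real.exp_zero, ENNReal.ofReal_one, one_mul, Pi.one_apply, mul_one, hμ']
    have h1 : ENNReal.ofReal (Real.exp (-(θ * (κ * a)))) *
        (killed μ' a)^[j] ((Set.Iic (κ * a)).indicator 1) 0 ≤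
        (killed μ' a)^[j] (fun z => ENNReal.ofReal (Real.exp (-(θ * z)))) 0 := by
      have := killed_iterate_mono (μ := μ') (a := a) (f := fun z =>
        ENNReal.ofReal (Real.exp (-(θ * (κ * a)))) * (Set.Iic (κ * a)).indicator 1 z)
        (g := fun z => ENNReal.ofReal (Real.exp (-(θ * z)))) (fun z => by
          beta_reduce
          by_cases hz : z ≤ κ * a
          · rw [Set.indicator_of_mem (Set.mem_Iic.2 hz), Pi.one_apply, mul_one]
            refine ENNReal.ofReal_le_ofReal (Real.exp_le_exp.2 ?_)
            nlinarith
          · simp [hz]) j 0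
      rwa [killed_iterate_const_mul _ ENNReal.ofReal_ne_top] at this
    have e1 : Real.exp (κ * (2 + θ) * a) * Real.exp (-(θ * (κ * a))) *
        Real.exp (-(2 * κ * a)) = 1 := by
      rw [← Real.exp_add, ← Real.exp_add, Real.exp_eq_one_iff]; ring
    calc b = ENNReal.ofReal (mgf id μ θ) ^ j * (killed μ' a)^[j] 1 0 := eb
      _ = ENNReal.ofReal (mgf id μ θ) ^ j * (ENNReal.ofReal (Real.exp (κ * (2 + θ) * a)) *
          (ENNReal.ofReal (Real.exp (-(θ * (κ * a)))) *
            (ENNReal.ofReal (Real.exp (-(2 * κ * a))) * (killed μ' a)^[j] 1 0))) := by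
          congr 1
          rw [← mul_assoc, ← mul_assoc, ← ENNReal.ofReal_mul (Real.exp_pos _).le,
            ← ENNReal.ofReal_mul (by positivity), e1]
          simp
      _ ≤ ENNReal.ofReal (mgf id μ θ) ^ j * (ENNReal.ofReal (Real.exp (κ * (2 + θ) * a)) *
          (killed μ' a)^[j] (fun z => ENNReal.ofReal (Real.exp (-(θ * z)))) 0) := by
          gcongr
          exact (mul_le_mul' le_rfl hQ).trans h1
      _ = _ := by rw [eu]; ring
  -- linear growth is dominated by exponential growth
  have hlin : (ENNReal.ofReal : ℝ → ℝ≥0∞) ≤ fun y => ENNReal.ofReal (ε / 2 * a) * (1 : ℝ → ℝ≥0∞) y +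
      ENNReal.ofReal (1 / θ * Real.exp (-(θ * (ε / 2 * a)))) *
        ENNReal.ofReal (Real.exp (θ * y)) := by
    intro y
    beta_reduce
    rw [Pi.one_apply, mul_one, ← ENNReal.ofReal_mul (by positivity),
      ← ENNReal.ofReal_add (by positivity) (by positivity)]
    refine ENNReal.ofReal_le_ofReal ?_
    rw [mul_assoc, ← Real.exp_add]
    -- Tangent line of the exponential at zero, with argument θ (y - ε a / 2).
    have := Real.add_one_le_exp (-(θ * (ε / 2 * a)) + θ * y)
    have h3 : 1 / θ * (-(θ * (ε / 2 * a)) + θ * y + 1) ≤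
        1 / θ * Real.exp (-(θ * (ε / 2 * a)) + θ * y) := by gcongr
    have h4 : 1 / θ * (-(θ * (ε / 2 * a)) + θ * y + 1) = y - ε / 2 * a + 1 / θ := by
      field_simp
      ring
    have : 0 < 1 / θ := by positivity
    linarith
  calc (killed μ a)^[j] ENNReal.ofReal 0
      ≤ ENNReal.ofReal (ε / 2 * a) * u + ENNReal.ofReal (1 / θ * Real.exp (-(θ * (ε / 2 * a)))) * b := by
        refine (killed_iterate_mono hlin j 0).trans (le_of_eq ?_)
        rw [killed_iterate_add (by fun_prop), killed_iterate_const_mul _ ENNReal.ofReal_ne_top,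
          killed_iterate_const_mul _ ENNReal.ofReal_ne_top]
    _ ≤ ENNReal.ofReal (ε / 2 * a) * u + ENNReal.ofReal (1 / θ * Real.exp (-(θ * (ε / 2 * a)))) *
          (ENNReal.ofReal (Real.exp (κ * (2 + θ) * a)) * u) := by gcongr
    _ = ENNReal.ofReal (ε / 2 * a + 1 / θ * Real.exp (-(θ * (ε / 2 * a))) *
          Real.exp (κ * (2 + θ) * a)) * u := by
        rw [← mul_assoc, ← ENNReal.ofReal_mul (by positivity), ← add_mul,
          ← ENNReal.ofReal_add (by positivity) (by positivity)]
    _ ≤ ENNReal.ofReal (ε * a) * u := by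
        gcongr
        have h5 : Real.exp (-(θ * (ε / 2 * a))) * Real.exp (κ * (2 + θ) * a) ≤ 1 := by
          rw [← Real.exp_add, Real.exp_le_one_iff]
          have : κ * (2 + θ) * a ≤ θ * (ε / 2) / 2 * a := by gcongr
          nlinarith [mul_pos (mul_pos hθ hε) hapos]
        have h6 : 1 / θ * Real.exp (-(θ * (ε / 2 * a))) * Real.exp (κ * (2 + θ) * a) ≤ 1 / θ := by
          rw [mul_assoc]
          exact mul_le_of_le_one_right (by positivity) h5
        linarith

end NegativeDrift

/-! ### Likelihood ratios of equivalent laws. -/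

section LLR

variable {α : Type*} [MeasurableSpace α] {P Q : Measure α} [IsProbabilityMeasure P]
  [IsProbabilityMeasure Q]

lemma setLIntegral_exp_llr (hPQ : P ≪ Q) (hQP : Q ≪ P) (B : Set α) :
    ∫⁻ x in B, ENNReal.ofReal (Real.exp (llr P Q x)) ∂Q = P B := by
  rw [← Measure.setLIntegral_rnDeriv hPQ]
  refine lintegral_congr_ae (ae_restrict_of_ae ?_)
  filter_upwards [exp_llr_of_ac' P Q hQP, P.rnDeriv_lt_top Q] with x hx hx'
  rw [hx, ENNReal.ofReal_toReal hx'.ne]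

lemma lintegral_exp_llr (hPQ : P ≪ Q) (hQP : Q ≪ P) :
    ∫⁻ x, ENNReal.ofReal (Real.exp (llr P Q x)) ∂Q = 1 := by
  rw [← setLIntegral_univ, setLIntegral_exp_llr hPQ hQP, measure_univ]

lemma lintegral_exp_neg_llr (hPQ : P ≪ Q) (hQP : Q ≪ P) :
    ∫⁻ x, ENNReal.ofReal (Real.exp (-llr P Q x)) ∂P = 1 := by
  rw [← lintegral_exp_llr hQP hPQ]
  refine lintegral_congr_ae ?_
  filter_upwards [neg_llr hPQ] with x hx
  rw [← hx]; rfl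

end LLR

/-! ### Mixtures and the increments of the statistic. -/

section Mixture

variable {K : ℕ} {X : Fin K → Type*} [∀ k, MeasurableSpace (X k)]
  {F : Measure (∀ k, X k)} {𝒢 : Set (Measure (∀ k, X k))} {E : Finset (Fin K)}

instance (L : Measure (∀ k, X k)) [IsProbabilityMeasure L] (E : Finset (Fin K)) :
    IsProbabilityMeasure (localLaw L E) :=
  Measure.isProbabilityMeasure_map (Finset.measurable_restrict E).aemeasurable

lemma ncard_ne_zero (hne : (localFamily F 𝒢 E).Nonempty) (hfin : (localFamily F 𝒢 E).Finite) :
    ((localFamily F 𝒢 E).ncard : ℝ≥0∞) ≠ 0 := by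
  have := (Set.ncard_pos hfin).2 hne
  exact_mod_cast this.ne'

lemma mixture_apply (s : Set (∀ k : E, X k)) (hs : MeasurableSet s) :
    mixture F 𝒢 E s = ((localFamily F 𝒢 E).ncard : ℝ≥0∞)⁻¹ *
      ∑' P : localFamily F 𝒢 E, (P : Measure (∀ k : E, X k)) s := by
  rw [mixture, Measure.smul_apply, Measure.sum_apply _ hs, smul_eq_mul]

lemma isProbabilityMeasure_mixture (hne : (localFamily F 𝒢 E).Nonempty)
    (hfin : (localFamily F 𝒢 E).Finite)
    (hP : ∀ P ∈ localFamily F 𝒢 E, IsProbabilityMeasure P) :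
    IsProbabilityMeasure (mixture F 𝒢 E) := by
  constructor
  rw [mixture_apply _ MeasurableSet.univ]
  have : ∀ P : localFamily F 𝒢 E, (P : Measure (∀ k : E, X k)) Set.univ = 1 := fun P =>
    (hP P P.2).measure_univ
  have := hfin.fintype
  rw [tsum_congr ‹∀ P : localFamily F 𝒢 E, _›, tsum_fintype]
  simp only [Finset.sum_const, Finset.card_univ, nsmul_eq_mul, mul_one]
  rw [Set.ncard_eq_toFinset_card' (localFamily F 𝒢 E), Set.toFinset_card]
  refine ENNReal.inv_mul_cancel ?_ (ENNReal.natCast_ne_top _)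
  have h0 := ncard_ne_zero hne hfin
  rwa [Set.ncard_eq_toFinset_card' (localFamily F 𝒢 E), Set.toFinset_card] at h0

lemma mixture_absolutelyContinuous (hP : ∀ P ∈ localFamily F 𝒢 E, P ≪ localLaw F E) :
    mixture F 𝒢 E ≪ localLaw F E :=
  (Measure.absolutelyContinuous_sum_left fun P : localFamily F 𝒢 E => hP _ P.property).smul_left _

/-- This domination carries integrability from the mixture over to each of its components, in
particular to the true post-change law. -/
lemma le_smul_mixture (hne : (localFamily F 𝒢 E).Nonempty)
    (hfin : (localFamily F 𝒢 E).Finite) {P : Measure (∀ k : E, X k)}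
    (hP : P ∈ localFamily F 𝒢 E) :
    P ≤ ((localFamily F 𝒢 E).ncard : ℝ≥0∞) • mixture F 𝒢 E := by
  rw [mixture, smul_smul, ENNReal.mul_inv_cancel (ncard_ne_zero hne hfin)
    (ENNReal.natCast_ne_top _), one_smul]
  exact Measure.le_sum (fun P : localFamily F 𝒢 E => (P : Measure (∀ k : E, X k))) ⟨P, hP⟩

lemma absolutelyContinuous_mixture (hne : (localFamily F 𝒢 E).Nonempty)
    (hfin : (localFamily F 𝒢 E).Finite) (hP : ∀ P ∈ localFamily F 𝒢 E, localLaw F E ≪ P) :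
    localLaw F E ≪ mixture F 𝒢 E := by
  obtain ⟨P, hP'⟩ := hne
  exact (hP P hP').trans (Measure.absolutelyContinuous_of_le_smul (le_smul_mixture ⟨P, hP'⟩ hfin hP'))

/-- The distribution, under `L`, of the increment of the statistic of unit `E`. -/
noncomputable def stepLaw (F : Measure (∀ k, X k)) (𝒢 : Set (Measure (∀ k, X k)))
    (L : Measure (∀ k, X k)) (E : Finset (Fin K)) : Measure ℝ :=
  (localLaw L E).map (mixLLR F 𝒢 E)

lemma measurable_mixLLR : Measurable (mixLLR F 𝒢 E) := measurable_llr _ _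

instance (L : Measure (∀ k, X k)) [IsProbabilityMeasure L] (E : Finset (Fin K)) :
    IsProbabilityMeasure (stepLaw F 𝒢 L E) :=
  Measure.isProbabilityMeasure_map measurable_mixLLR.aemeasurable

lemma stepLaw_congr {L L' : Measure (∀ k, X k)} (h : localLaw L E = localLaw L' E) :
    stepLaw F 𝒢 L E = stepLaw F 𝒢 L' E := by
  rw [stepLaw, stepLaw, h]

lemma lintegral_stepLaw (L : Measure (∀ k, X k)) {g : ℝ → ℝ≥0∞} (hg : Measurable g) :
    ∫⁻ x, g x ∂stepLaw F 𝒢 L E = ∫⁻ x, g (mixLLR F 𝒢 E (E.restrict x)) ∂L := by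
  rw [stepLaw, lintegral_map hg measurable_mixLLR]
  exact lintegral_map (hg.comp measurable_mixLLR) (Finset.measurable_restrict E)

/-- The standing assumptions on a unit. -/
structure RegularUnit (F : Measure (∀ k, X k)) (𝒢 : Set (Measure (∀ k, X k)))
    (E : Finset (Fin K)) : Prop where
  nonempty : (localFamily F 𝒢 E).Nonempty
  finite : (localFamily F 𝒢 E).Finite
  prob : ∀ P ∈ localFamily F 𝒢 E, IsProbabilityMeasure P
  ac : ∀ P ∈ localFamily F 𝒢 E, P ≪ localLaw F E
  ac' : ∀ P ∈ localFamily F 𝒢 E, localLaw F E ≪ P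
  integrable : Integrable (llr (localLaw F E) (mixture F 𝒢 E)) (localLaw F E)
  pos : 0 < preDrift F 𝒢 E

variable [IsProbabilityMeasure F]

lemma RegularUnit.lintegral_exp_stepLaw (h : RegularUnit F 𝒢 E) :
    ∫⁻ x, ENNReal.ofReal (Real.exp x) ∂stepLaw F 𝒢 F E = 1 := by
  have := isProbabilityMeasure_mixture h.nonempty h.finite h.prob
  rw [stepLaw, lintegral_map (by fun_prop) measurable_mixLLR]
  exact lintegral_exp_llr (mixture_absolutelyContinuous h.ac)
    (absolutelyContinuous_mixture h.nonempty h.finite h.ac')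

lemma RegularUnit.integrable_exp_stepLaw (h : RegularUnit F 𝒢 E) :
    Integrable (fun x => Real.exp x) (stepLaw F 𝒢 F E) := by
  refine ⟨by fun_prop, ?_⟩
  rw [hasFiniteIntegral_iff_ofReal (ae_of_all _ fun x => (Real.exp_pos x).le),
    h.lintegral_exp_stepLaw]
  exact ENNReal.one_lt_top

lemma RegularUnit.integral_exp_stepLaw (h : RegularUnit F 𝒢 E) :
    ∫ x, Real.exp x ∂stepLaw F 𝒢 F E = 1 := by
  rw [integral_eq_lintegral_of_nonneg_ae (ae_of_all _ fun x => (Real.exp_pos x).le) (by fun_prop),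
    h.lintegral_exp_stepLaw, ENNReal.toReal_one]

lemma RegularUnit.mixLLR_ae_eq (h : RegularUnit F 𝒢 E) :
    (fun x => - llr (localLaw F E) (mixture F 𝒢 E) x) =ᵐ[localLaw F E] mixLLR F 𝒢 E := by
  have := isProbabilityMeasure_mixture h.nonempty h.finite h.prob
  exact neg_llr (absolutelyContinuous_mixture h.nonempty h.finite h.ac')

lemma RegularUnit.integrable_stepLaw (h : RegularUnit F 𝒢 E) : Integrable id (stepLaw F 𝒢 F E) := by
  rw [stepLaw, integrable_map_measure (by fun_prop) measurable_mixLLR.aemeasurable]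
  exact h.integrable.neg.congr h.mixLLR_ae_eq

lemma RegularUnit.integral_stepLaw (h : RegularUnit F 𝒢 E) :
    ∫ x, x ∂stepLaw F 𝒢 F E = - preDrift F 𝒢 E := by
  rw [stepLaw, integral_map measurable_mixLLR.aemeasurable (by fun_prop),
    ← integral_congr_ae h.mixLLR_ae_eq, integral_neg, preDrift]

lemma RegularUnit.integral_stepLaw_neg (h : RegularUnit F 𝒢 E) : ∫ x, x ∂stepLaw F 𝒢 F E < 0 := by
  rw [h.integral_stepLaw]; linarith [h.pos]

/-- If the increments were almost surely at most 0, then exp(x) ≤ 1 with mean one would force x = 0,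
against the negative drift. Positive increments are all that finiteness of the alarm time requires.
-/
lemma RegularUnit.stepLaw_Ioi_ne_zero (h : RegularUnit F 𝒢 E) : stepLaw F 𝒢 F E (Set.Ioi 0) ≠ 0 := by
  intro h0
  have hle : ∀ᵐ x ∂stepLaw F 𝒢 F E, x ≤ 0 := by
    filter_upwards [measure_eq_zero_iff_ae_notMem.1 h0] with x hx
    simpa using hx
  have hnn : 0 ≤ᵐ[stepLaw F 𝒢 F E] fun x => 1 - Real.exp x := by
    filter_upwards [hle] with x hx
    have := Real.exp_le_one_iff.2 hx
    simp only [Pi.zero_apply]; linarith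
  have hz : ∫ x, (1 - Real.exp x) ∂stepLaw F 𝒢 F E = 0 := by
    rw [integral_sub (integrable_const _) h.integrable_exp_stepLaw, h.integral_exp_stepLaw]
    simp
  have h1 := (integral_eq_zero_iff_of_nonneg_ae hnn
    ((integrable_const _).sub h.integrable_exp_stepLaw)).1 hz
  have h2 : (fun x : ℝ => x) =ᵐ[stepLaw F 𝒢 F E] 0 := by
    filter_upwards [h1] with x hx
    have : Real.exp x = 1 := by simp only [Pi.zero_apply] at hx; linarith
    exact (Real.exp_eq_one_iff x).1 this
  have h3 := h.integral_stepLaw_neg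
  rw [integral_congr_ae h2] at h3
  simp at h3

lemma RegularUnit.stepLaw_Ioi_ne_zero_of_ac (h : RegularUnit F 𝒢 E) {L : Measure (∀ k, X k)}
    (hL : localLaw F E ≪ localLaw L E) : stepLaw F 𝒢 L E (Set.Ioi 0) ≠ 0 :=
  fun h0 => h.stepLaw_Ioi_ne_zero (hL.map measurable_mixLLR h0)

/-- The negative exponential moment of the increments after the change is finite. -/
lemma RegularUnit.integrable_exp_neg_stepLaw (h : RegularUnit F 𝒢 E) {L : Measure (∀ k, X k)}
    (hL : localLaw L E ∈ localFamily F 𝒢 E) :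
    Integrable (fun x => Real.exp (-x)) (stepLaw F 𝒢 L E) := by
  have := isProbabilityMeasure_mixture h.nonempty h.finite h.prob
  refine ⟨by fun_prop, ?_⟩
  rw [hasFiniteIntegral_iff_ofReal (ae_of_all _ fun x => (Real.exp_pos _).le), stepLaw,
    lintegral_map (by fun_prop) measurable_mixLLR]
  calc ∫⁻ x, ENNReal.ofReal (Real.exp (-mixLLR F 𝒢 E x)) ∂localLaw L E
      ≤ ∫⁻ x, ENNReal.ofReal (Real.exp (-mixLLR F 𝒢 E x))
          ∂(((localFamily F 𝒢 E).ncard : ℝ≥0∞) • mixture F 𝒢 E) :=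
        lintegral_mono' (le_smul_mixture h.nonempty h.finite hL) le_rfl
    _ = ((localFamily F 𝒢 E).ncard : ℝ≥0∞) * 1 := by
        rw [lintegral_smul_measure, smul_eq_mul, mixLLR, lintegral_exp_neg_llr
          (mixture_absolutelyContinuous h.ac)
          (absolutelyContinuous_mixture h.nonempty h.finite h.ac')]
    _ < ∞ := by simp

end Mixture

/-! ### Truncated means and small exponential moments. -/

section RealSteps

variable {κ : Measure ℝ} [IsProbabilityMeasure κ]

/-- Truncation at a high level loses little drift and bounds the overshoot over the threshold, so
that no second moment of the increments is needed. -/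
lemma tendsto_integral_min (hint : Integrable id κ) :
    Tendsto (fun C : ℝ => ∫ x, min x C ∂κ) atTop (𝓝 (∫ x, x ∂κ)) := by
  refine tendsto_integral_filter_of_dominated_convergence (fun x => |x|) ?_ ?_ hint.abs ?_
  · exact Eventually.of_forall fun C => by fun_prop
  · filter_upwards [eventually_ge_atTop 0] with C hC
    refine ae_of_all _ fun x => ?_
    rw [Real.norm_eq_abs]
    rcases le_total x C with h | h
    · rw [min_eq_left h]
    · rw [min_eq_right h, abs_of_nonneg hC, abs_of_nonneg (hC.trans h)]; exact h
  · refine ae_of_all _ fun x => ?_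
    refine tendsto_const_nhds.congr' ?_
    filter_upwards [eventually_ge_atTop x] with C hC
    rw [min_eq_left hC]

lemma tendsto_integral_max (hint : Integrable id κ) :
    Tendsto (fun C : ℝ => ∫ x, max x (-C) ∂κ) atTop (𝓝 (∫ x, x ∂κ)) := by
  refine tendsto_integral_filter_of_dominated_convergence (fun x => |x|) ?_ ?_ hint.abs ?_
  · exact Eventually.of_forall fun C => by fun_prop
  · filter_upwards [eventually_ge_atTop 0] with C hC
    refine ae_of_all _ fun x => ?_
    rw [Real.norm_eq_abs]
    rcases le_total x (-C) with h | h
    · rw [max_eq_right h, abs_neg, abs_of_nonneg hC, abs_of_nonpos (by linarith)]; linarith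
    · rw [max_eq_left h]
  · refine ae_of_all _ fun x => ?_
    refine tendsto_const_nhds.congr' ?_
    filter_upwards [eventually_ge_atTop (-x)] with C hC
    rw [max_eq_left (by linarith)]

/-- A step distribution with positive mean and a finite negative exponential moment has a
negative exponential moment below one. -/
lemma exists_exp_neg_moment_lt_one (hint : Integrable id κ) (hpos : 0 < ∫ x, x ∂κ)
    (hexp : Integrable (fun x => Real.exp (-x)) κ) :
    ∃ s : ℝ, 0 < s ∧ Integrable (fun x => Real.exp (-(s * x))) κ ∧
      ∫ x, Real.exp (-(s * x)) ∂κ < 1 := by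
  have hi : ∀ s : ℝ, 0 ≤ s → s ≤ 1 → Integrable (fun x => Real.exp (-(s * x))) κ := by
    intro s hs0 hs1
    refine ((integrable_const (1 : ℝ)).add hexp).mono' (by fun_prop) (ae_of_all _ fun x => ?_)
    rw [Real.norm_eq_abs, abs_of_pos (Real.exp_pos _)]
    simp only [Pi.add_apply]
    rcases le_total 0 x with hx | hx
    · have : Real.exp (-(s * x)) ≤ 1 := Real.exp_le_one_iff.2 (by nlinarith)
      linarith [Real.exp_pos (-x)]
    · have : Real.exp (-(s * x)) ≤ Real.exp (-x) := Real.exp_le_exp.2 (by nlinarith)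
      linarith
  -- The difference quotients at 0 of s ↦ 1 - E[exp(-s x)], for s = 1 / (n + 1), tend to the mean.
  -- The dominating function comes from tangent line and convexity.
  have hlim : Tendsto (fun n : ℕ => ∫ x, ((n : ℝ) + 1) * (1 - Real.exp (-(((n : ℝ) + 1)⁻¹ * x))) ∂κ)
      atTop (𝓝 (∫ x, x ∂κ)) := by
    refine tendsto_integral_of_dominated_convergence (fun x => |x| + Real.exp (-x)) ?_
      (hint.abs.add hexp) ?_ ?_
    · exact fun n => by fun_prop
    · intro n
      refine ae_of_all _ fun x => ?_
      set s : ℝ := ((n : ℝ) + 1)⁻¹ with hs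
      have hn : (0 : ℝ) < n + 1 := by positivity
      have hs0 : 0 < s := by positivity
      have hs1 : s ≤ 1 := inv_le_one_of_one_le₀ (by linarith [n.cast_nonneg (α := ℝ)])
      have hsn : ((n : ℝ) + 1) * s = 1 := mul_inv_cancel₀ hn.ne'
      rw [Real.norm_eq_abs, abs_le]
      have h1 := Real.add_one_le_exp (-(s * x))
      have hup : ((n : ℝ) + 1) * (1 - Real.exp (-(s * x))) ≤ x := by
        calc ((n : ℝ) + 1) * (1 - Real.exp (-(s * x))) ≤ ((n : ℝ) + 1) * (s * x) := by
              gcongr; linarith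
          _ = x := by rw [← mul_assoc, hsn, one_mul]
      refine ⟨?_, hup.trans ((le_abs_self x).trans (by linarith [Real.exp_pos (-x)]))⟩
      -- convexity of the exponential
      have hconv : Real.exp (-(s * x)) ≤ s * Real.exp (-x) + (1 - s) * 1 := by
        have := convexOn_exp.2 (Set.mem_univ (-x)) (Set.mem_univ 0) hs0.le (by linarith : 0 ≤ 1 - s)
          (by ring)
        simpa [mul_comm] using this
      have h2 : -(s * Real.exp (-x)) ≤ 1 - Real.exp (-(s * x)) := by linarith
      have h3 : ((n : ℝ) + 1) * (-(s * Real.exp (-x))) ≤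
          ((n : ℝ) + 1) * (1 - Real.exp (-(s * x))) := by gcongr
      have h4 : ((n : ℝ) + 1) * (-(s * Real.exp (-x))) = - Real.exp (-x) := by
        rw [mul_neg, ← mul_assoc, hsn, one_mul]
      have := abs_nonneg x
      linarith
    · refine ae_of_all _ fun x => ?_
      have hd : HasDerivAt (fun t : ℝ => 1 - Real.exp (-(t * x))) x 0 := by
        have h1 : HasDerivAt (fun t : ℝ => -(t * x)) (-(1 * x)) 0 :=
          ((hasDerivAt_id (0 : ℝ)).mul_const x).neg
        have := h1.exp.const_sub 1
        simpa using this
      have hs := hd.tendsto_slope_zero_right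
      have ht : Tendsto (fun n : ℕ => ((n : ℝ) + 1)⁻¹) atTop (𝓝[>] 0) := by
        refine tendsto_nhdsWithin_iff.2 ⟨?_, Eventually.of_forall fun n => ?_⟩
        · simpa using tendsto_one_div_add_atTop_nhds_zero_nat (𝕜 := ℝ)
        · show (0 : ℝ) < _; positivity
      have := hs.comp ht
      refine this.congr fun n => ?_
      simp
  obtain ⟨n, hn⟩ := (hlim.eventually_const_lt hpos).exists
  have hn0 : (0 : ℝ) < (n : ℝ) + 1 := by positivity
  have hii := hi ((n : ℝ) + 1)⁻¹ (by positivity)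
    (inv_le_one_of_one_le₀ (by linarith [n.cast_nonneg (α := ℝ)]))
  refine ⟨((n : ℝ) + 1)⁻¹, by positivity, hii, ?_⟩
  rw [integral_const_mul, integral_sub (integrable_const _) hii] at hn
  have := (pos_iff_pos_of_mul_pos hn).1 hn0
  simp at this
  exact this

end RealSteps

/-- The truncated difference counts the times from `ν` on that precede `t`. Expected delays thereby
become sums of survival probabilities. -/
lemma enat_sub_eq_tsum (t : ℕ∞) (ν : ℕ) :
    (t : ℝ≥0∞) - (ν : ℝ≥0∞) = ∑' i : ℕ, if ((ν + i : ℕ) : ℕ∞) < t then 1 else 0 := by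
  induction t using ENat.recTopCoe with
  | top =>
    have : ∀ i : ℕ, (if ((ν + i : ℕ) : ℕ∞) < ⊤ then (1 : ℝ≥0∞) else 0) = 1 := fun i =>
      if_pos (ENat.natCast_lt_top _)
    rw [tsum_congr this, ENNReal.tsum_const_eq_top_of_ne_zero one_ne_zero]
    simp
  | coe n =>
    have h : ∀ i ∉ Finset.range (n - ν),
        (if ((ν + i : ℕ) : ℕ∞) < (n : ℕ∞) then (1 : ℝ≥0∞) else 0) = 0 := fun i hi => by
      rw [if_neg]
      rw [Nat.cast_lt]
      simp only [Finset.mem_range] at hi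
      omega
    rw [tsum_eq_sum h, Finset.sum_congr rfl (g := fun _ => (1 : ℝ≥0∞)) fun i hi => ?_]
    · simp
    · rw [if_pos]
      rw [Nat.cast_lt]
      simp only [Finset.mem_range] at hi
      omega

lemma measurable_sigma_of {ι β : Type*} {V : ι → Type*} [∀ i, MeasurableSpace (V i)]
    [MeasurableSpace β] {f : (Σ i, V i) → β} (h : ∀ i, Measurable fun v => f ⟨i, v⟩) :
    Measurable f := fun _ hs =>
  MeasurableSpace.measurableSet_iInf.2 fun i => h i hs

lemma measurableSet_sigma_mk_preimage {ι : Type*} {V : ι → Type*} [∀ i, MeasurableSpace (V i)]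
    {s : Set (Σ i, V i)} (hs : MeasurableSet s) (i : ι) :
    MeasurableSet (Sigma.mk i ⁻¹' s) :=
  MeasurableSpace.measurableSet_iInf.1 hs i

/-! ### Observations and the history from affected sets. -/

section Sampling

variable {R : Type*} [MeasurableSpace R] {K : ℕ} {X : Fin K → Type*} [∀ k, MeasurableSpace (X k)]

lemma measurableSet_observed {S : ℕ → Sample R X → Finset (Fin K)} {n : ℕ}
    (hS : ∀ E, MeasurableSet[past n] {ω | S n ω = E})
    {B : Set (Σ E : Finset (Fin K), ∀ k : E, X k)} (hB : MeasurableSet B) :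
    MeasurableSet[past (n + 1)] (observed S n ⁻¹' B) := by
  have e : observed S n ⁻¹' B = ⋃ E : Finset (Fin K), {ω | S n ω = E} ∩
      {ω : Sample R X | E.restrict (ω.2 n) ∈ Sigma.mk E ⁻¹' B} := by
    ext ω
    simp only [Set.mem_preimage, Set.mem_iUnion, Set.mem_inter_iff, Set.mem_ofPred_eq]
    constructor
    · intro h; exact ⟨S n ω, rfl, h⟩
    · rintro ⟨E, rfl, h⟩; exact h
  rw [e]
  refine MeasurableSet.iUnion fun E => MeasurableSet.inter (past_mono n.le_succ _ (hS E)) ?_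
  refine ⟨?_, fun ω ω' h hω => ?_⟩
  · exact ((Finset.measurable_restrict E).comp ((measurable_pi_apply n).comp measurable_snd))
      (measurableSet_sigma_mk_preimage hB E)
  · have : ω.2 n = ω'.2 n := h.2 n n.lt_succ_self
    simp only [Set.mem_ofPred_eq] at hω ⊢
    rwa [← this]

lemma affectedHistory_le {F G : Measure (∀ k, X k)} {m : ℕ}
    {S : ℕ → Sample R X → Finset (Fin K)} (hS : ∀ n E, MeasurableSet[past n] {ω | S n ω = E})
    (ν : ℕ) : affectedHistory F G m S ν ≤ (inferInstance : MeasurableSpace (Sample R X)) := by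
  refine MeasurableSpace.generateFrom_le ?_
  rintro s ⟨t, ht, B, hB, rfl⟩
  have h1 : MeasurableSet {ω | S t ω ∈ affected F G m} := by
    have : {ω | S t ω ∈ affected F G m} = ⋃ E ∈ affected F G m, {ω | S t ω = E} := by
      ext; simp
    rw [this]
    exact Finset.measurableSet_biUnion _ fun E _ => past_le _ _ (hS t E)
  exact h1.inter (past_le _ _ (measurableSet_observed (hS t) hB))

/-- On an event on which no affected set is sampled from time `s` on, the history from the affected
sets is determined by the past at time `s`. -/
lemma exists_past_inter_eq {F G : Measure (∀ k, X k)} {m : ℕ}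
    {S : ℕ → Sample R X → Finset (Fin K)} (hS : ∀ n E, MeasurableSet[past n] {ω | S n ω = E})
    {s ν : ℕ} {D : Set (Sample R X)}
    (hD : ∀ ω ∈ D, ∀ t, s ≤ t → t < ν → S t ω ∉ affected F G m) {A : Set (Sample R X)}
    (hA : MeasurableSet[affectedHistory F G m S ν] A) :
    ∃ A', MeasurableSet[past s] A' ∧ A ∩ D = A' ∩ D := by
  refine MeasurableSpace.generateFrom_induction
    (p := fun A _ => ∃ A', MeasurableSet[past s] A' ∧ A ∩ D = A' ∩ D) _ ?_ ?_ ?_ ?_ A hA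
  · rintro A ⟨t, ht, B, hB, rfl⟩ _
    rcases lt_or_ge t s with hts | hts
    · refine ⟨{ω | S t ω ∈ affected F G m ∧ observed S t ω ∈ B}, ?_, rfl⟩
      have h1 : MeasurableSet[past s] {ω | S t ω ∈ affected F G m} := by
        have : {ω | S t ω ∈ affected F G m} = ⋃ E ∈ affected F G m, {ω | S t ω = E} := by
          ext; simp
        rw [this]
        exact @Finset.measurableSet_biUnion _ _ (past s) _ _
          fun E _ => past_mono hts.le _ (hS t E)
      exact @MeasurableSet.inter _ (past s) _ _ h1
        (past_mono hts _ (measurableSet_observed (hS t) hB))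
    · refine ⟨∅, @MeasurableSet.empty _ (past s), ?_⟩
      ext ω
      simp only [Set.mem_inter_iff, Set.mem_ofPred_eq, Set.mem_empty_iff_false, false_and,
        iff_false, not_and]
      rintro ⟨h, _⟩ hω
      exact hD ω hω t hts ht h
  · exact ⟨∅, @MeasurableSet.empty _ (past s), rfl⟩
  · rintro A _ ⟨A', hA', h⟩
    refine ⟨A'ᶜ, MeasurableSet.compl hA', ?_⟩
    ext ω
    have := Set.ext_iff.1 h ω
    simp only [Set.mem_inter_iff, Set.mem_compl_iff] at this ⊢
    tauto
  · intro f _ hf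
    choose g hg h using hf
    refine ⟨⋃ i, g i, MeasurableSet.iUnion hg, ?_⟩
    rw [Set.iUnion_inter, Set.iUnion_inter]
    exact Set.iUnion_congr h

end Sampling

/-! ### Round Robin CUSUM as a Markov chain. -/

section RoundRobin

variable {R : Type*} [MeasurableSpace R] {K : ℕ} {X : Fin K → Type*} [∀ k, MeasurableSpace (X k)]
  {U : Finset (Finset (Fin K))} {N : ℕ} [NeZero N]
  {F : Measure (∀ k, X k)} {𝒢 : Set (Measure (∀ k, X k))} {e : Fin N ≃ U}

/-- One move of the Round Robin state, when the log-likelihood ratio is `x`. -/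
noncomputable def rrMove (s : Fin N × ℝ) (x : ℝ) : Fin N × ℝ :=
  (if max s.2 0 + x ≤ 0 then s.1 + 1 else s.1, max s.2 0 + x)

lemma rrState_succ (n : ℕ) (ω : Sample R X) :
    rrState F 𝒢 e (n + 1) ω = rrMove (rrState F 𝒢 e n ω)
      (mixLLR F 𝒢 (e (rrState F 𝒢 e n ω).1 : Finset (Fin K))
        ((e (rrState F 𝒢 e n ω).1 : Finset (Fin K)).restrict (ω.2 n))) := rfl

lemma measurable_rrMove : Measurable fun p : (Fin N × ℝ) × ℝ => rrMove p.1 p.2 := by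
  unfold rrMove
  have h : Measurable fun p : (Fin N × ℝ) × ℝ => max p.1.2 0 + p.2 := by fun_prop
  refine Measurable.prodMk (Measurable.ite (measurableSet_le h measurable_const) ?_ ?_) h
  · exact (measurable_from_top (f := fun d : Fin N => d + 1)).comp
      (measurable_fst.comp measurable_fst)
  · fun_prop

lemma measurable_increment : Measurable fun p : Fin N × (∀ k, X k) =>
    mixLLR F 𝒢 (e p.1 : Finset (Fin K)) ((e p.1 : Finset (Fin K)).restrict p.2) := by
  have h : ∀ d : Fin N, Measurable fun v : ∀ k, X k =>
      mixLLR F 𝒢 (e d : Finset (Fin K)) ((e d : Finset (Fin K)).restrict v) := fun d =>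
    measurable_mixLLR.comp (Finset.measurable_restrict _)
  intro B hB
  have : (fun p : Fin N × (∀ k, X k) =>
      mixLLR F 𝒢 (e p.1 : Finset (Fin K)) ((e p.1 : Finset (Fin K)).restrict p.2)) ⁻¹' B =
      ⋃ d : Fin N, {d} ×ˢ ((fun v : ∀ k, X k =>
        mixLLR F 𝒢 (e d : Finset (Fin K)) ((e d : Finset (Fin K)).restrict v)) ⁻¹' B) := by
    ext ⟨d, v⟩
    simp
  rw [this]
  exact MeasurableSet.iUnion fun d => (measurableSet_singleton d).prod (h d hB)

lemma measurable_rrMove_increment : Measurable fun p : (Fin N × ℝ) × (∀ k, X k) =>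
    rrMove p.1 (mixLLR F 𝒢 (e p.1.1 : Finset (Fin K))
      ((e p.1.1 : Finset (Fin K)).restrict p.2)) :=
  measurable_rrMove.comp (measurable_fst.prodMk (measurable_increment.comp
    ((measurable_fst.comp measurable_fst).prodMk measurable_snd)))

lemma measurable_rrState (n : ℕ) :
    Measurable (rrState F 𝒢 e n : Sample R X → Fin N × ℝ) := by
  induction n with
  | zero => exact measurable_const
  | succ n ih =>
    exact measurable_rrMove_increment.comp
      (ih.prodMk ((measurable_pi_apply n).comp measurable_snd))

lemma rrState_eq_of_agree {n : ℕ} {ω ω' : Sample R X} (h : Agree n ω ω') :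
    rrState F 𝒢 e n ω = rrState F 𝒢 e n ω' := by
  induction n with
  | zero => rfl
  | succ n ih =>
    rw [rrState_succ, rrState_succ, ih (h.mono n.le_succ), h.2 n n.lt_succ_self]

lemma measurable_past_rrState {k n : ℕ} (h : k ≤ n) :
    Measurable[past n] (rrState F 𝒢 e k : Sample R X → Fin N × ℝ) :=
  measurable_past (measurable_rrState k) fun _ _ H => rrState_eq_of_agree (H.mono h)

lemma measurableSet_past_rrS (n : ℕ) (E : Finset (Fin K)) :
    MeasurableSet[past n] {ω : Sample R X | rrS F 𝒢 e n ω = E} := by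
  have : {ω : Sample R X | rrS F 𝒢 e n ω = E} =
      rrState F 𝒢 e n ⁻¹' (Prod.fst ⁻¹' {d | (e d : Finset (Fin K)) = E}) := rfl
  rw [this]
  exact measurable_past_rrState le_rfl (measurable_fst (MeasurableSet.of_discrete))

/-- No alarm has been raised up to time `n`. -/
def alive (F : Measure (∀ k, X k)) (𝒢 : Set (Measure (∀ k, X k))) (e : Fin N ≃ U) (a : ℝ) (n : ℕ) :
    Set (Sample R X) :=
  {ω | ∀ k ≤ n, (rrState F 𝒢 e k ω).2 < a}

lemma measurableSet_past_rrState_snd {k n : ℕ} (h : k ≤ n) {B : Set ℝ} (hB : MeasurableSet B) :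
    MeasurableSet[past n] {ω : Sample R X | (rrState F 𝒢 e k ω).2 ∈ B} :=
  measurable_past_rrState h (measurable_snd hB)

lemma measurableSet_past_alive (a : ℝ) (n : ℕ) :
    MeasurableSet[past n] (alive F 𝒢 e a n : Set (Sample R X)) := by
  have : (alive F 𝒢 e a n : Set (Sample R X)) =
      ⋂ k, ⋂ (_ : k ≤ n), {ω | (rrState F 𝒢 e k ω).2 ∈ Set.Iio a} := by
    ext; simp [alive]
  rw [this]
  exact MeasurableSet.iInter fun k => MeasurableSet.iInter fun hk =>
    measurableSet_past_rrState_snd hk measurableSet_Iio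

lemma alive_succ (a : ℝ) (n : ℕ) : (alive F 𝒢 e a (n + 1) : Set (Sample R X)) =
    alive F 𝒢 e a n ∩ {ω | (rrState F 𝒢 e (n + 1) ω).2 < a} := by
  ext ω
  simp only [alive, Set.mem_ofPred_eq, Set.mem_inter_iff]
  constructor
  · intro h; exact ⟨fun k hk => h k (by omega), h _ le_rfl⟩
  · rintro ⟨h1, h2⟩ k hk
    rcases Nat.le_succ_iff.1 hk with hk | rfl
    exacts [h1 k hk, h2]

/-- Positivity of `a` is needed at time 0: the event `alive` inspects Y_0 = 0, while the alarm time
only looks at times n ≥ 1. -/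
lemma lt_rrT_iff {a : ℝ} (ha : 0 < a) (n : ℕ) (ω : Sample R X) :
    (n : ℕ∞) < rrT F 𝒢 e a ω ↔ ω ∈ alive F 𝒢 e a n := by
  constructor
  · intro h k hk
    by_contra! hak
    rcases Nat.eq_zero_or_pos k with rfl | hk0
    · have : (rrState F 𝒢 e 0 ω).2 = 0 := rfl
      linarith
    · have : rrT F 𝒢 e a ω ≤ k := sInf_le ⟨k, hk0, hak, rfl⟩
      exact absurd (h.trans_le this) (not_lt.2 (by exact_mod_cast hk))
  · intro h
    have : ((n + 1 : ℕ) : ℕ∞) ≤ rrT F 𝒢 e a ω := by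
      refine le_sInf ?_
      rintro t ⟨k, hk, hak, rfl⟩
      rw [Nat.cast_le]
      by_contra! hkn
      exact absurd (h k (by omega)) (not_lt.2 hak)
    exact lt_of_lt_of_le (by exact_mod_cast n.lt_succ_self) this

variable (ρ : Measure R) [IsProbabilityMeasure ρ] (μ : ℕ → Measure (∀ k, X k))
  [∀ n, IsProbabilityMeasure (μ n)]

/-- Integrating out one observation of Round Robin. -/
lemma setLIntegral_rrState_succ (n : ℕ) {A : Set (Sample R X)} (hA : MeasurableSet[past n] A)
    {g : Fin N × ℝ → ℝ≥0∞} (hg : Measurable g) :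
    ∫⁻ ω in A, g (rrState F 𝒢 e (n + 1) ω) ∂seqLaw ρ μ =
      ∫⁻ ω in A, ∫⁻ x, g (rrMove (rrState F 𝒢 e n ω) x)
        ∂stepLaw F 𝒢 (μ n) (e (rrState F 𝒢 e n ω).1) ∂seqLaw ρ μ := by
  have hA' := past_le _ _ hA
  rw [← lintegral_indicator hA', ← lintegral_indicator hA']
  let H : Fin N × ℝ → (∀ k, X k) → ℝ≥0∞ := fun s x =>
    g (rrMove s (mixLLR F 𝒢 (e s.1 : Finset (Fin K)) ((e s.1 : Finset (Fin K)).restrict x)))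
  let f : Sample R X → (∀ k, X k) → ℝ≥0∞ := fun ω x => A.indicator (fun ω =>
    H (rrState F 𝒢 e n ω) x) ω
  have hf : Measurable (Function.uncurry f) := by
    have h1 : Measurable fun p : Sample R X × (∀ k, X k) =>
        g (rrMove (rrState F 𝒢 e n p.1) (mixLLR F 𝒢 (e (rrState F 𝒢 e n p.1).1 : Finset (Fin K))
          ((e (rrState F 𝒢 e n p.1).1 : Finset (Fin K)).restrict p.2))) :=
      hg.comp (measurable_rrMove_increment.comp
        (((measurable_rrState n).comp measurable_fst).prodMk measurable_snd))
    exact h1.indicator (measurable_fst hA')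
  have hdep : ∀ ω x y, f (resample ω n x) y = f ω y := by
    intro ω x y
    have h1 : rrState F 𝒢 e n (resample ω n x) = rrState F 𝒢 e n ω :=
      rrState_eq_of_agree (agree_resample n ω x)
    by_cases h : ω ∈ A
    · simp [f, h, (mem_resample hA ω x).2 h, h1]
    · simp [f, h, (mem_resample hA ω x).not.2 h]
  have key := lintegral_seqLaw_step ρ μ n hf hdep
  refine Eq.trans (lintegral_congr fun ω => ?_) (key.trans (lintegral_congr fun ω => ?_))
  · by_cases h : ω ∈ A <;> simp [f, H, h, rrState_succ]
  · by_cases h : ω ∈ A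
    · simp only [f, H, Set.indicator_of_mem h]
      rw [lintegral_stepLaw]
      exact hg.comp (measurable_rrMove.comp (measurable_const.prodMk measurable_id))
    · simp [f, h]

/-- A potential that decreases in the mean by at least one at each step bounds the expected time
until the alarm. -/
theorem tsum_alive_le_potential {L : Measure (∀ k, X k)} {ν : ℕ} (hμ : ∀ n ≥ ν, μ n = L) (a : ℝ)
    {Φ : Fin N × ℝ → ℝ≥0∞} (hΦ : Measurable Φ)
    (hdrift : ∀ s : Fin N × ℝ, s.2 < a →
      ∫⁻ x, {z : Fin N × ℝ | z.2 < a}.indicator Φ (rrMove s x) ∂stepLaw F 𝒢 L (e s.1) + 1 ≤ Φ s)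
    {A : Set (Sample R X)} (hA : MeasurableSet[past ν] A) :
    ∑' i : ℕ, seqLaw ρ μ (A ∩ alive F 𝒢 e a (ν + i)) ≤
      ∫⁻ ω in A ∩ alive F 𝒢 e a ν, Φ (rrState F 𝒢 e ν ω) ∂seqLaw ρ μ := by
  have hm : MeasurableSet {z : Fin N × ℝ | z.2 < a} := measurableSet_lt measurable_snd measurable_const
  have hstep : ∀ n ≥ ν, ∫⁻ ω in A ∩ alive F 𝒢 e a (n + 1), Φ (rrState F 𝒢 e (n + 1) ω) ∂seqLaw ρ μ +
      seqLaw ρ μ (A ∩ alive F 𝒢 e a n) ≤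
      ∫⁻ ω in A ∩ alive F 𝒢 e a n, Φ (rrState F 𝒢 e n ω) ∂seqLaw ρ μ := by
    intro n hn
    have hAn : MeasurableSet[past n] (A ∩ alive F 𝒢 e a n) :=
      MeasurableSet.inter (past_mono hn _ hA) (measurableSet_past_alive a n)
    have hAn' := past_le _ _ hAn
    have h1 : ∫⁻ ω in A ∩ alive F 𝒢 e a (n + 1), Φ (rrState F 𝒢 e (n + 1) ω) ∂seqLaw ρ μ =
        ∫⁻ ω in A ∩ alive F 𝒢 e a n,
          {z : Fin N × ℝ | z.2 < a}.indicator Φ (rrState F 𝒢 e (n + 1) ω) ∂seqLaw ρ μ := by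
      have hm' : MeasurableSet {ω : Sample R X | (rrState F 𝒢 e (n + 1) ω).2 < a} :=
        (measurable_rrState (n + 1)) hm
      rw [alive_succ, ← Set.inter_assoc, Set.inter_comm, ← Measure.restrict_restrict hm',
        ← lintegral_indicator hm']
      rfl
    rw [h1, setLIntegral_rrState_succ ρ μ n hAn (hΦ.indicator hm), hμ n hn]
    have h2 : seqLaw ρ μ (A ∩ alive F 𝒢 e a n) = ∫⁻ _ in A ∩ alive F 𝒢 e a n, 1 ∂seqLaw ρ μ := by
      simp
    rw [h2, ← lintegral_add_right _ measurable_const]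
    refine setLIntegral_mono' hAn' fun ω hω => ?_
    exact hdrift _ (hω.2 n le_rfl)
  -- The drift inequality telescopes; the remaining potential is dropped at the end.
  have hsum : ∀ n : ℕ, ∑ i ∈ Finset.range n, seqLaw ρ μ (A ∩ alive F 𝒢 e a (ν + i)) +
      ∫⁻ ω in A ∩ alive F 𝒢 e a (ν + n), Φ (rrState F 𝒢 e (ν + n) ω) ∂seqLaw ρ μ ≤
      ∫⁻ ω in A ∩ alive F 𝒢 e a ν, Φ (rrState F 𝒢 e ν ω) ∂seqLaw ρ μ := by
    intro n
    induction n with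
    | zero => simp
    | succ n ih =>
      refine le_trans ?_ ih
      rw [Finset.sum_range_succ, add_assoc]
      gcongr
      rw [add_comm]
      exact hstep (ν + n) (Nat.le_add_right _ _)
  exact ENNReal.tsum_le_of_sum_range_le fun n => le_self_add.trans (hsum n)

lemma setLIntegral_rrT_sub {a : ℝ} (ha : 0 < a) (ν : ℕ) (A : Set (Sample R X)) :
    ∫⁻ ω in A, ((rrT F 𝒢 e a ω : ℝ≥0∞) - (ν : ℝ≥0∞)) ∂seqLaw ρ μ =
      ∑' i : ℕ, seqLaw ρ μ (A ∩ alive F 𝒢 e a (ν + i)) := by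
  classical
  have hm : ∀ i, MeasurableSet (alive F 𝒢 e a i : Set (Sample R X)) := fun i =>
    past_le _ _ (measurableSet_past_alive a i)
  have h1 : ∀ ω : Sample R X, (rrT F 𝒢 e a ω : ℝ≥0∞) - (ν : ℝ≥0∞) =
      ∑' i : ℕ, (alive F 𝒢 e a (ν + i)).indicator 1 ω := fun ω => by
    rw [enat_sub_eq_tsum]
    refine tsum_congr fun i => ?_
    rw [Set.indicator_apply]
    simp only [lt_rrT_iff ha, Pi.one_apply]
  rw [lintegral_congr h1, lintegral_tsum fun i => (measurable_one.indicator (hm _)).aemeasurable]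
  refine tsum_congr fun i => ?_
  rw [lintegral_indicator_one (hm _), Measure.restrict_apply (hm _), Set.inter_comm]

end RoundRobin

lemma exists_pos_measure_Ici_ne_zero {κ : Measure ℝ} (h : κ (Set.Ioi 0) ≠ 0) :
    ∃ n : ℕ, κ (Set.Ici (1 / ((n : ℝ) + 1))) ≠ 0 := by
  by_contra! H
  refine h (measure_mono_null (t := ⋃ n : ℕ, Set.Ici (1 / ((n : ℝ) + 1))) ?_
    (measure_iUnion_null H))
  intro x hx
  obtain ⟨n, hn⟩ := exists_nat_one_div_lt (Set.mem_Ioi.1 hx)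
  exact Set.mem_iUnion.2 ⟨n, Set.mem_Ici.2 hn.le⟩

/-- Finitely many step laws charging the positive half-line charge a common half-line, away
from zero. -/
lemma exists_uniform_step {ι : Type*} [Finite ι] {κ : ι → Measure ℝ}
    (h : ∀ i, κ i (Set.Ioi 0) ≠ 0) :
    ∃ δ : ℝ, 0 < δ ∧ ∃ p : ℝ, 0 < p ∧ ∀ i, ENNReal.ofReal p ≤ κ i (Set.Ici δ) := by
  cases nonempty_fintype ι
  choose n hn using fun i => exists_pos_measure_Ici_ne_zero (h i)
  obtain ⟨M, hM⟩ : ∃ M : ℕ, ∀ i, n i ≤ M :=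
    ⟨Finset.univ.sup n, fun i => Finset.le_sup (Finset.mem_univ i)⟩
  have hpos : ∀ i, κ i (Set.Ici (1 / ((M : ℝ) + 1))) ≠ 0 := fun i h0 =>
    hn i (measure_mono_null (Set.Ici_subset_Ici.2 (by
      have : (n i : ℝ) ≤ M := by exact_mod_cast hM i
      exact one_div_le_one_div_of_le (by positivity) (by linarith))) h0)
  refine ⟨1 / ((M : ℝ) + 1), by positivity, ?_⟩
  rcases isEmpty_or_nonempty ι with hι | hι
  · exact ⟨1, one_pos, fun i => (hι.false i).elim⟩
  let q : ι → ℝ≥0∞ := fun i => min 1 (κ i (Set.Ici (1 / ((M : ℝ) + 1))))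
  obtain ⟨i₀, hi₀⟩ := Finite.exists_min q
  have hq0 : q i₀ ≠ 0 := by
    have := pos_iff_ne_zero.2 (hpos i₀)
    exact (lt_min one_pos this).ne'
  have hqt : q i₀ ≠ ⊤ := ((min_le_left _ _).trans_lt ENNReal.one_lt_top).ne
  refine ⟨(q i₀).toReal, ENNReal.toReal_pos hq0 hqt, fun i => ?_⟩
  rw [ENNReal.ofReal_toReal hqt]
  exact (hi₀ i).trans (min_le_right _ _)

/-! ### Finiteness of the alarm time, and false alarms. -/

section RoundRobin

variable {R : Type*} [MeasurableSpace R] {K : ℕ} {X : Fin K → Type*} [∀ k, MeasurableSpace (X k)]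
  {U : Finset (Finset (Fin K))} {N : ℕ} [NeZero N]
  {F : Measure (∀ k, X k)} {𝒢 : Set (Measure (∀ k, X k))} {e : Fin N ≃ U}

section Finiteness

variable (ρ : Measure R) [IsProbabilityMeasure ρ] (μ : ℕ → Measure (∀ k, X k))
  [∀ n, IsProbabilityMeasure (μ n)]

/-- The potential is M - exp(θ max(Y, 0)). Every unit makes a step of at least δ with probability at
least p, and p exp(θ δ) ≥ 2 makes the exponential grow by at least one in the mean, whatever the
sign of the drift. -/
lemma tsum_alive_ne_top {L : Measure (∀ k, X k)} [IsProbabilityMeasure L] {ν : ℕ}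
    (hμ : ∀ n ≥ ν, μ n = L) (hL : ∀ d : Fin N, stepLaw F 𝒢 L (e d) (Set.Ioi 0) ≠ 0) (a : ℝ) :
    ∑' i : ℕ, seqLaw ρ μ (alive F 𝒢 e a (ν + i)) ≠ ⊤ := by
  obtain ⟨δ, hδ, p, hp, hδp⟩ := exists_uniform_step hL
  obtain ⟨θ, hθ0, hθ⟩ : ∃ θ : ℝ, 0 < θ ∧ 2 ≤ p * Real.exp (θ * δ) := by
    have h1 : Tendsto (fun θ : ℝ => p * Real.exp (θ * δ)) atTop atTop :=
      (Real.tendsto_exp_atTop.comp (tendsto_id.atTop_mul_const hδ)).const_mul_atTop hp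
    obtain ⟨θ, h2, h3⟩ := ((h1.eventually_ge_atTop 2).and (eventually_gt_atTop 0)).exists
    exact ⟨θ, h3, h2⟩
  -- The extra δ keeps the exponential credited for a step of size δ below `M`, even if that step
  -- raises an alarm.
  set b := max a 0 + δ with hb
  let w : ℝ → ℝ≥0∞ := fun y => ENNReal.ofReal (Real.exp (θ * max y 0))
  let M : ℝ≥0∞ := ENNReal.ofReal (Real.exp (θ * b))
  let Φ : Fin N × ℝ → ℝ≥0∞ := fun s => M - w s.2
  have hwm : Measurable w := by fun_prop
  have hΦ : Measurable Φ := measurable_const.sub (hwm.comp measurable_snd)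
  have hwM : ∀ y, y < a → w y ≤ M := fun y hy => by
    refine ENNReal.ofReal_le_ofReal (Real.exp_le_exp.2 (mul_le_mul_of_nonneg_left ?_ hθ0.le))
    have := max_le_max hy.le (le_refl (0 : ℝ))
    linarith
  have hw1 : ∀ y, 1 ≤ w y := fun y => by
    rw [← ENNReal.ofReal_one]
    exact ENNReal.ofReal_le_ofReal (Real.one_le_exp (mul_nonneg hθ0.le (le_max_right _ _)))
  refine ne_top_of_le_ne_top (b := M) ENNReal.ofReal_ne_top ?_
  have key := tsum_alive_le_potential (F := F) (𝒢 := 𝒢) (e := e) ρ μ hμ a hΦ ?_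
    (A := Set.univ) (@MeasurableSet.univ _ (past ν))
  · simp only [Set.univ_inter] at key
    refine key.trans ((lintegral_mono fun ω => tsub_le_self).trans ?_)
    rw [lintegral_const]
    refine mul_le_of_le_one_right zero_le ?_
    rw [Measure.restrict_apply_univ]
    exact prob_le_one
  rintro ⟨d, y⟩ hy
  dsimp only at hy
  set κ := stepLaw F 𝒢 L (e d) with hκ
  have hsplit : ∫⁻ x, {z : Fin N × ℝ | z.2 < a}.indicator Φ (rrMove (d, y) x) ∂κ +
      ∫⁻ x, (Set.Ici δ).indicator (fun _ => ENNReal.ofReal (Real.exp (θ * (max y 0 + δ)))) x ∂κ ≤ M := by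
    rw [← lintegral_add_right _ (measurable_const.indicator measurableSet_Ici)]
    have : ∫⁻ _, M ∂κ = M := by simp
    rw [← this]
    refine lintegral_mono fun x => ?_
    have hsnd : (rrMove (d, y) x).2 = max y 0 + x := rfl
    by_cases hx : max y 0 + x < a
    · rw [Set.indicator_of_mem (by simpa [hsnd] using hx)]
      have h3 : w (max y 0 + x) ≤ M := hwM _ hx
      refine le_trans (add_le_add (le_refl _) ?_) (tsub_add_cancel_of_le h3).le
      by_cases hxδ : x ∈ Set.Ici δ
      · rw [Set.indicator_of_mem hxδ]
        refine ENNReal.ofReal_le_ofReal (Real.exp_le_exp.2 (mul_le_mul_of_nonneg_left ?_ hθ0.le))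
        have := Set.mem_Ici.1 hxδ
        exact le_max_of_le_left (by linarith)
      · rw [Set.indicator_of_notMem hxδ]; exact zero_le
    · rw [Set.indicator_of_notMem (by simpa [hsnd] using hx), zero_add]
      refine (Set.indicator_le_self _ _ x).trans ?_
      refine ENNReal.ofReal_le_ofReal (Real.exp_le_exp.2 (mul_le_mul_of_nonneg_left ?_ hθ0.le))
      have := max_le_max hy.le (le_refl (0 : ℝ))
      linarith
  have hgain : 1 + w y ≤ ∫⁻ x, (Set.Ici δ).indicator
      (fun _ => ENNReal.ofReal (Real.exp (θ * (max y 0 + δ)))) x ∂κ := by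
    rw [lintegral_indicator_const measurableSet_Ici]
    calc 1 + w y ≤ w y + w y := by gcongr; exact hw1 y
      _ = ENNReal.ofReal (2 * Real.exp (θ * max y 0)) := by
        rw [two_mul, ENNReal.ofReal_add (Real.exp_pos _).le (Real.exp_pos _).le]
      _ ≤ ENNReal.ofReal (Real.exp (θ * (max y 0 + δ)) * p) := by
        refine ENNReal.ofReal_le_ofReal ?_
        rw [mul_add, Real.exp_add]
        nlinarith [Real.exp_pos (θ * max y 0)]
      _ ≤ _ := by
        rw [ENNReal.ofReal_mul (Real.exp_pos _).le]
        gcongr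
        exact hδp d
  have hwt : w y ≠ ⊤ := ENNReal.ofReal_ne_top
  refine ENNReal.le_sub_of_add_le_right hwt ?_
  rw [add_assoc]
  exact (add_le_add (le_refl _) hgain).trans hsplit

lemma ae_rrT_ne_top {L : Measure (∀ k, X k)} [IsProbabilityMeasure L] {ν : ℕ}
    (hμ : ∀ n ≥ ν, μ n = L) (hL : ∀ d : Fin N, stepLaw F 𝒢 L (e d) (Set.Ioi 0) ≠ 0)
    {a : ℝ} (ha : 0 < a) : ∀ᵐ ω ∂seqLaw ρ μ, rrT F 𝒢 e a ω ≠ ⊤ := by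
  have h0 := ENNReal.tendsto_atTop_zero_of_tsum_ne_top (tsum_alive_ne_top (e := e) ρ μ hμ hL a)
  rw [ae_iff]
  refine le_antisymm (ge_of_tendsto' h0 fun i => measure_mono fun ω hω => ?_) zero_le
  rw [← lt_rrT_iff ha]
  have : rrT F 𝒢 e a ω = ⊤ := by simpa using hω
  rw [this]
  exact ENat.natCast_lt_top _

/-- The mean time until a false alarm is at least the exponential of the threshold. -/
theorem le_tsum_alive [IsProbabilityMeasure F] (h : ∀ d : Fin N, RegularUnit F 𝒢 (e d))
    {a : ℝ} (ha : 0 < a) :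
    ENNReal.ofReal (Real.exp a) ≤
      ∑' i : ℕ, seqLaw ρ (fun _ => F) (alive F 𝒢 e a i : Set (Sample R X)) := by
  set P : Measure (Sample R X) := seqLaw ρ (fun _ => F) with hP
  have hfin : ∑' i : ℕ, P (alive F 𝒢 e a (0 + i)) ≠ ⊤ :=
    tsum_alive_ne_top ρ (fun _ => F) (ν := 0) (fun _ _ => rfl)
      (fun d => (h d).stepLaw_Ioi_ne_zero) a
  simp only [zero_add] at hfin
  have hm : ∀ n, MeasurableSet (alive F 𝒢 e a n : Set (Sample R X)) := fun n =>
    past_le _ _ (measurableSet_past_alive a n)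
  let w : Fin N × ℝ → ℝ≥0∞ := fun s => ENNReal.ofReal (Real.exp (max s.2 0))
  have hw : Measurable w := by fun_prop
  let g : Fin N × ℝ → ℝ≥0∞ := fun s => ENNReal.ofReal (Real.exp s.2)
  have hg : Measurable g := by fun_prop
  set c := ENNReal.ofReal (Real.exp a) with hc
  -- Optional stopping by hand: the mean of exp(max(Y, 0)) up to the alarm, with the value at the
  -- alarm replaced by its lower bound exp(a), is at most the expected number of steps.
  have key : ∀ n, ∫⁻ ω in alive F 𝒢 e a n, w (rrState F 𝒢 e n ω) ∂P +
      c * P (alive F 𝒢 e a n)ᶜ ≤ ∑ i ∈ Finset.range (n + 1), P (alive F 𝒢 e a i) := by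
    intro n
    induction n with
    | zero =>
      have : (alive F 𝒢 e a 0 : Set (Sample R X)) = Set.univ := by
        ext ω
        simp only [alive, Set.mem_ofPred_eq, Set.mem_univ, iff_true]
        intro k hk
        obtain rfl := Nat.le_zero.1 hk
        exact ha
      rw [this]
      have h1 : ∀ ω : Sample R X, w (rrState F 𝒢 e 0 ω) = 1 := fun ω => by simp [w, rrState]
      simp [h1, this]
    | succ n ih =>
      have hma : MeasurableSet {ω : Sample R X | (rrState F 𝒢 e (n + 1) ω).2 < a} :=
        measurableSet_lt (measurable_snd.comp (measurable_rrState _)) measurable_const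
      have hstep : ∫⁻ ω in alive F 𝒢 e a n, g (rrState F 𝒢 e (n + 1) ω) ∂P =
          ∫⁻ ω in alive F 𝒢 e a n, w (rrState F 𝒢 e n ω) ∂P := by
        rw [setLIntegral_rrState_succ ρ _ n (measurableSet_past_alive a n) hg]
        refine lintegral_congr fun ω => ?_
        have h2 : ∀ x, g (rrMove (rrState F 𝒢 e n ω) x) =
            w (rrState F 𝒢 e n ω) * ENNReal.ofReal (Real.exp x) := fun x => by
          simp only [g, w, rrMove]
          rw [Real.exp_add, ENNReal.ofReal_mul (Real.exp_pos _).le]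
        rw [lintegral_congr h2, lintegral_const_mul _ (by fun_prop),
          (h _).lintegral_exp_stepLaw, mul_one]
      -- Replacing a negative Y by zero raises its exponential by at most one, which is charged to
      -- survival at time n + 1. Where the alarm is raised, exp(Y) ≥ exp(a).
      have hdecomp : ∫⁻ ω in alive F 𝒢 e a (n + 1), w (rrState F 𝒢 e (n + 1) ω) ∂P +
          c * P (alive F 𝒢 e a n \ alive F 𝒢 e a (n + 1)) ≤
          ∫⁻ ω in alive F 𝒢 e a n, g (rrState F 𝒢 e (n + 1) ω) ∂P +
            P (alive F 𝒢 e a (n + 1)) := by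
        have hsub : (alive F 𝒢 e a (n + 1) : Set (Sample R X)) ⊆ alive F 𝒢 e a n := by
          rw [alive_succ]; exact Set.inter_subset_left
        rw [← lintegral_inter_add_sdiff (fun ω => g (rrState F 𝒢 e (n + 1) ω)) (alive F 𝒢 e a n) (hm (n + 1)),
          Set.inter_eq_right.2 hsub, add_right_comm]
        refine add_le_add ?_ ?_
        · have h3 : P (alive F 𝒢 e a (n + 1)) = ∫⁻ _ in alive F 𝒢 e a (n + 1), 1 ∂P := by simp
          rw [h3, ← lintegral_add_right _ measurable_const]
          refine lintegral_mono fun ω => ?_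
          simp only [w, g]
          rcases le_total (rrState F 𝒢 e (n + 1) ω).2 0 with h4 | h4
          · rw [max_eq_right h4]; simp
          · rw [max_eq_left h4]; exact le_self_add
        · rw [← setLIntegral_const]
          refine setLIntegral_mono' ((hm n).diff (hm (n + 1))) fun ω hω => ?_
          refine ENNReal.ofReal_le_ofReal (Real.exp_le_exp.2 ?_)
          by_contra! hlt
          refine hω.2 ?_
          rw [alive_succ]
          exact ⟨hω.1, hlt⟩
      have hcompl : P (alive F 𝒢 e a (n + 1))ᶜ ≤ P (alive F 𝒢 e a n)ᶜ +
          P (alive F 𝒢 e a n \ alive F 𝒢 e a (n + 1)) := by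
        refine (measure_mono fun ω hω => ?_).trans (measure_union_le _ _)
        by_cases hn : ω ∈ (alive F 𝒢 e a n : Set (Sample R X))
        · exact Or.inr ⟨hn, hω⟩
        · exact Or.inl hn
      rw [Finset.sum_range_succ]
      calc _ ≤ ∫⁻ ω in alive F 𝒢 e a (n + 1), w (rrState F 𝒢 e (n + 1) ω) ∂P +
            (c * P (alive F 𝒢 e a n)ᶜ + c * P (alive F 𝒢 e a n \ alive F 𝒢 e a (n + 1))) := by
              rw [← mul_add]; gcongr
        _ = (∫⁻ ω in alive F 𝒢 e a (n + 1), w (rrState F 𝒢 e (n + 1) ω) ∂P +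
            c * P (alive F 𝒢 e a n \ alive F 𝒢 e a (n + 1))) + c * P (alive F 𝒢 e a n)ᶜ := by
              rw [add_comm (c * _), add_assoc]
        _ ≤ (∫⁻ ω in alive F 𝒢 e a n, w (rrState F 𝒢 e n ω) ∂P + P (alive F 𝒢 e a (n + 1))) +
            c * P (alive F 𝒢 e a n)ᶜ := by
              rw [← hstep]; gcongr
        _ = (∫⁻ ω in alive F 𝒢 e a n, w (rrState F 𝒢 e n ω) ∂P + c * P (alive F 𝒢 e a n)ᶜ) +
            P (alive F 𝒢 e a (n + 1)) := by rw [add_right_comm]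
        _ ≤ _ := by gcongr
  have h0 := ENNReal.tendsto_atTop_zero_of_tsum_ne_top hfin
  -- The alarm is almost surely raised, so the bound by `c` times the probability of an alarm
  -- becomes sharp in the limit.
  have hlim : Tendsto (fun n => c * (1 - P (alive F 𝒢 e a n))) atTop (𝓝 (c * (1 - 0))) :=
    ENNReal.Tendsto.const_mul (ENNReal.Tendsto.sub tendsto_const_nhds h0 (Or.inl ENNReal.one_ne_top))
      (Or.inr ENNReal.ofReal_ne_top)
  rw [tsub_zero, mul_one] at hlim
  refine le_of_tendsto' hlim fun n => ?_
  rw [← prob_compl_eq_one_sub (hm n)]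
  exact le_add_self.trans ((key n).trans (ENNReal.sum_le_tsum _))

end Finiteness

lemma one_le_rrT (a : ℝ) (ω : Sample R X) : 1 ≤ rrT F 𝒢 e a ω := by
  refine le_sInf ?_
  rintro t ⟨k, hk, -, rfl⟩
  exact_mod_cast hk

lemma obsFiltration_mono (S : ℕ → Sample R X → Finset (Fin K)) : Monotone (obsFiltration S) :=
  monotone_nat_of_le_succ fun _ => le_sup_left

/-- The update reads only the pair of sampled set and sampled values. The state is therefore adapted
to the collected observations, not merely to the full past. -/
lemma measurable_obsFiltration_rrState (n : ℕ) :
    Measurable[obsFiltration (rrS F 𝒢 e) n] (rrState F 𝒢 e n : Sample R X → Fin N × ℝ) := by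
  induction n with
  | zero => exact measurable_const
  | succ n ih =>
    have hG : Measurable fun p : (Fin N × ℝ) × (Σ E : Finset (Fin K), ∀ k : E, X k) =>
        mixLLR F 𝒢 p.2.1 p.2.2 := by
      have h1 : Measurable fun q : (Σ E : Finset (Fin K), ∀ k : E, X k) => mixLLR F 𝒢 q.1 q.2 :=
        measurable_sigma_of fun E => measurable_mixLLR
      exact h1.comp measurable_snd
    have h2 : (rrState F 𝒢 e (n + 1) : Sample R X → Fin N × ℝ) = fun ω =>
        rrMove (rrState F 𝒢 e n ω)
          (mixLLR F 𝒢 (observed (rrS F 𝒢 e) n ω).1 (observed (rrS F 𝒢 e) n ω).2) := rfl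
    rw [h2]
    have h3 : Measurable[obsFiltration (rrS F 𝒢 e) (n + 1)]
        (rrState F 𝒢 e n : Sample R X → Fin N × ℝ) := ih.mono le_sup_left le_rfl
    have h4 : Measurable[obsFiltration (rrS F 𝒢 e) (n + 1)]
        (observed (rrS F 𝒢 e) n : Sample R X → _) :=
      (comap_measurable (observed (rrS F 𝒢 e) n)).mono le_sup_right le_rfl
    have h5 := hG.comp (h3.prodMk h4)
    exact measurable_rrMove.comp (h3.prodMk h5)

theorem isPolicy_rr (ρ : Measure R) [IsProbabilityMeasure ρ] [IsProbabilityMeasure F]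
    (h𝒢 : ∀ G ∈ 𝒢, IsProbabilityMeasure G) {m : ℕ} (hU : ∀ E ∈ U, E.card = m)
    (h : ∀ d : Fin N, RegularUnit F 𝒢 (e d)) {a : ℝ} (ha : 0 < a) :
    IsPolicy ρ F 𝒢 m (rrS F 𝒢 e) (rrT F 𝒢 e a) where
  card_eq n ω := hU _ (e _).2
  adapted n E := by
    have : {ω : Sample R X | rrS F 𝒢 e n ω = E} =
        rrState F 𝒢 e n ⁻¹' (Prod.fst ⁻¹' {d | (e d : Finset (Fin K)) = E}) := rfl
    rw [this]
    exact measurable_obsFiltration_rrState n (measurable_fst (MeasurableSet.of_discrete))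
  one_le ω := one_le_rrT a ω
  stopping n := by
    have hlt : ∀ k, k ≤ n → MeasurableSet[obsFiltration (rrS F 𝒢 e) n]
        {ω : Sample R X | (k : ℕ∞) < rrT F 𝒢 e a ω} := by
      intro k hk
      have : {ω : Sample R X | (k : ℕ∞) < rrT F 𝒢 e a ω} =
          ⋂ i, ⋂ (_ : i ≤ k), rrState F 𝒢 e i ⁻¹' (Prod.snd ⁻¹' Set.Iio a) := by
        ext ω
        simp [lt_rrT_iff ha, alive]
      rw [this]
      exact MeasurableSet.iInter fun i => MeasurableSet.iInter fun hi =>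
        obsFiltration_mono _ (hi.trans hk) _
          (measurable_obsFiltration_rrState i (measurable_snd measurableSet_Iio))
    rcases Nat.eq_zero_or_pos n with rfl | hn
    · have : {ω : Sample R X | rrT F 𝒢 e a ω = ((0 : ℕ) : ℕ∞)} = ∅ := by
        ext ω
        have := one_le_rrT (F := F) (𝒢 := 𝒢) (e := e) a ω
        simp only [Set.mem_ofPred_eq, Set.mem_empty_iff_false, iff_false]
        intro h0
        rw [h0] at this
        exact absurd this (by simp)
      rw [this]
      exact @MeasurableSet.empty _ (obsFiltration (rrS F 𝒢 e) 0)
    · obtain ⟨k, rfl⟩ := Nat.exists_eq_add_of_le' hn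
      have : {ω : Sample R X | rrT F 𝒢 e a ω = ((k + 1 : ℕ) : ℕ∞)} =
          {ω | (k : ℕ∞) < rrT F 𝒢 e a ω} \ {ω | ((k + 1 : ℕ) : ℕ∞) < rrT F 𝒢 e a ω} := by
        ext ω
        simp only [Set.mem_ofPred_eq, Set.mem_sdiff, not_lt]
        constructor
        · intro h; rw [h]; exact ⟨by exact_mod_cast k.lt_succ_self, le_rfl⟩
        · rintro ⟨h1, h2⟩
          refine le_antisymm h2 ?_
          have := Order.add_one_le_of_lt h1
          exact_mod_cast this
      rw [this]
      exact @MeasurableSet.diff _ (obsFiltration (rrS F 𝒢 e) (k + 1)) _ _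
        (hlt k k.le_succ) (hlt (k + 1) le_rfl)
  finite_noChange := ae_rrT_ne_top ρ (fun _ => F) (L := F) (ν := 0) (fun _ _ => rfl)
    (fun d => (h d).stepLaw_Ioi_ne_zero) ha
  finite_change G hG ν := by
    have := h𝒢 G hG
    have : ∀ n : ℕ, IsProbabilityMeasure (if n < ν then F else G) := fun n => by
      split_ifs <;> infer_instance
    refine ae_rrT_ne_top ρ (fun n => if n < ν then F else G) (L := G) (ν := ν)
      (fun n hn => if_neg (not_lt.2 hn)) (fun d => ?_) ha
    by_cases hd : localLaw G (e d) = localLaw F (e d)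
    · rw [stepLaw_congr hd]
      exact (h d).stepLaw_Ioi_ne_zero
    · exact (h d).stepLaw_Ioi_ne_zero_of_ac ((h d).ac' _ ⟨G, hG, rfl, hd⟩)

lemma le_expNoChange_rr (ρ : Measure R) [IsProbabilityMeasure ρ] [IsProbabilityMeasure F]
    (h : ∀ d : Fin N, RegularUnit F 𝒢 (e d)) {a : ℝ} (ha : 0 < a) :
    ENNReal.ofReal (Real.exp a) ≤ expNoChange ρ F (rrT F 𝒢 e a : Sample R X → ℕ∞) := by
  refine (le_tsum_alive ρ h ha).trans (le_of_eq ?_)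
  have := setLIntegral_rrT_sub (F := F) (𝒢 := 𝒢) (e := e) ρ (fun _ => F) ha 0 Set.univ
  simp only [Nat.cast_zero, tsub_zero, Measure.restrict_univ, Set.univ_inter, zero_add] at this
  exact this.symm

end RoundRobin

/-- Reduces a drift inequality in `ℝ≥0∞` to one between real integrals, through a nonnegative
integrable majorant. -/
lemma lintegral_add_one_le_of_integral {κ : Measure ℝ} {g : ℝ → ℝ≥0∞} {b : ℝ → ℝ} {c : ℝ}
    (hb : Integrable b κ) (hb0 : ∀ x, 0 ≤ b x) (hg : ∀ x, g x ≤ ENNReal.ofReal (b x))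
    (hc : ∫ x, b x ∂κ + 1 ≤ c) : ∫⁻ x, g x ∂κ + 1 ≤ ENNReal.ofReal c := by
  refine (add_le_add (lintegral_mono hg) (le_refl _)).trans ?_
  rw [← ofReal_integral_eq_lintegral_ofReal hb (ae_of_all _ hb0), ← ENNReal.ofReal_one,
    ← ENNReal.ofReal_add (integral_nonneg hb0) zero_le_one]
  exact ENNReal.ofReal_le_ofReal hc

/-! ### Construction of the potential function. -/

section Potential

variable {N : ℕ} [NeZero N]

/-- `r d` is the number of cyclic moves from `d` to a fixed affected unit. It bounds the number of
unaffected units still to be visited before some affected one is reached. -/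
lemma exists_cyclic_distance {aff : Set (Fin N)} (haff : aff.Nonempty) :
    ∃ r : Fin N → ℕ, ∀ d, r d ≤ N ∧ (d ∉ aff → r (d + 1) + 1 = r d) := by
  obtain ⟨d₀, hd₀⟩ := haff
  refine ⟨fun d => (d₀ - d).val, fun d => ⟨(d₀ - d).isLt.le, fun hd => ?_⟩⟩
  have hne : d₀ - d ≠ 0 := by
    rw [sub_ne_zero]
    rintro rfl
    exact hd hd₀
  have h1 : d₀ - (d + 1) = d₀ - d - 1 := by rw [sub_add_eq_sub_sub]
  beta_reduce
  rw [h1, Fin.val_sub_one_of_ne_zero hne]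
  have : (d₀ - d).val ≠ 0 := fun h => hne (Fin.ext h)
  omega

/-- The data of a potential function for the Round Robin state. -/
structure DriftData (κ : Fin N → Measure ℝ) (aff : Set (Fin N)) (J I C M : ℝ) (s : Fin N → ℝ)
    (r : Fin N → ℕ) : Prop where
  J_pos : 0 < J
  I_pos : 0 < I
  C_nonneg : 0 ≤ C
  M_nonneg : 0 ≤ M
  r_le : ∀ d, r d ≤ N
  r_succ : ∀ d ∉ aff, r (d + 1) + 1 = r d
  s_pos : ∀ d ∈ aff, 0 < s d
  integrable : ∀ d, Integrable id (κ d)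
  le_integral_min : ∀ d ∈ aff, J ≤ ∫ x, min x C ∂κ d
  integral_max_le : ∀ d ∉ aff, ∫ x, max x (-C) ∂κ d ≤ -I
  integrable_exp : ∀ d ∈ aff, Integrable (fun x => Real.exp (-(s d * x))) (κ d)
  -- When an affected unit is left, up to `N` unaffected ones may follow, each of extra cost C / I,
  -- before a new attempt. The exponential moment below one lets a large `M` pay for this.
  moment_le : ∀ d ∈ aff, (M + N * (C / I)) * ∫ x, Real.exp (-(s d * x)) ∂κ d ≤ M

open scoped Classical in
/-- A potential function for the Round Robin state. -/
noncomputable def driftPotential (aff : Set (Fin N)) (J I C M : ℝ) (s : Fin N → ℝ)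
    (r : Fin N → ℕ) (a : ℝ) (d : Fin N) (y : ℝ) : ℝ :=
  -- Time to climb at rate `J` to the level `a + C`, where `C` allows for the overshoot, plus the
  -- price of a return to zero, which decays exponentially in the height.
  if d ∈ aff then (a + C - max y 0) / J + M * Real.exp (-(s d * max y 0))
  -- Time to fall to zero at rate `I`, one allowance C / I for the undershoot of each unaffected
  -- unit still to come, and the value on entering an affected unit at zero.
  else max y 0 / I + r d * (C / I) + (a + C) / J + M

variable {κ : Fin N → Measure ℝ} [∀ d, IsProbabilityMeasure (κ d)] {aff : Set (Fin N)}
  {J I C M : ℝ} {s : Fin N → ℝ} {r : Fin N → ℕ}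

lemma driftPotential_entry_le (h : DriftData κ aff J I C M s r) {a : ℝ} (d : Fin N) {y : ℝ}
    (hy : y ≤ 0) :
    driftPotential aff J I C M s r a d y ≤ r d * (C / I) + (a + C) / J + M := by
  have hI := h.I_pos
  have hC := h.C_nonneg
  unfold driftPotential
  rw [max_eq_right hy]
  split_ifs with hd
  · simp only [sub_zero, mul_zero, neg_zero, Real.exp_zero, mul_one]
    have : 0 ≤ r d * (C / I) := by positivity
    linarith
  · simp

/-- At an affected unit the linear term loses one in the mean, and the exponential term covers the
rise of the potential when the unit is left. At an unaffected unit max(Y, 0) / I loses one, and the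
drop of `r` by one on leaving covers the undershoot, truncated at `C`. -/
lemma driftPotential_drift (h : DriftData κ aff J I C M s r) {a : ℝ} (ha : 0 < a) (d : Fin N)
    {y : ℝ} (hy : y < a) :
    ∫⁻ x, {z : Fin N × ℝ | z.2 < a}.indicator
      (fun z => ENNReal.ofReal (driftPotential aff J I C M s r a z.1 z.2)) (rrMove (d, y) x) ∂κ d
        + 1 ≤ ENNReal.ofReal (driftPotential aff J I C M s r a d y) := by
  have hI := h.I_pos
  have hJ := h.J_pos
  have hC := h.C_nonneg
  have hM := h.M_nonneg
  set z := max y 0 with hz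
  have hz0 : 0 ≤ z := le_max_right _ _
  have hza : z < a := max_lt hy ha
  have hcI : 0 ≤ C / I := by positivity
  by_cases hd : d ∈ aff
  · set b : ℝ → ℝ := fun x => ((a + C - z) - min x C) / J +
      (M + N * (C / I)) * Real.exp (-(s d * z)) * Real.exp (-(s d * x)) with hb
    have hs := h.s_pos d hd
    have hi1 : Integrable (fun x => min x C) (κ d) := (h.integrable d).inf (integrable_const C)
    have hi2 := (h.integrable_exp d hd).const_mul ((M + N * (C / I)) * Real.exp (-(s d * z)))
    have hi3 : Integrable (fun x => ((a + C - z) - min x C) / J) (κ d) :=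
      ((integrable_const (a + C - z)).sub hi1).div_const J
    have hmin : ∀ x, 0 ≤ (a + C - z) - min x C := fun x => by
      have := min_le_right x C; linarith
    have hb0 : ∀ x, 0 ≤ b x := fun x => by
      have := hmin x
      positivity
    refine lintegral_add_one_le_of_integral (b := b) (hi3.add hi2) hb0 ?_ ?_
    · intro x
      by_cases hxa : z + x < a
      swap
      · rw [Set.indicator_of_notMem]
        · exact zero_le
        · intro hmem
          exact hxa hmem
      have hmem : rrMove (d, y) x ∈ {z : Fin N × ℝ | z.2 < a} := hxa
      rw [Set.indicator_of_mem hmem]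
      refine ENNReal.ofReal_le_ofReal ?_
      have hexp : Real.exp (-(s d * z)) * Real.exp (-(s d * x)) = Real.exp (-(s d * (z + x))) := by
        rw [← Real.exp_add]; ring_nf
      have hbx : b x = ((a + C - z) - min x C) / J +
          (M + N * (C / I)) * Real.exp (-(s d * (z + x))) := by
        rw [hb]; beta_reduce; rw [mul_assoc, hexp]
      rw [hbx]
      have hle : (a + C - (z + x)) / J ≤ ((a + C - z) - min x C) / J := by
        have := min_le_left x C
        exact div_le_div_of_nonneg_right (by linarith) hJ.le
      by_cases hx0 : z + x ≤ 0
      · have : rrMove (d, y) x = (d + 1, z + x) := by simp [rrMove, ← hz, hx0]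
        rw [this]
        refine (driftPotential_entry_le h (d + 1) hx0).trans ?_
        -- On leaving, z + x ≤ 0, so the exponential is at least 1 and its coefficient covers the
        -- entry cost M + r (C / I).
        have h1 : 1 ≤ Real.exp (-(s d * (z + x))) := Real.one_le_exp (by nlinarith)
        have h2 : (r (d + 1) : ℝ) ≤ N := by exact_mod_cast h.r_le (d + 1)
        have h3 : (r (d + 1) : ℝ) * (C / I) ≤ N * (C / I) := by gcongr
        have h4 : (a + C) / J ≤ (a + C - (z + x)) / J := by gcongr; linarith
        have h5 : 0 ≤ M + N * (C / I) := by positivity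
        nlinarith
      · have : rrMove (d, y) x = (d, z + x) := by simp [rrMove, ← hz, hx0]
        rw [this]
        unfold driftPotential
        rw [if_pos hd, max_eq_left (not_le.1 hx0).le]
        have h5 : 0 ≤ N * (C / I) * Real.exp (-(s d * (z + x))) := by positivity
        linarith
    · have hint : ∫ x, b x ∂κ d = ((a + C - z) - ∫ x, min x C ∂κ d) / J +
          (M + N * (C / I)) * Real.exp (-(s d * z)) * ∫ x, Real.exp (-(s d * x)) ∂κ d := by
        rw [hb, integral_add hi3 hi2, integral_div, integral_sub (integrable_const _) hi1,
          integral_const_mul]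
        simp
      rw [hint]
      unfold driftPotential
      rw [if_pos hd, ← hz]
      have h1 : ((a + C - z) - ∫ x, min x C ∂κ d) / J ≤ (a + C - z) / J - 1 := by
        rw [sub_div]
        have := h.le_integral_min d hd
        have := (one_le_div hJ).2 this
        linarith
      have h2 := mul_le_mul_of_nonneg_right (h.moment_le d hd) (Real.exp_pos (-(s d * z))).le
      nlinarith
  · set b : ℝ → ℝ := fun x => (z + max x (-C)) / I + (r d * (C / I) + (a + C) / J + M) with hb
    have hi1 : Integrable (fun x => max x (-C)) (κ d) := (h.integrable d).sup (integrable_const _)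
    have hi2 : Integrable (fun x => (z + max x (-C)) / I) (κ d) :=
      ((integrable_const z).add hi1).div_const I
    have hr : (r (d + 1) : ℝ) + 1 = r d := by exact_mod_cast h.r_succ d hd
    have hb0 : ∀ x, 0 ≤ b x := fun x => by
      have h1 : -C ≤ z + max x (-C) := by linarith [le_max_right x (-C)]
      have h2 : -C / I ≤ (z + max x (-C)) / I := by gcongr
      have h3 : 0 ≤ r (d + 1) * (C / I) + (a + C) / J + M := by positivity
      have h4 : (r d : ℝ) * (C / I) = r (d + 1) * (C / I) + C / I := by rw [← hr]; ring
      simp only [hb, h4]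
      rw [neg_div] at h2
      linarith
    refine lintegral_add_one_le_of_integral (b := b) (hi2.add (integrable_const _)) hb0 ?_ ?_
    · intro x
      by_cases hxa : z + x < a
      swap
      · rw [Set.indicator_of_notMem]
        · exact zero_le
        · intro hmem
          exact hxa hmem
      have hmem : rrMove (d, y) x ∈ {z : Fin N × ℝ | z.2 < a} := hxa
      rw [Set.indicator_of_mem hmem]
      refine ENNReal.ofReal_le_ofReal ?_
      by_cases hx0 : z + x ≤ 0
      · have : rrMove (d, y) x = (d + 1, z + x) := by simp [rrMove, ← hz, hx0]
        rw [this]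
        refine (driftPotential_entry_le h (d + 1) hx0).trans ?_
        have h1 : -C ≤ z + max x (-C) := by linarith [le_max_right x (-C)]
        have h2 : -C / I ≤ (z + max x (-C)) / I := by gcongr
        have h4 : (r d : ℝ) * (C / I) = r (d + 1) * (C / I) + C / I := by rw [← hr]; ring
        simp only [hb, h4]
        rw [neg_div] at h2
        linarith
      · have : rrMove (d, y) x = (d, z + x) := by simp [rrMove, ← hz, hx0]
        rw [this]
        unfold driftPotential
        rw [if_neg hd, max_eq_left (not_le.1 hx0).le]
        have h2 : (z + x) / I ≤ (z + max x (-C)) / I := by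
          gcongr
          exact le_max_left _ _
        simp only [hb]
        linarith
    · have hint : ∫ x, b x ∂κ d = (z + ∫ x, max x (-C) ∂κ d) / I +
          (r d * (C / I) + (a + C) / J + M) := by
        rw [hb, integral_add hi2 (integrable_const _), integral_div,
          integral_add (integrable_const _) hi1]
        simp
      rw [hint]
      unfold driftPotential
      rw [if_neg hd, ← hz]
      have h1 : (z + ∫ x, max x (-C) ∂κ d) / I ≤ z / I - 1 := by
        rw [add_div]
        have h2 := h.integral_max_le d hd
        have : (∫ x, max x (-C) ∂κ d) / I ≤ -1 := by rw [div_le_iff₀ hI]; linarith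
        linarith
      linarith

/-- The constants are chosen in the order `I`, `C`, `s`, `M`. The strict inequalities on the drifts
leave room for the truncation at `C`, and `M` must absorb the cost N (C / I). -/
lemma exists_driftData (haff : aff.Nonempty) (hint : ∀ d, Integrable id (κ d)) (hJ : 0 < J)
    (hpos : ∀ d ∈ aff, J < ∫ x, x ∂κ d)
    (hexp : ∀ d ∈ aff, Integrable (fun x => Real.exp (-x)) (κ d))
    (hneg : ∀ d ∉ aff, ∫ x, x ∂κ d < 0) :
    ∃ (I C M : ℝ) (s : Fin N → ℝ) (r : Fin N → ℕ), DriftData κ aff J I C M s r := by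
  obtain ⟨r, hr⟩ := exists_cyclic_distance haff
  obtain ⟨I, hI0, hI⟩ : ∃ I : ℝ, 0 < I ∧ ∀ d, d ∉ aff → ∫ x, x ∂κ d < -I := by
    have h1 : ∀ d, ∀ᶠ I : ℝ in 𝓝[>] 0, d ∉ aff → ∫ x, x ∂κ d < -I := fun d => by
      by_cases hd : d ∈ aff
      · exact Eventually.of_forall fun _ h => absurd hd h
      · have : ∀ᶠ I : ℝ in 𝓝 0, I < -∫ x, x ∂κ d :=
          eventually_lt_nhds (by linarith [hneg d hd])
        filter_upwards [nhdsWithin_le_nhds this] with I hI _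
        linarith
    obtain ⟨I, h2, h3⟩ := ((eventually_all.2 h1).and self_mem_nhdsWithin).exists
    exact ⟨I, h3, h2⟩
  obtain ⟨C, hC0, hC⟩ : ∃ C : ℝ, 0 ≤ C ∧ ∀ d, (d ∈ aff → J ≤ ∫ x, min x C ∂κ d) ∧
      (d ∉ aff → ∫ x, max x (-C) ∂κ d ≤ -I) := by
    have h1 : ∀ d, ∀ᶠ C : ℝ in atTop, (d ∈ aff → J ≤ ∫ x, min x C ∂κ d) ∧
      (d ∉ aff → ∫ x, max x (-C) ∂κ d ≤ -I) := fun d => by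
      by_cases hd : d ∈ aff
      · filter_upwards [(tendsto_integral_min (hint d)).eventually_const_le (hpos d hd)] with C hC
        exact ⟨fun _ => hC, fun h => absurd hd h⟩
      · filter_upwards [(tendsto_integral_max (hint d)).eventually_le_const (hI d hd)] with C hC
        exact ⟨fun h => absurd h hd, fun _ => hC⟩
    obtain ⟨C, h2, h3⟩ := ((eventually_all.2 h1).and (eventually_ge_atTop 0)).exists
    exact ⟨C, h3, h2⟩
  have hs : ∀ d, ∃ s : ℝ, d ∈ aff → 0 < s ∧ Integrable (fun x => Real.exp (-(s * x))) (κ d) ∧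
      ∫ x, Real.exp (-(s * x)) ∂κ d < 1 := fun d => by
    by_cases hd : d ∈ aff
    · obtain ⟨s, h⟩ := exists_exp_neg_moment_lt_one (hint d) (hJ.trans (hpos d hd)) (hexp d hd)
      exact ⟨s, fun _ => h⟩
    · exact ⟨0, fun h => absurd h hd⟩
  choose s hs using hs
  obtain ⟨M, hM0, hM⟩ : ∃ M : ℝ, 0 ≤ M ∧ ∀ d, d ∈ aff →
      (M + N * (C / I)) * ∫ x, Real.exp (-(s d * x)) ∂κ d ≤ M := by
    have h1 : ∀ d, ∀ᶠ M : ℝ in atTop, d ∈ aff →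
        (M + N * (C / I)) * ∫ x, Real.exp (-(s d * x)) ∂κ d ≤ M := fun d => by
      by_cases hd : d ∈ aff
      · have hlt := (hs d hd).2.2
        set m := ∫ x, Real.exp (-(s d * x)) ∂κ d
        -- The solution of (M + N (C / I)) m = M.
        filter_upwards [eventually_ge_atTop (N * (C / I) * m / (1 - m))] with M hM _
        rw [div_le_iff₀ (by linarith)] at hM
        nlinarith
      · exact Eventually.of_forall fun _ h => absurd h hd
    obtain ⟨M, h2, h3⟩ := ((eventually_all.2 h1).and (eventually_ge_atTop 0)).exists
    exact ⟨M, h3, h2⟩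
  exact ⟨I, C, M, s, r, hJ, hI0, hC0, hM0, fun d => (hr d).1, fun d => (hr d).2,
    fun d hd => (hs d hd).1, hint, fun d => (hC d).1, fun d => (hC d).2,
    fun d hd => (hs d hd).2.1, hM⟩

/-- Existence of a potential function that bounds the expected time until an alarm by
`a / J + O(1)`, up to a multiple of the statistic when an unaffected unit is sampled. -/
theorem exists_potential (haff : aff.Nonempty) (hint : ∀ d, Integrable id (κ d)) (hJ : 0 < J)
    (hpos : ∀ d ∈ aff, J < ∫ x, x ∂κ d)
    (hexp : ∀ d ∈ aff, Integrable (fun x => Real.exp (-x)) (κ d))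
    (hneg : ∀ d ∉ aff, ∫ x, x ∂κ d < 0) :
    ∃ B B' : ℝ, 0 ≤ B ∧ 0 ≤ B' ∧ ∀ a : ℝ, 0 < a → ∃ Φ : Fin N × ℝ → ℝ≥0∞, Measurable Φ ∧
      (∀ z : Fin N × ℝ, z.2 < a → ∫⁻ x, {z : Fin N × ℝ | z.2 < a}.indicator Φ (rrMove z x) ∂κ z.1
        + 1 ≤ Φ z) ∧
      (∀ z : Fin N × ℝ, z.1 ∈ aff → Φ z ≤ ENNReal.ofReal (a / J + B)) ∧
      (∀ z : Fin N × ℝ, z.1 ∉ aff →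
        Φ z ≤ ENNReal.ofReal (a / J + B) + ENNReal.ofReal B' * ENNReal.ofReal z.2) := by
  obtain ⟨I, C, M, s, r, h⟩ := exists_driftData haff hint hJ hpos hexp hneg
  have hI := h.I_pos
  have hC := h.C_nonneg
  have hM := h.M_nonneg
  refine ⟨C / J + N * (C / I) + M, 1 / I, by positivity, by positivity, fun a ha =>
    ⟨fun z => ENNReal.ofReal (driftPotential aff J I C M s r a z.1 z.2), ?_, ?_, ?_, ?_⟩⟩
  · refine ENNReal.measurable_ofReal.comp (measurable_from_prod_countable_right fun d => ?_)
    simp only [driftPotential]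
    split_ifs <;> fun_prop
  · rintro ⟨d, y⟩ hy
    exact driftPotential_drift h ha d hy
  · rintro ⟨d, y⟩ hd
    refine ENNReal.ofReal_le_ofReal ?_
    simp only [driftPotential]
    rw [if_pos hd]
    have hz : 0 ≤ max y 0 := le_max_right _ _
    have h1 : Real.exp (-(s d * max y 0)) ≤ 1 := by
      rw [Real.exp_le_one_iff]
      have := mul_nonneg (h.s_pos d hd).le hz
      linarith
    have h2 : (a + C - max y 0) / J ≤ a / J + C / J := by
      rw [← add_div]; gcongr; linarith
    have h3 : 0 ≤ N * (C / I) := by positivity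
    nlinarith
  · rintro ⟨d, y⟩ hd
    have hofReal : ENNReal.ofReal y = ENNReal.ofReal (max y 0) := by
      simp
    rw [hofReal, ← ENNReal.ofReal_mul (by positivity),
      ← ENNReal.ofReal_add (by positivity) (by positivity)]
    refine ENNReal.ofReal_le_ofReal ?_
    simp only [driftPotential]
    rw [if_neg hd]
    have h2 : (r d : ℝ) ≤ N := by exact_mod_cast h.r_le d
    have h3 : (r d : ℝ) * (C / I) ≤ N * (C / I) := by gcongr
    rw [add_div, one_div_mul_eq_div]
    linarith

end Potential

/-- Turns a bound on the essential supremum of a conditional expectation into inequalities on the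
events of the history. -/
lemma condLExp_ae_le_const {Ω : Type*} {m m₀ : MeasurableSpace Ω} (hm : m ≤ m₀)
    (P : Measure[m₀] Ω) [IsFiniteMeasure P] {f : Ω → ℝ≥0∞} {c : ℝ≥0∞}
    (h : ∀ A, MeasurableSet[m] A → ∫⁻ ω in A, f ω ∂P ≤ c * P A) :
    condLExp m P f ≤ᵐ[P] fun _ => c := by
  refine ae_le_of_ae_le_trim (hm := hm) ?_
  refine ae_le_of_forall_setLIntegral_le_of_sigmaFinite (measurable_condLExp _ _ _)
    fun A hA _ => ?_
  rw [setLIntegral_condLExp_trim hm _ _ hA, setLIntegral_const, trim_measurableSet_eq hm hA]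
  exact h A hA

/-! ### The worst-case delay, bounded through events of the history. -/

section Delay

variable {R : Type*} [MeasurableSpace R] {K : ℕ} {X : Fin K → Type*} [∀ k, MeasurableSpace (X k)]

/-- The distributions of the vectors when the change happens at time `ν`. -/
noncomputable def changeSeq (F G : Measure (∀ k, X k)) (ν n : ℕ) : Measure (∀ k, X k) :=
  if n < ν then F else G

instance (F G : Measure (∀ k, X k)) [IsProbabilityMeasure F] [IsProbabilityMeasure G] (ν n : ℕ) :
    IsProbabilityMeasure (changeSeq F G ν n) := by
  unfold changeSeq; split_ifs <;> infer_instance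

lemma changeLaw_eq (ρ : Measure R) (F G : Measure (∀ k, X k)) (ν : ℕ) :
    changeLaw ρ F G ν = seqLaw ρ (changeSeq F G ν) := rfl

variable (ρ : Measure R) [IsProbabilityMeasure ρ] {F G : Measure (∀ k, X k)}
  [IsProbabilityMeasure F] [IsProbabilityMeasure G]

lemma delay_le {m : ℕ} {S : ℕ → Sample R X → Finset (Fin K)} {T : Sample R X → ℕ∞}
    (hS : ∀ n E, MeasurableSet[past n] {ω | S n ω = E})
    {c : ℝ≥0∞}
    (h : ∀ ν A, MeasurableSet[affectedHistory F G m S ν] A →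
      ∫⁻ ω in A ∩ {ω | (ν : ℕ∞) < T ω}, ((T ω : ℝ≥0∞) - (ν : ℝ≥0∞)) ∂seqLaw ρ (changeSeq F G ν) ≤
        c * seqLaw ρ (changeSeq F G ν) (A ∩ {ω | (ν : ℕ∞) < T ω})) :
    delay ρ F G m S T ≤ c := by
  refine iSup_le fun ν => essSup_le_of_ae_le _ ?_
  rw [changeLaw_eq]
  refine condLExp_ae_le_const (affectedHistory_le hS ν) _ fun A hA => ?_
  have hA' := affectedHistory_le hS ν _ hA
  rw [ProbabilityTheory.cond, Measure.restrict_smul, Measure.restrict_restrict hA',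
    lintegral_smul_measure, Measure.smul_apply, Measure.restrict_apply hA', smul_eq_mul, smul_eq_mul,
    mul_left_comm]
  gcongr
  exact h ν A hA

end Delay

/-! ### Excursions of the statistic above zero. -/

section RoundRobin

variable {R : Type*} [MeasurableSpace R] {K : ℕ} {X : Fin K → Type*} [∀ k, MeasurableSpace (X k)]
  {U : Finset (Finset (Fin K))} {N : ℕ} [NeZero N]
  {F : Measure (∀ k, X k)} {𝒢 : Set (Measure (∀ k, X k))} {e : Fin N ≃ U}

/-- No alarm up to time `n`, at which the unit `d` is sampled since time `s`. -/
def excursion (F : Measure (∀ k, X k)) (𝒢 : Set (Measure (∀ k, X k))) (e : Fin N ≃ U) (a : ℝ)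
    (d : Fin N) (s n : ℕ) : Set (Sample R X) :=
  alive F 𝒢 e a n ∩ {ω | (rrState F 𝒢 e s ω).1 = d ∧ (rrState F 𝒢 e s ω).2 ≤ 0 ∧
    ∀ k, s < k → k ≤ n → 0 < (rrState F 𝒢 e k ω).2}

lemma measurableSet_past_excursion (a : ℝ) (d : Fin N) {s n : ℕ} (h : s ≤ n) :
    MeasurableSet[past n] (excursion F 𝒢 e a d s n : Set (Sample R X)) := by
  have : (excursion F 𝒢 e a d s n : Set (Sample R X)) = alive F 𝒢 e a n ∩
      (rrState F 𝒢 e s ⁻¹' (Prod.fst ⁻¹' {d}) ∩ ({ω | (rrState F 𝒢 e s ω).2 ∈ Set.Iic 0} ∩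
        ⋂ k, ⋂ (_ : s < k), ⋂ (_ : k ≤ n), {ω | (rrState F 𝒢 e k ω).2 ∈ Set.Ioi 0})) := by
    ext ω
    simp [excursion]
  rw [this]
  refine @MeasurableSet.inter _ (past n) _ _ (measurableSet_past_alive a n) ?_
  refine @MeasurableSet.inter _ (past n) _ _ (measurable_past_rrState h
    (measurable_fst (measurableSet_singleton d))) ?_
  refine @MeasurableSet.inter _ (past n) _ _ (measurableSet_past_rrState_snd h measurableSet_Iic) ?_
  exact MeasurableSet.iInter fun k => MeasurableSet.iInter fun _ => MeasurableSet.iInter fun hk =>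
    measurableSet_past_rrState_snd hk measurableSet_Ioi

lemma excursion_succ (a : ℝ) (d : Fin N) {s n : ℕ} (h : s ≤ n) :
    (excursion F 𝒢 e a d s (n + 1) : Set (Sample R X)) =
      {ω | (rrState F 𝒢 e (n + 1) ω).2 ∈ Set.Ioo 0 a} ∩ excursion F 𝒢 e a d s n := by
  ext ω
  simp only [excursion, alive_succ, Set.mem_inter_iff, Set.mem_ofPred_eq, Set.mem_Ioo]
  constructor
  · rintro ⟨⟨h1, h2⟩, h3, h4, h5⟩
    exact ⟨⟨h5 _ (by omega) le_rfl, h2⟩, h1, h3, h4, fun k hk hkn => h5 k hk (by omega)⟩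
  · rintro ⟨⟨h0, h2⟩, h1, h3, h4, h5⟩
    refine ⟨⟨h1, h2⟩, h3, h4, fun k hk hkn => ?_⟩
    rcases Nat.le_succ_iff.1 hkn with hkn | rfl
    exacts [h5 k hk hkn, h0]

lemma rrState_fst_of_mem_excursion {a : ℝ} {d : Fin N} {s n : ℕ} {ω : Sample R X}
    (hω : ω ∈ excursion F 𝒢 e a d s n) {k : ℕ} (hsk : s ≤ k) (hkn : k ≤ n) :
    (rrState F 𝒢 e k ω).1 = d := by
  induction k, hsk using Nat.le_induction with
  | base => exact hω.2.1
  | succ k hk ih =>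
    have h1 := hω.2.2.2 (k + 1) (by omega) hkn
    rw [rrState_succ] at h1 ⊢
    simp only [rrMove] at h1 ⊢
    rw [if_neg (not_le.2 h1)]
    exact ih (by omega)

/-- The excursion starts at the last time at which the statistic is nonpositive; time 0 is one, as
Y_0 = 0. -/
lemma iUnion_excursion (a : ℝ) (n : ℕ) : (alive F 𝒢 e a n : Set (Sample R X)) =
    ⋃ p : Fin N × Fin (n + 1), excursion F 𝒢 e a p.1 p.2 n := by
  ext ω
  simp only [Set.mem_iUnion]
  constructor
  · intro hω
    classical
    let Z := (Finset.range (n + 1)).filter fun k => (rrState F 𝒢 e k ω).2 ≤ 0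
    have h0 : (0 : ℕ) ∈ Z := by simp [Z, rrState]
    have hZ := Finset.max'_mem Z ⟨0, h0⟩
    set s := Z.max' ⟨0, h0⟩ with hs
    obtain ⟨h1, h2⟩ := Finset.mem_filter.1 hZ
    refine ⟨((rrState F 𝒢 e s ω).1, ⟨s, Finset.mem_range.1 h1⟩), hω, rfl, h2, fun k hk hkn => ?_⟩
    by_contra! hle
    have := Finset.le_max' Z k (Finset.mem_filter.2 ⟨Finset.mem_range.2 (by omega), hle⟩)
    exact absurd hk (not_lt.2 this)
  · rintro ⟨p, h⟩
    exact h.1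

lemma pairwise_disjoint_excursion (a : ℝ) (n : ℕ) :
    Pairwise (Function.onFun Disjoint fun p : Fin N × Fin (n + 1) =>
      (excursion F 𝒢 e a p.1 p.2 n : Set (Sample R X))) := by
  rintro ⟨d, s⟩ ⟨d', s'⟩ hne
  refine Set.disjoint_left.2 fun ω h h' => hne ?_
  have hs : s = s' := by
    rcases lt_trichotomy s s' with hlt | heq | hlt
    · exact absurd h'.2.2.1 (not_le.2 (h.2.2.2 s' hlt (Nat.lt_succ_iff.1 s'.2)))
    · exact heq
    · exact absurd h.2.2.1 (not_le.2 (h'.2.2.2 s hlt (Nat.lt_succ_iff.1 s.2)))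
  subst hs
  exact Prod.ext (h.2.1.symm.trans h'.2.1) rfl

variable (ρ : Measure R) [IsProbabilityMeasure ρ] (μ : ℕ → Measure (∀ k, X k))
  [∀ n, IsProbabilityMeasure (μ n)]

/-- During an excursion the unit does not change and no reset occurs, so the statistic is the killed
walk started at 0. What happened before `s` enters only through the probability of the start. -/
lemma setLIntegral_excursion [IsProbabilityMeasure F] {a : ℝ} (d : Fin N) (s j : ℕ)
    (hμ : ∀ n, s ≤ n → n < s + j → μ n = F) {A : Set (Sample R X)} (hA : MeasurableSet[past s] A)
    {f : ℝ → ℝ≥0∞} (hf : Measurable f) :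
    ∫⁻ ω in A ∩ excursion F 𝒢 e a d s (s + j), f (max (rrState F 𝒢 e (s + j) ω).2 0) ∂seqLaw ρ μ =
      (killed (stepLaw F 𝒢 F (e d)) a)^[j] f 0 *
        seqLaw ρ μ (A ∩ excursion F 𝒢 e a d s s) := by
  induction j generalizing f with
  | zero =>
    have hm : MeasurableSet (A ∩ excursion F 𝒢 e a d s s) :=
      (past_le _ _ hA).inter (past_le _ _ (measurableSet_past_excursion a d le_rfl))
    rw [Function.iterate_zero_apply, ← setLIntegral_const]
    refine setLIntegral_congr_fun hm fun ω hω => ?_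
    have : (rrState F 𝒢 e s ω).2 ≤ 0 := hω.2.2.2.1
    simp [max_eq_right this]
  | succ j ih =>
    have hle : s ≤ s + j := Nat.le_add_right _ _
    have hmn : MeasurableSet[past (s + j)] (A ∩ excursion F 𝒢 e a d s (s + j)) :=
      @MeasurableSet.inter _ (past (s + j)) _ _ (past_mono hle _ hA)
        (measurableSet_past_excursion a d hle)
    have hI : MeasurableSet {ω : Sample R X | (rrState F 𝒢 e (s + j + 1) ω).2 ∈ Set.Ioo 0 a} :=
      (measurable_snd.comp (measurable_rrState (s + j + 1))) measurableSet_Ioo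
    let g : Fin N × ℝ → ℝ≥0∞ := fun z => (Set.Ioo 0 a).indicator f z.2
    have hg : Measurable g := (hf.indicator measurableSet_Ioo).comp measurable_snd
    have h1 : ∫⁻ ω in A ∩ excursion F 𝒢 e a d s (s + (j + 1)),
        f (max (rrState F 𝒢 e (s + (j + 1)) ω).2 0) ∂seqLaw ρ μ =
        ∫⁻ ω in A ∩ excursion F 𝒢 e a d s (s + j), g (rrState F 𝒢 e (s + j + 1) ω) ∂seqLaw ρ μ := by
      rw [← add_assoc, excursion_succ a d hle, Set.inter_left_comm, ← Measure.restrict_restrict hI,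
        ← lintegral_indicator hI]
      refine lintegral_congr fun ω => ?_
      by_cases hω : (rrState F 𝒢 e (s + j + 1) ω).2 ∈ Set.Ioo 0 a
      · have hmem : ω ∈ {ω : Sample R X | (rrState F 𝒢 e (s + j + 1) ω).2 ∈ Set.Ioo 0 a} := hω
        rw [Set.indicator_of_mem hmem]
        simp only [g]
        rw [Set.indicator_of_mem hω, max_eq_left hω.1.le]
      · have hmem : ω ∉ {ω : Sample R X | (rrState F 𝒢 e (s + j + 1) ω).2 ∈ Set.Ioo 0 a} := hω
        rw [Set.indicator_of_notMem hmem]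
        simp only [g]
        rw [Set.indicator_of_notMem hω]
    rw [h1, setLIntegral_rrState_succ ρ μ (s + j) hmn hg, hμ (s + j) hle (by omega),
      Function.iterate_succ_apply, ← ih (fun n h2 h3 => hμ n h2 (by omega)) (measurable_killed hf)]
    refine setLIntegral_congr_fun (past_le _ _ hmn) fun ω hω => ?_
    have hd := rrState_fst_of_mem_excursion hω.2 hle le_rfl
    simp only [hd]
    rfl

/-- On the excursions of an unaffected unit, the statistic is small in the mean. -/
lemma setLIntegral_excursion_le [IsProbabilityMeasure F] {a c : ℝ} {d : Fin N} {s ν : ℕ} (hs : s ≤ ν)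
    (hμ : ∀ n < ν, μ n = F) {A : Set (Sample R X)} (hA : MeasurableSet[past s] A)
    (hk : ∀ j, (killed (stepLaw F 𝒢 F (e d)) a)^[j] ENNReal.ofReal 0 ≤
      ENNReal.ofReal c * (killed (stepLaw F 𝒢 F (e d)) a)^[j] 1 0) :
    ∫⁻ ω in A ∩ excursion F 𝒢 e a d s ν, ENNReal.ofReal (rrState F 𝒢 e ν ω).2 ∂seqLaw ρ μ ≤
      ENNReal.ofReal c * seqLaw ρ μ (A ∩ excursion F 𝒢 e a d s ν) := by
  obtain ⟨j, rfl⟩ := Nat.exists_eq_add_of_le hs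
  have h1 := setLIntegral_excursion (a := a) (𝒢 := 𝒢) (e := e) ρ μ d s j (fun n _ h => hμ n h) hA
    ENNReal.measurable_ofReal
  have h2 := setLIntegral_excursion (a := a) (𝒢 := 𝒢) (e := e) ρ μ d s j (fun n _ h => hμ n h) hA
    (f := 1) measurable_one
  have h3 : ∀ y : ℝ, ENNReal.ofReal (max y 0) = ENNReal.ofReal y := fun y => by simp
  simp only [h3] at h1
  simp only [Pi.one_apply, lintegral_one, Measure.restrict_apply_univ] at h2
  rw [h1, h2, ← mul_assoc]
  gcongr
  exact hk j

end RoundRobin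

/-! ### Affected and unaffected sets. -/

section Affected

variable {K : ℕ} {X : Fin K → Type*} [∀ k, MeasurableSpace (X k)] {F G : Measure (∀ k, X k)}
  {𝒢 : Set (Measure (∀ k, X k))} {m : ℕ} {E : Finset (Fin K)}

lemma mem_affected : E ∈ affected F G m ↔ E.card = m ∧ localLaw G E ≠ localLaw F E := by
  simp [affected, Finset.mem_powersetCard]

lemma localLaw_eq_of_notMem_affected (hE : E.card = m) (h : E ∉ affected F G m) :
    localLaw G E = localLaw F E := by
  by_contra hne
  exact h (mem_affected.2 ⟨hE, hne⟩)

lemma integrable_id_stepLaw (h : Integrable (mixLLR F 𝒢 E) (localLaw G E)) :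
    Integrable id (stepLaw F 𝒢 G E) :=
  (integrable_map_measure (by fun_prop) measurable_mixLLR.aemeasurable).2 h

lemma integral_stepLaw_eq_postDrift : ∫ x, x ∂stepLaw F 𝒢 G E = postDrift F 𝒢 G E := by
  rw [stepLaw, integral_map measurable_mixLLR.aemeasurable (by fun_prop), postDrift]

end Affected

/-! ### Upper bound on the delay of Round Robin. -/

section RoundRobin

variable {R : Type*} [MeasurableSpace R] {K : ℕ} {X : Fin K → Type*} [∀ k, MeasurableSpace (X k)]
  {U : Finset (Finset (Fin K))} {N : ℕ} [NeZero N]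
  {F : Measure (∀ k, X k)} {𝒢 : Set (Measure (∀ k, X k))} {e : Fin N ≃ U}

/-- The conditional expected delay of Round Robin is at most the value of a potential function, in
the mean over the excursions at the change-point. -/
lemma setLIntegral_delay_rr_le (ρ : Measure R) [IsProbabilityMeasure ρ] [IsProbabilityMeasure F]
    {G : Measure (∀ k, X k)} [IsProbabilityMeasure G] {m : ℕ}
    {a b b' c : ℝ} (ha : 0 < a) (hb : 0 ≤ b) (hb' : 0 ≤ b') (hc : 0 ≤ c)
    {Φ : Fin N × ℝ → ℝ≥0∞} (hΦ : Measurable Φ)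
    (hdrift : ∀ z : Fin N × ℝ, z.2 < a →
      ∫⁻ x, {z : Fin N × ℝ | z.2 < a}.indicator Φ (rrMove z x) ∂stepLaw F 𝒢 G (e z.1) + 1 ≤ Φ z)
    (haff : ∀ z : Fin N × ℝ, (e z.1 : Finset (Fin K)) ∈ affected F G m → Φ z ≤ ENNReal.ofReal b)
    (hunaff : ∀ z : Fin N × ℝ, (e z.1 : Finset (Fin K)) ∉ affected F G m →
      Φ z ≤ ENNReal.ofReal b + ENNReal.ofReal b' * ENNReal.ofReal z.2)
    (hk : ∀ d : Fin N, (e d : Finset (Fin K)) ∉ affected F G m →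
      ∀ j, (killed (stepLaw F 𝒢 F (e d)) a)^[j] ENNReal.ofReal 0 ≤
        ENNReal.ofReal c * (killed (stepLaw F 𝒢 F (e d)) a)^[j] 1 0)
    (ν : ℕ) {A : Set (Sample R X)} (hA : MeasurableSet[affectedHistory F G m (rrS F 𝒢 e) ν] A) :
    ∫⁻ ω in A ∩ {ω | (ν : ℕ∞) < rrT F 𝒢 e a ω},
      ((rrT F 𝒢 e a ω : ℝ≥0∞) - (ν : ℝ≥0∞)) ∂seqLaw ρ (changeSeq F G ν) ≤
        ENNReal.ofReal (b + b' * c) *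
          seqLaw ρ (changeSeq F G ν) (A ∩ {ω | (ν : ℕ∞) < rrT F 𝒢 e a ω}) := by
  set P := seqLaw ρ (changeSeq F G ν) with hP
  have hS : ∀ n E, MeasurableSet[past n] {ω : Sample R X | rrS F 𝒢 e n ω = E} :=
    measurableSet_past_rrS
  have hAm := affectedHistory_le hS ν _ hA
  have hexc : ∀ (p : Fin N × Fin (ν + 1)),
      MeasurableSet (excursion F 𝒢 e a p.1 p.2 ν : Set (Sample R X)) := fun p =>
    past_le _ _ (measurableSet_past_excursion a p.1 (Nat.lt_succ_iff.1 p.2.2))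
  have hAe : ∀ (p : Fin N × Fin (ν + 1)), MeasurableSet (A ∩ excursion F 𝒢 e a p.1 p.2 ν) :=
    fun p => hAm.inter (hexc p)
  have hdisj : Pairwise (Function.onFun Disjoint fun p : Fin N × Fin (ν + 1) =>
      A ∩ (excursion F 𝒢 e a p.1 p.2 ν : Set (Sample R X))) := fun p q hpq =>
    (pairwise_disjoint_excursion (F := F) (𝒢 := 𝒢) (e := e) a ν hpq).mono Set.inter_subset_right
      Set.inter_subset_right
  have hset : A ∩ {ω | (ν : ℕ∞) < rrT F 𝒢 e a ω} = A ∩ alive F 𝒢 e a ν := by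
    congr 1
    ext ω
    exact lt_rrT_iff ha ν ω
  have hsplit : A ∩ (alive F 𝒢 e a ν : Set (Sample R X)) =
      ⋃ p : Fin N × Fin (ν + 1), A ∩ excursion F 𝒢 e a p.1 p.2 ν := by
    rw [iUnion_excursion, Set.inter_iUnion]
  have hFν : ∀ n < ν, changeSeq F G ν n = F := fun n hn => if_pos hn
  have hGν : ∀ n ≥ ν, changeSeq F G ν n = G := fun n hn => if_neg (not_lt.2 hn)
  have hApast : MeasurableSet[past ν] A := by
    obtain ⟨A', h1, h2⟩ := exists_past_inter_eq hS (s := ν) (D := Set.univ)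
      (fun _ _ t h1 h2 => absurd h1 (not_le.2 h2)) hA
    rw [Set.inter_univ, Set.inter_univ] at h2
    rwa [h2]
  rw [hset, setLIntegral_rrT_sub ρ _ ha]
  have hpot := tsum_alive_le_potential ρ (changeSeq F G ν) (L := G) hGν a hΦ hdrift hApast
  refine (ENNReal.tsum_le_tsum fun i => measure_mono ?_).trans (hpot.trans ?_)
  · exact Set.inter_subset_inter_left _ Set.inter_subset_left
  rw [hsplit, lintegral_iUnion hAe hdisj, measure_iUnion hdisj hAe, ← ENNReal.tsum_mul_left]
  refine ENNReal.tsum_le_tsum fun p => ?_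
  obtain ⟨d, s⟩ := p
  have hfst : ∀ ω ∈ A ∩ excursion F 𝒢 e a d s ν, (rrState F 𝒢 e ν ω).1 = d := fun ω hω =>
    rrState_fst_of_mem_excursion hω.2 (Nat.lt_succ_iff.1 s.2) le_rfl
  have hb'c : 0 ≤ b' * c := by positivity
  rw [ENNReal.ofReal_add hb hb'c, add_mul, ENNReal.ofReal_mul hb', mul_assoc]
  by_cases hd : (e d : Finset (Fin K)) ∈ affected F G m
  · refine le_trans ?_ le_self_add
    rw [← setLIntegral_const]
    refine setLIntegral_mono' (hAe (d, s)) fun ω hω => haff _ ?_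
    rw [hfst ω hω]
    exact hd
  -- While an unaffected unit is sampled, the history records nothing. On this excursion `A` is
  -- therefore an event of the past at time `s`, and the estimate for the conditioned walk applies.
  · obtain ⟨A', hA', hAA'⟩ := exists_past_inter_eq hS (s := s)
      (D := excursion F 𝒢 e a d s ν) (fun ω hω t h1 h2 => by
        have := rrState_fst_of_mem_excursion hω h1 h2.le
        simp only [rrS, this]
        exact hd) hA
    have hexc_le := setLIntegral_excursion_le ρ (changeSeq F G ν) (Nat.lt_succ_iff.1 s.2) hFν hA'
      (hk d hd)
    have hmono : ∫⁻ ω in A ∩ excursion F 𝒢 e a d s ν, Φ (rrState F 𝒢 e ν ω) ∂P ≤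
        ∫⁻ ω in A ∩ excursion F 𝒢 e a d s ν, (ENNReal.ofReal b + ENNReal.ofReal b' *
          ENNReal.ofReal (rrState F 𝒢 e ν ω).2) ∂P :=
      setLIntegral_mono' (hAe (d, s)) fun ω hω => hunaff _ (by rw [hfst ω hω]; exact hd)
    refine hmono.trans ?_
    have hYm : Measurable fun ω : Sample R X => ENNReal.ofReal (rrState F 𝒢 e ν ω).2 :=
      ENNReal.measurable_ofReal.comp (measurable_snd.comp (measurable_rrState ν))
    rw [lintegral_add_left measurable_const, setLIntegral_const, lintegral_const_mul _ hYm]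
    gcongr
    rw [hAA']
    exact hexc_le

/-- The delay of Round Robin is asymptotically at most the threshold divided by the smallest
post-change drift. -/
theorem eventually_delay_rr_le (ρ : Measure R) [IsProbabilityMeasure ρ] [IsProbabilityMeasure F]
    {G : Measure (∀ k, X k)} [IsProbabilityMeasure G] (hG : G ∈ 𝒢) {m : ℕ}
    (hU : ∀ E ∈ U, E.card = m) (h : ∀ d : Fin N, RegularUnit F 𝒢 (e d))
    (hne : (affected F G m ∩ U).Nonempty)
    (hpost : ∀ E ∈ affected F G m ∩ U, Integrable (mixLLR F 𝒢 E) (localLaw G E))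
    {J c : ℝ} (hJ : 0 < J) (hJpost : ∀ E ∈ affected F G m ∩ U, J < postDrift F 𝒢 G E)
    (hc : 1 / J < c) :
    ∀ᶠ a : ℝ in atTop, delay ρ F G m (rrS F 𝒢 e) (rrT F 𝒢 e a : Sample R X → ℕ∞) ≤
      ENNReal.ofReal (c * a) := by
  set aff : Set (Fin N) := {d | (e d : Finset (Fin K)) ∈ affected F G m} with haff
  have hmem : ∀ d ∈ aff, (e d : Finset (Fin K)) ∈ affected F G m ∩ U := fun d hd =>
    Finset.mem_inter.2 ⟨hd, (e d).2⟩
  have hloc : ∀ d ∉ aff, localLaw G (e d) = localLaw F (e d) := fun d hd =>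
    localLaw_eq_of_notMem_affected (hU _ (e d).2) hd
  have hne' : aff.Nonempty := by
    obtain ⟨E, hE⟩ := hne
    obtain ⟨h1, h2⟩ := Finset.mem_inter.1 hE
    refine ⟨e.symm ⟨E, h2⟩, ?_⟩
    show ((e (e.symm ⟨E, h2⟩) : U) : Finset (Fin K)) ∈ affected F G m
    rwa [Equiv.apply_symm_apply]
  obtain ⟨B, B', hB, hB', hpot⟩ := exists_potential (κ := fun d => stepLaw F 𝒢 G (e d)) hne'
    (fun d => by
      by_cases hd : d ∈ aff
      · exact integrable_id_stepLaw (hpost _ (hmem d hd))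
      · rw [stepLaw_congr (hloc d hd)]
        exact (h d).integrable_stepLaw) hJ
    (fun d hd => by
      rw [integral_stepLaw_eq_postDrift]
      exact hJpost _ (hmem d hd))
    (fun d hd => (h d).integrable_exp_neg_stepLaw
      ⟨G, hG, rfl, (mem_affected.1 (Finset.mem_inter.1 (hmem d hd)).1).2⟩)
    (fun d hd => by
      rw [stepLaw_congr (hloc d hd)]
      exact (h d).integral_stepLaw_neg)
  -- Half of the slack in the rate absorbs the constant `B`, the other half the mean of the
  -- statistic of an unaffected unit.
  set η := (c - 1 / J) / 2 with hη
  have hη0 : 0 < η := by rw [hη]; linarith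
  obtain ⟨ε, hε, hεB⟩ : ∃ ε : ℝ, 0 < ε ∧ B' * ε ≤ η := by
    refine ⟨η / (B' + 1), by positivity, ?_⟩
    rw [mul_div_assoc', div_le_iff₀ (by positivity)]
    nlinarith
  have hcond : ∀ᶠ a : ℝ in atTop, ∀ d : Fin N, ∀ j : ℕ,
      (killed (stepLaw F 𝒢 F (e d)) a)^[j] ENNReal.ofReal 0 ≤
        ENNReal.ofReal (ε * a) * (killed (stepLaw F 𝒢 F (e d)) a)^[j] 1 0 :=
    eventually_all.2 fun d => conditioned_mean_le (h d).integral_stepLaw_neg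
      (h d).integrable_exp_stepLaw (h d).integral_exp_stepLaw hε
  filter_upwards [hcond, eventually_gt_atTop 0, eventually_ge_atTop (B / η)] with a hk ha haB
  obtain ⟨Φ, hΦ, hdrift, h1, h2⟩ := hpot a ha
  have hba : 0 ≤ a / J + B := by positivity
  have hca : 0 ≤ ε * a := by positivity
  refine (delay_le ρ (c := ENNReal.ofReal (a / J + B + B' * (ε * a))) measurableSet_past_rrS
    fun ν A hA => ?_).trans (ENNReal.ofReal_le_ofReal ?_)
  · exact setLIntegral_delay_rr_le (m := m) ρ ha hba hB' hca hΦ hdrift h1 h2 (fun d _ => hk d) ν hA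
  · rw [div_le_iff₀ hη0] at haB
    have h3 : B' * (ε * a) ≤ η * a := by
      rw [← mul_assoc]
      exact mul_le_mul_of_nonneg_right hεB ha.le
    have h4 : c * a = a / J + η * a + η * a := by rw [hη]; ring
    rw [h4]
    nlinarith

end RoundRobin

/-! ### General policies: integrating out one observation. -/

section Policies

variable {R : Type*} [MeasurableSpace R] {K : ℕ} {X : Fin K → Type*} [∀ k, MeasurableSpace (X k)]
  {S : ℕ → Sample R X → Finset (Fin K)}

lemma obsFiltration_le_past (hS : ∀ n E, MeasurableSet[obsFiltration S n] {ω | S n ω = E}) (n : ℕ) :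
    obsFiltration S n ≤ past n := by
  induction n with
  | zero =>
    rintro A ⟨B, hB, rfl⟩
    exact ⟨measurable_fst hB, fun ω ω' h hω => by
      simp only [Set.mem_preimage] at hω ⊢
      rwa [← h.1]⟩
  | succ n ih =>
    refine sup_le (ih.trans (past_mono n.le_succ)) ?_
    rintro A ⟨B, hB, rfl⟩
    exact measurableSet_observed (fun E => ih _ (hS n E)) hB

lemma measurableSet_lt_of_stopping {T : Sample R X → ℕ∞}
    (hT : ∀ n : ℕ, MeasurableSet[obsFiltration S n] {ω | T ω = n}) (n : ℕ) :
    MeasurableSet[obsFiltration S n] {ω | (n : ℕ∞) < T ω} := by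
  have : {ω | (n : ℕ∞) < T ω} = (⋃ k, ⋃ (_ : k ≤ n), {ω | T ω = (k : ℕ∞)})ᶜ := by
    ext ω
    simp only [Set.mem_ofPred_eq, Set.mem_compl_iff, Set.mem_iUnion, not_exists]
    constructor
    · intro h k hk hT
      rw [hT, Nat.cast_lt] at h
      omega
    · intro h
      by_contra! hle
      lift T ω to ℕ using (hle.trans_lt (ENat.natCast_lt_top n)).ne with t ht
      exact h t (by exact_mod_cast hle) rfl
  rw [this]
  exact MeasurableSet.compl (MeasurableSet.iUnion fun k => MeasurableSet.iUnion fun hk =>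
    obsFiltration_mono S hk _ (hT k))

lemma measurable_comp_of_measurableSet_eq {Ω β : Type*} {m : MeasurableSpace Ω} [MeasurableSpace β]
    {D : Type*} [Countable D] {S : Ω → D} (hS : ∀ E, MeasurableSet {ω | S ω = E}) (q : D → β) :
    Measurable fun ω => q (S ω) := by
  intro B _
  have : (fun ω => q (S ω)) ⁻¹' B = ⋃ E, ⋃ (_ : q E ∈ B), {ω | S ω = E} := by
    ext ω; simp
  rw [this]
  exact MeasurableSet.iUnion fun E => MeasurableSet.iUnion fun _ => hS E

lemma measurable_sigma_mk {ι : Type*} {V : ι → Type*} [∀ i, MeasurableSpace (V i)] (i : ι) :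
    Measurable (Sigma.mk (β := V) i) := fun _ hs => measurableSet_sigma_mk_preimage hs i

lemma measurable_observed_of {S : Sample R X → Finset (Fin K)} (hS : ∀ E, MeasurableSet {ω | S ω = E}) :
    Measurable fun p : Sample R X × (∀ k, X k) =>
      (⟨S p.1, (S p.1).restrict p.2⟩ : Σ E : Finset (Fin K), ∀ k : E, X k) := by
  intro B hB
  have : (fun p : Sample R X × (∀ k, X k) =>
      (⟨S p.1, (S p.1).restrict p.2⟩ : Σ E : Finset (Fin K), ∀ k : E, X k)) ⁻¹' B =
      ⋃ E : Finset (Fin K), {ω | S ω = E} ×ˢ (E.restrict ⁻¹' (Sigma.mk (β := fun E : Finset (Fin K) => ∀ k : E, X k) E ⁻¹' B)) := by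
    ext ⟨ω, x⟩
    simp only [Set.mem_preimage, Set.mem_iUnion, Set.mem_prod, Set.mem_ofPred_eq]
    constructor
    · intro h; exact ⟨S ω, rfl, h⟩
    · rintro ⟨E, rfl, h⟩; exact h
  rw [this]
  exact MeasurableSet.iUnion fun E => (hS E).prod
    (Finset.measurable_restrict E (measurableSet_sigma_mk_preimage hB E))

variable (ρ : Measure R) [IsProbabilityMeasure ρ] (μ : ℕ → Measure (∀ k, X k))
  [∀ n, IsProbabilityMeasure (μ n)]

/-- Integrating out the observation at time `n + 1`. -/
lemma lintegral_observed {n : ℕ} (hS : ∀ E, MeasurableSet[past n] {ω | S n ω = E})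
    {f : Sample R X → (Σ E : Finset (Fin K), ∀ k : E, X k) → ℝ≥0∞}
    (hf : Measurable (Function.uncurry f)) (hpast : ∀ z, Measurable[past n] fun ω => f ω z) :
    ∫⁻ ω, f ω (observed S n ω) ∂seqLaw ρ μ =
      ∫⁻ ω, ∫⁻ v, f ω ⟨S n ω, v⟩ ∂localLaw (μ n) (S n ω) ∂seqLaw ρ μ := by
  let g : Sample R X → (∀ k, X k) → ℝ≥0∞ := fun ω x => f ω ⟨S n ω, (S n ω).restrict x⟩
  have hobs := measurable_observed_of fun E => past_le _ _ (hS E)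
  have hg : Measurable (Function.uncurry g) := hf.comp (measurable_fst.prodMk hobs)
  have key := lintegral_seqLaw_step ρ μ n hg fun ω x y => by
    have h1 : S n (resample ω n x) = S n ω := by
      have : resample ω n x ∈ {ω' | S n ω' = S n ω} := (mem_resample (hS (S n ω)) ω x).2 rfl
      exact this
    have h2 : ∀ E E' : Finset (Fin K), E = E' →
        f (resample ω n x) ⟨E, E.restrict y⟩ = f ω ⟨E', E'.restrict y⟩ := by
      rintro E _ rfl
      exact eq_resample (hpast _) ω x
    exact h2 _ _ h1
  refine key.trans (lintegral_congr fun ω => ?_)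
  rw [localLaw, lintegral_map]
  · exact hf.comp (measurable_const.prodMk (measurable_sigma_mk _))
  · exact Finset.measurable_restrict _

end Policies

/-! ### Change of measure along the collected observations. -/

section LikelihoodRatio

variable {R : Type*} [MeasurableSpace R] {K : ℕ} {X : Fin K → Type*} [∀ k, MeasurableSpace (X k)]
  {S : ℕ → Sample R X → Finset (Fin K)} {F G : Measure (∀ k, X k)}

/-- The log-likelihood ratio of one observation. -/
noncomputable def obsLLR (F G : Measure (∀ k, X k)) (z : Σ E : Finset (Fin K), ∀ k : E, X k) : ℝ :=
  llr (localLaw G z.1) (localLaw F z.1) z.2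

lemma measurable_obsLLR : Measurable (obsLLR F G) :=
  measurable_sigma_of fun E => measurable_llr (localLaw G E) (localLaw F E)

/-- The log-likelihood ratio of the observations at times `ν + 1, …, ν + n`. -/
noncomputable def cumLLR (F G : Measure (∀ k, X k)) (S : ℕ → Sample R X → Finset (Fin K)) (ν n : ℕ)
    (ω : Sample R X) : ℝ :=
  ∑ i ∈ Finset.range n, obsLLR F G (observed S (ν + i) ω)

lemma measurable_obsFiltration_observed (n : ℕ) : Measurable[obsFiltration S (n + 1)] (observed S n) :=
  (comap_measurable (observed S n)).mono le_sup_right le_rfl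

lemma measurable_cumLLR (ν n : ℕ) : Measurable[obsFiltration S (ν + n)] (cumLLR F G S ν n) := by
  unfold cumLLR
  refine Finset.measurable_sum _ fun i hi => measurable_obsLLR.comp ?_
  have hi' := Finset.mem_range.1 hi
  exact (measurable_obsFiltration_observed (ν + i)).mono (obsFiltration_mono S (by omega)) le_rfl

lemma measurable_indicator_one_mul {Ω : Type*} {m : MeasurableSpace Ω} {A : Set Ω}
    (hA : MeasurableSet A) {g : Ω → ℝ≥0∞} (hg : Measurable g) :
    Measurable fun ω => A.indicator 1 ω * g ω := (measurable_one.indicator hA).mul hg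

lemma lintegral_eq_of_setLIntegral {Ω : Type*} {m m₀ : MeasurableSpace Ω} (hm : m ≤ m₀)
    {P Q : Measure[m₀] Ω} {w : Ω → ℝ≥0∞} (hw : Measurable[m₀] w)
    (h : ∀ A, MeasurableSet[m] A → P A = ∫⁻ ω in A, w ω ∂Q) {f : Ω → ℝ≥0∞} (hf : Measurable[m] f) :
    ∫⁻ ω, f ω ∂P = ∫⁻ ω, f ω * w ω ∂Q := by
  have hPQ : P.trim hm = (Q.withDensity w).trim hm := by
    refine @Measure.ext _ m _ _ fun A hA => ?_
    rw [trim_measurableSet_eq hm hA, trim_measurableSet_eq hm hA, withDensity_apply _ (hm _ hA), h A hA]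
  rw [← lintegral_trim hm hf, hPQ, lintegral_trim hm hf,
    lintegral_withDensity_eq_lintegral_mul _ hw (hf.mono hm le_rfl)]
  refine lintegral_congr fun ω => ?_
  rw [Pi.mul_apply, mul_comm]

lemma sup_comap_eq_generateFrom {Ω β : Type*} {m : MeasurableSpace Ω} [mβ : MeasurableSpace β]
    (g : Ω → β) : m ⊔ MeasurableSpace.comap g mβ = MeasurableSpace.generateFrom
      {s | ∃ A, MeasurableSet[m] A ∧ ∃ B, MeasurableSet B ∧ s = A ∩ g ⁻¹' B} := by
  refine le_antisymm (sup_le (fun A hA => ?_) ?_) (MeasurableSpace.generateFrom_le ?_)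
  · exact MeasurableSpace.measurableSet_generateFrom ⟨A, hA, Set.univ, MeasurableSet.univ, by simp⟩
  · rintro _ ⟨B, hB, rfl⟩
    exact MeasurableSpace.measurableSet_generateFrom ⟨Set.univ, @MeasurableSet.univ _ m, B, hB, by simp⟩
  · rintro _ ⟨A, hA, B, hB, rfl⟩
    exact @MeasurableSet.inter _ (m ⊔ MeasurableSpace.comap g mβ) _ _
      ((le_sup_left : m ≤ m ⊔ MeasurableSpace.comap g mβ) _ hA)
      ((le_sup_right : MeasurableSpace.comap g mβ ≤ m ⊔ MeasurableSpace.comap g mβ) _ ⟨B, hB, rfl⟩)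

lemma isPiSystem_inter_preimage {Ω β : Type*} {m : MeasurableSpace Ω} [MeasurableSpace β] (g : Ω → β) :
    IsPiSystem {s | ∃ A, MeasurableSet[m] A ∧ ∃ B, MeasurableSet B ∧ s = A ∩ g ⁻¹' B} := by
  rintro _ ⟨A, hA, B, hB, rfl⟩ _ ⟨A', hA', B', hB', rfl⟩ -
  exact ⟨A ∩ A', @MeasurableSet.inter _ m _ _ hA hA', B ∩ B', hB.inter hB', by
    rw [Set.preimage_inter, Set.inter_inter_inter_comm]⟩

variable (ρ : Measure R) [IsProbabilityMeasure ρ] [IsProbabilityMeasure F] [IsProbabilityMeasure G]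

/-- Change of measure along the observations collected after the change-point. -/
theorem lintegral_changeSeq_eq
    (hS : ∀ n E, MeasurableSet[obsFiltration S n] {ω | S n ω = E})
    (hac : ∀ n ω, localLaw G (S n ω) ≪ localLaw F (S n ω) ∧ localLaw F (S n ω) ≪ localLaw G (S n ω))
    (ν n : ℕ) {f : Sample R X → ℝ≥0∞} (hf : Measurable[obsFiltration S (ν + n)] f) :
    ∫⁻ ω, f ω ∂seqLaw ρ (changeSeq F G ν) =
      ∫⁻ ω, f ω * ENNReal.ofReal (Real.exp (cumLLR F G S ν n ω)) ∂seqLaw ρ (fun _ => F) := by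
  have hobs := obsFiltration_le_past hS
  have hSp : ∀ n E, MeasurableSet[past n] {ω | S n ω = E} := fun n E => hobs n _ (hS n E)
  have hle : ∀ n, obsFiltration S n ≤ (inferInstance : MeasurableSpace (Sample R X)) := fun n =>
    (hobs n).trans (past_le n)
  induction n generalizing f with
  | zero =>
    simp only [cumLLR, Finset.range_zero, Finset.sum_empty, Real.exp_zero, ENNReal.ofReal_one, mul_one]
    exact lintegral_seqLaw_congr ρ (changeSeq F G ν) (fun _ => F) (n := ν) (fun i hi => if_pos hi)
      (hf.mono (hobs _) le_rfl)
  | succ n ih =>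
    set P := seqLaw ρ (changeSeq F G ν)
    set Q := seqLaw ρ (fun _ : ℕ => F)
    have hLm : ∀ n, Measurable[obsFiltration S (ν + n)] fun ω =>
        ENNReal.ofReal (Real.exp (cumLLR F G S ν n ω)) := fun n =>
      (ENNReal.measurable_ofReal.comp Real.measurable_exp).comp (measurable_cumLLR ν n)
    have hwm := (hLm (n + 1)).mono (hle _) le_rfl
    have hmG : changeSeq F G ν (ν + n) = G := if_neg (by omega)
    -- Integrating out the last observation yields the post-change probability of `B` on both sides:
    -- directly under the post-change law, and through the likelihood ratio under the pre-change
    -- law. What remains is the induction hypothesis for a function of the earlier observations.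
    have hrect : ∀ A, MeasurableSet[obsFiltration S (ν + n)] A →
        ∀ B : Set (Σ E : Finset (Fin K), ∀ k : E, X k), MeasurableSet B →
        P (A ∩ observed S (ν + n) ⁻¹' B) = ∫⁻ ω in A ∩ observed S (ν + n) ⁻¹' B,
          ENNReal.ofReal (Real.exp (cumLLR F G S ν (n + 1) ω)) ∂Q := by
      intro A hA B hB
      have hA' := hle _ _ hA
      have hAB : MeasurableSet (A ∩ observed S (ν + n) ⁻¹' B) :=
        hA'.inter (past_le _ _ (measurableSet_observed (hSp _) hB))
      let q : Finset (Fin K) → ℝ≥0∞ := fun E => localLaw G E (Sigma.mk (β := fun E : Finset (Fin K) => ∀ k : E, X k) E ⁻¹' B)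
      have hq : Measurable[obsFiltration S (ν + n)] fun ω => q (S (ν + n) ω) :=
        measurable_comp_of_measurableSet_eq (hS (ν + n)) q
      have hleft : P (A ∩ observed S (ν + n) ⁻¹' B) =
          ∫⁻ ω, A.indicator 1 ω * q (S (ν + n) ω) ∂P := by
        let f₁ : Sample R X → (Σ E : Finset (Fin K), ∀ k : E, X k) → ℝ≥0∞ := fun ω z =>
          A.indicator 1 ω * B.indicator 1 z
        have h1 := lintegral_observed ρ (changeSeq F G ν) (hSp (ν + n)) (f := f₁)
          (((measurable_one.indicator hA').comp measurable_fst).mul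
            ((measurable_one.indicator hB).comp measurable_snd))
          (fun z => measurable_indicator_one_mul (hobs _ _ hA) (@measurable_const _ _ _ (past (ν + n)) _))
        rw [hmG] at h1
        rw [← lintegral_indicator_one hAB]
        refine Eq.trans (lintegral_congr fun ω => ?_) (h1.trans (lintegral_congr fun ω => ?_))
        · rw [Set.inter_indicator_one]; rfl
        · simp only [f₁]
          refine (lintegral_const_mul _ ((measurable_one.indicator hB).comp
            (measurable_sigma_mk (S (ν + n) ω)))).trans ?_
          congr 1
          exact lintegral_indicator_one (measurableSet_sigma_mk_preimage hB _)
      have hright : ∫⁻ ω in A ∩ observed S (ν + n) ⁻¹' B,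
          ENNReal.ofReal (Real.exp (cumLLR F G S ν (n + 1) ω)) ∂Q =
          ∫⁻ ω, (A.indicator 1 ω * q (S (ν + n) ω)) *
            ENNReal.ofReal (Real.exp (cumLLR F G S ν n ω)) ∂Q := by
        let h₂ : (Σ E : Finset (Fin K), ∀ k : E, X k) → ℝ≥0∞ :=
          B.indicator fun z => ENNReal.ofReal (Real.exp (obsLLR F G z))
        have hh₂ : Measurable h₂ := ((ENNReal.measurable_ofReal.comp Real.measurable_exp).comp
          measurable_obsLLR).indicator hB
        let g₂ : Sample R X → ℝ≥0∞ := fun ω =>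
          A.indicator 1 ω * ENNReal.ofReal (Real.exp (cumLLR F G S ν n ω))
        have hg₂ : Measurable[obsFiltration S (ν + n)] g₂ :=
          measurable_indicator_one_mul hA (hLm n)
        have h1 := lintegral_observed ρ (fun _ => F) (hSp (ν + n)) (f := fun ω z => g₂ ω * h₂ z)
          (((hg₂.mono (hle _) le_rfl).comp measurable_fst).mul (hh₂.comp measurable_snd))
          (fun z => (hg₂.mono (hobs _) le_rfl).mul_const _)
        rw [← lintegral_indicator hAB]
        refine Eq.trans (lintegral_congr fun ω => ?_) (h1.trans (lintegral_congr fun ω => ?_))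
        · have hc : cumLLR F G S ν (n + 1) ω = cumLLR F G S ν n ω +
              obsLLR F G (observed S (ν + n) ω) := Finset.sum_range_succ _ _
          by_cases hωA : ω ∈ A
          · by_cases hωB : observed S (ν + n) ω ∈ B
            · rw [Set.indicator_of_mem (show ω ∈ A ∩ observed S (ν + n) ⁻¹' B from ⟨hωA, hωB⟩), hc,
                Real.exp_add, ENNReal.ofReal_mul (Real.exp_pos _).le]
              simp [g₂, h₂, hωA, hωB]
            · rw [Set.indicator_of_notMem (fun h => hωB h.2)]
              simp [h₂, hωB]
          · rw [Set.indicator_of_notMem (fun h => hωA h.1)]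
            simp [g₂, hωA]
        · refine (lintegral_const_mul _ (hh₂.comp (measurable_sigma_mk (S (ν + n) ω)))).trans ?_
          have h3 : ∫⁻ v : (∀ k : S (ν + n) ω, X k), h₂ ⟨S (ν + n) ω, v⟩ ∂localLaw F (S (ν + n) ω) = q (S (ν + n) ω) := by
            have := setLIntegral_exp_llr (hac (ν + n) ω).1 (hac (ν + n) ω).2
              (Sigma.mk (β := fun E : Finset (Fin K) => ∀ k : E, X k) (S (ν + n) ω) ⁻¹' B)
            rw [← lintegral_indicator (measurableSet_sigma_mk_preimage hB _)] at this
            exact this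
          refine (congrArg (g₂ ω * ·) h3).trans ?_
          simp only [g₂]
          ring
      rw [hleft, hright]
      exact ih (measurable_indicator_one_mul hA hq)
    have hfin : ∫⁻ ω, ENNReal.ofReal (Real.exp (cumLLR F G S ν (n + 1) ω)) ∂Q = 1 := by
      have := hrect Set.univ (@MeasurableSet.univ _ (obsFiltration S (ν + n))) Set.univ MeasurableSet.univ
      simp only [Set.preimage_univ, Set.inter_univ, Measure.restrict_univ, measure_univ] at this
      exact this.symm
    -- Such intersections form a π-system generating the observations, and the total masses agree by
    -- `hfin`.
    have hsets : ∀ A, MeasurableSet[obsFiltration S (ν + (n + 1))] A → P A =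
        ∫⁻ ω in A, ENNReal.ofReal (Real.exp (cumLLR F G S ν (n + 1) ω)) ∂Q := by
      have htrim : P.trim (hle (ν + (n + 1))) =
          (Q.withDensity fun ω => ENNReal.ofReal (Real.exp (cumLLR F G S ν (n + 1) ω))).trim
            (hle (ν + (n + 1))) := by
        refine @ext_of_generate_finite _ (obsFiltration S (ν + (n + 1))) _ _ _
          (sup_comap_eq_generateFrom (m := obsFiltration S (ν + n)) (observed S (ν + n)))
          (isPiSystem_inter_preimage _) ?_ ?_ ?_
        · infer_instance
        · rintro s ⟨A, hA, B, hB, rfl⟩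
          have hm : MeasurableSet[obsFiltration S (ν + (n + 1))] (A ∩ observed S (ν + n) ⁻¹' B) :=
            @MeasurableSet.inter _ (obsFiltration S (ν + (n + 1))) _ _
              (obsFiltration_mono S (by omega) _ hA) (measurable_obsFiltration_observed (ν + n) hB)
          rw [trim_measurableSet_eq _ hm, trim_measurableSet_eq _ hm,
            withDensity_apply _ (hle _ _ hm)]
          exact hrect A hA B hB
        · rw [trim_measurableSet_eq _ MeasurableSet.univ, trim_measurableSet_eq _ MeasurableSet.univ,
            withDensity_apply _ MeasurableSet.univ, Measure.restrict_univ, hfin, measure_univ]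
      intro A hA
      rw [← trim_measurableSet_eq (hle _) hA, htrim, trim_measurableSet_eq _ hA,
        withDensity_apply _ (hle _ _ hA)]
    exact lintegral_eq_of_setLIntegral (hle _) hwm hsets hf

end LikelihoodRatio

lemma measurable_indicator_one {Ω : Type*} {m : MeasurableSpace Ω} {A : Set Ω}
    (hA : MeasurableSet A) : Measurable (A.indicator (1 : Ω → ℝ≥0∞)) := measurable_one.indicator hA

/-- A centered square-integrable variable added to a constant. -/
lemma lintegral_ofReal_sq_add_sub_le {α : Type*} [MeasurableSpace α] {Q : Measure α}
    [IsProbabilityMeasure Q] {f : α → ℝ} (hf : Measurable f)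
    (h2 : Integrable (fun x => f x ^ 2) Q) (c : ℝ) :
    ∫⁻ x, ENNReal.ofReal ((c + (f x - ∫ y, f y ∂Q)) ^ 2) ∂Q ≤
      ENNReal.ofReal (c ^ 2) + ENNReal.ofReal (∫ x, f x ^ 2 ∂Q) := by
  have hL : MemLp f 2 Q := (memLp_two_iff_integrable_sq hf.aestronglyMeasurable).2 h2
  have h1 : Integrable f Q := hL.integrable one_le_two
  set I := ∫ y, f y ∂Q with hI
  have he : ∀ x, (c + (f x - I)) ^ 2 = f x ^ 2 + (2 * (c - I) * f x + (c - I) ^ 2) := fun x => by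
    ring
  have hi : Integrable (fun x => 2 * (c - I) * f x + (c - I) ^ 2) Q :=
    (h1.const_mul _).add (integrable_const _)
  have hint : Integrable (fun x => (c + (f x - I)) ^ 2) Q := by
    simp only [he]
    exact h2.add hi
  rw [← ofReal_integral_eq_lintegral_ofReal hint (ae_of_all _ fun x => sq_nonneg _),
    ← ENNReal.ofReal_add (sq_nonneg _) (integral_nonneg fun x => sq_nonneg _)]
  refine ENNReal.ofReal_le_ofReal ?_
  simp only [he]
  rw [integral_add h2 hi, integral_add (h1.const_mul _) (integrable_const _), integral_const_mul,
    ← hI, integral_const]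
  simp only [probReal_univ, smul_eq_mul, one_mul]
  nlinarith [sq_nonneg I]

/-! ### Lower bound on the delay of an arbitrary policy. -/

section Policies

variable {R : Type*} [MeasurableSpace R] {K : ℕ} {X : Fin K → Type*} [∀ k, MeasurableSpace (X k)]
  {S : ℕ → Sample R X → Finset (Fin K)} {F G : Measure (∀ k, X k)}
  (ρ : Measure R) [IsProbabilityMeasure ρ] [IsProbabilityMeasure F] [IsProbabilityMeasure G]

/-- The centered log-likelihood ratio of one observation. -/
noncomputable def centeredLLR (F G : Measure (∀ k, X k))
    (z : Σ E : Finset (Fin K), ∀ k : E, X k) : ℝ :=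
  obsLLR F G z - infoNumber F G z.1

lemma measurable_centeredLLR : Measurable (centeredLLR F G) :=
  measurable_sigma_of fun E => (measurable_llr (localLaw G E) (localLaw F E)).sub_const
    (infoNumber F G E)

/-- The second moment of the centered cumulative log-likelihood ratio after the change. -/
lemma setLIntegral_centered_sq_le
    (hS : ∀ n E, MeasurableSet[obsFiltration S n] {ω | S n ω = E}) {σ2 : ℝ}
    (hsq : ∀ n ω, Integrable (fun x => llr (localLaw G (S n ω)) (localLaw F (S n ω)) x ^ 2)
      (localLaw G (S n ω)))
    (hσ : ∀ n ω, ∫ x, llr (localLaw G (S n ω)) (localLaw F (S n ω)) x ^ 2 ∂localLaw G (S n ω) ≤ σ2)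
    (ν k : ℕ) {A : Set (Sample R X)} (hA : MeasurableSet[past ν] A) :
    ∫⁻ ω in A, ENNReal.ofReal ((∑ i ∈ Finset.range k,
        centeredLLR F G (observed S (ν + i) ω)) ^ 2) ∂seqLaw ρ (changeSeq F G ν) ≤
      k * ENNReal.ofReal σ2 * seqLaw ρ (changeSeq F G ν) A := by
  have hobs := obsFiltration_le_past hS
  have hSp : ∀ n E, MeasurableSet[past n] {ω | S n ω = E} := fun n E => hobs n _ (hS n E)
  set P := seqLaw ρ (changeSeq F G ν) with hP
  have hA' := past_le _ _ hA
  let M : ℕ → Sample R X → ℝ := fun k ω => ∑ i ∈ Finset.range k,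
    centeredLLR F G (observed S (ν + i) ω)
  have hM : ∀ k, Measurable[past (ν + k)] (M k) := fun k => by
    refine Finset.measurable_sum _ fun i hi => measurable_centeredLLR.comp ?_
    have hi' := Finset.mem_range.1 hi
    exact ((measurable_obsFiltration_observed (ν + i)).mono (obsFiltration_mono S (by omega))
      le_rfl).mono (hobs (ν + k)) le_rfl
  induction k with
  | zero => simp
  | succ k ih =>
    let f : Sample R X → (Σ E : Finset (Fin K), ∀ k : E, X k) → ℝ≥0∞ := fun ω z =>
      A.indicator 1 ω * ENNReal.ofReal ((M k ω + centeredLLR F G z) ^ 2)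
    have hMm : Measurable (M k) := (hM k).mono (past_le _) le_rfl
    have hf : Measurable (Function.uncurry f) := by
      refine ((measurable_one.indicator hA').comp measurable_fst).mul
        (ENNReal.measurable_ofReal.comp (((hMm.comp measurable_fst).add
          (measurable_centeredLLR.comp measurable_snd)).pow_const 2))
    have hfp : ∀ z, Measurable[past (ν + k)] fun ω => f ω z := fun z =>
      measurable_indicator_one_mul (past_mono (Nat.le_add_right _ _) _ hA)
        (ENNReal.measurable_ofReal.comp (((hM k).add_const _).pow_const 2))
    have hstep := lintegral_observed ρ (changeSeq F G ν) (hSp (ν + k)) hf hfp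
    have hmG : changeSeq F G ν (ν + k) = G := if_neg (by omega)
    rw [hmG] at hstep
    have hleft : ∫⁻ ω in A, ENNReal.ofReal (M (k + 1) ω ^ 2) ∂P =
        ∫⁻ ω, f ω (observed S (ν + k) ω) ∂P := by
      rw [← lintegral_indicator hA']
      refine lintegral_congr fun ω => ?_
      have hs : M (k + 1) ω = M k ω + centeredLLR F G (observed S (ν + k) ω) :=
        Finset.sum_range_succ _ _
      by_cases hω : ω ∈ A <;> simp [f, hω, hs]
    -- Given the past, the new increment is centered, so no cross term arises and the second moment
    -- grows by at most `σ2` per step.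
    have hinner : ∀ ω, ∫⁻ v, f ω ⟨S (ν + k) ω, v⟩ ∂localLaw G (S (ν + k) ω) ≤
        A.indicator (fun ω => ENNReal.ofReal (M k ω ^ 2) + ENNReal.ofReal σ2) ω := by
      intro ω
      by_cases hω : ω ∈ A
      · rw [Set.indicator_of_mem hω]
        simp only [f, Set.indicator_of_mem hω, Pi.one_apply, one_mul]
        refine (lintegral_ofReal_sq_add_sub_le (measurable_llr _ _) (hsq (ν + k) ω) (M k ω)).trans ?_
        gcongr
        exact hσ (ν + k) ω
      · simp [f, hω]
    refine (le_of_eq (hleft.trans hstep)).trans ((lintegral_mono hinner).trans ?_)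
    rw [lintegral_indicator hA', lintegral_add_right _ measurable_const, setLIntegral_const]
    push_cast
    rw [add_mul, add_mul, one_mul]
    gcongr

/-- A change-point at which a false alarm in the next `k` steps is unlikely. -/
lemma exists_unlikely_alarm {Ω : Type*} [MeasurableSpace Ω] (P : Measure Ω) [IsProbabilityMeasure P]
    {T : Ω → ℕ∞} (hT : ∀ n : ℕ, MeasurableSet {ω | (n : ℕ∞) < T ω}) (k : ℕ) {δ : ℝ≥0∞}
    (h : (k : ℝ≥0∞) < δ * ∫⁻ ω, (T ω : ℝ≥0∞) ∂P) :
    ∃ ν : ℕ, P ({ω | (ν : ℕ∞) < T ω} \ {ω | ((ν + k : ℕ) : ℕ∞) < T ω}) <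
      δ * P {ω | (ν : ℕ∞) < T ω} := by
  classical
  -- Otherwise sum over `ν`. The right sides add up to δ times the mean of `T`, the left sides to at
  -- most `k`, since ν < T ≤ ν + k holds for at most `k` values of `ν` (and for none if T = ∞).
  by_contra! H
  refine absurd h (not_lt.2 ?_)
  have hmean : ∫⁻ ω, (T ω : ℝ≥0∞) ∂P = ∑' ν : ℕ, P {ω | (ν : ℕ∞) < T ω} := by
    have h1 : ∀ ω, (T ω : ℝ≥0∞) = ∑' ν : ℕ, {ω | (ν : ℕ∞) < T ω}.indicator 1 ω := fun ω => by
      have := enat_sub_eq_tsum (T ω) 0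
      simp only [Nat.cast_zero, tsub_zero, zero_add] at this
      rw [this]
      refine tsum_congr fun i => ?_
      simp [Set.indicator_apply]
    rw [lintegral_congr h1, lintegral_tsum fun i => (measurable_one.indicator (hT i)).aemeasurable]
    exact tsum_congr fun i => lintegral_indicator_one (hT i)
  rw [hmean, ← ENNReal.tsum_mul_left]
  refine (ENNReal.tsum_le_tsum H).trans ?_
  have hD : ∀ ν : ℕ, MeasurableSet ({ω | (ν : ℕ∞) < T ω} \ {ω | ((ν + k : ℕ) : ℕ∞) < T ω}) :=
    fun ν => (hT ν).diff (hT _)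
  calc ∑' ν : ℕ, P ({ω | (ν : ℕ∞) < T ω} \ {ω | ((ν + k : ℕ) : ℕ∞) < T ω})
      = ∫⁻ ω, ∑' ν : ℕ, ({ω | (ν : ℕ∞) < T ω} \ {ω | ((ν + k : ℕ) : ℕ∞) < T ω}).indicator 1 ω ∂P := by
        rw [lintegral_tsum fun i => (measurable_one.indicator (hD i)).aemeasurable]
        exact tsum_congr fun i => (lintegral_indicator_one (hD i)).symm
    _ ≤ ∫⁻ _, (k : ℝ≥0∞) ∂P := by
        refine lintegral_mono fun ω => ?_
        by_cases htop : T ω = ⊤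
        · have : ∀ ν : ℕ, ({ω | (ν : ℕ∞) < T ω} \ {ω | ((ν + k : ℕ) : ℕ∞) < T ω}).indicator
              (1 : Ω → ℝ≥0∞) ω = 0 := fun ν => by
            refine Set.indicator_of_notMem (fun hmem => hmem.2 ?_) _
            show ((ν + k : ℕ) : ℕ∞) < T ω
            rw [htop]
            exact ENat.natCast_lt_top _
          rw [tsum_congr this]
          simp
        · obtain ⟨t, ht⟩ := ENat.ne_top_iff_exists.1 htop
          have hmem : ∀ ν : ℕ, ω ∈ ({ω | (ν : ℕ∞) < T ω} \ {ω | ((ν + k : ℕ) : ℕ∞) < T ω}) ↔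
              ν ∈ Finset.Ico (t - k) t := fun ν => by
            simp only [Set.mem_sdiff, Set.mem_ofPred_eq, ← ht, Nat.cast_lt, Finset.mem_Ico]
            omega
          rw [tsum_eq_sum (s := Finset.Ico (t - k) t) fun ν hν =>
            Set.indicator_of_notMem (fun h => hν ((hmem ν).1 h)) _]
          refine (Finset.sum_le_card_nsmul _ _ 1 fun ν _ => ?_).trans ?_
          · exact Set.indicator_le_self _ _ ω
          · rw [Nat.card_Ico, nsmul_eq_mul, mul_one]
            exact_mod_cast (by omega : t - (t - k) ≤ k)
    _ = k := by simp

/-- The worst-case delay dominates the mean delay, given any change-point. -/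
lemma mul_prob_le_delay {m : ℕ} {T : Sample R X → ℕ∞}
    (hS : ∀ n E, MeasurableSet[past n] {ω | S n ω = E})
    (hT : ∀ n : ℕ, MeasurableSet {ω | (n : ℕ∞) < T ω}) (ν k : ℕ)
    (h0 : changeLaw ρ F G ν {ω | (ν : ℕ∞) < T ω} ≠ 0) :
    k * ((changeLaw ρ F G ν {ω | (ν : ℕ∞) < T ω})⁻¹ *
      changeLaw ρ F G ν {ω | ((ν + k : ℕ) : ℕ∞) < T ω}) ≤ delay ρ F G m S T := by
  have hprob : IsProbabilityMeasure (changeLaw ρ F G ν) := by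
    rw [changeLaw_eq]; infer_instance
  set P := cond (changeLaw ρ F G ν) {ω | (ν : ℕ∞) < T ω} with hP
  have hPp : IsProbabilityMeasure P := cond_isProbabilityMeasure h0
  refine le_trans ?_ (le_iSup (fun ν : ℕ =>
    essSup (condLExp (affectedHistory F G m S ν) (cond (changeLaw ρ F G ν) {ω | (ν : ℕ∞) < T ω})
      (fun ω => (T ω : ℝ≥0∞) - (ν : ℝ≥0∞))) (cond (changeLaw ρ F G ν) {ω | (ν : ℕ∞) < T ω})) ν)
  set f : Sample R X → ℝ≥0∞ := fun ω => (T ω : ℝ≥0∞) - (ν : ℝ≥0∞) with hf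
  -- The essential supremum dominates the mean of the conditional expectation, so the bound does not
  -- depend on the history that is conditioned on.
  have h1 : ∫⁻ ω, condLExp (affectedHistory F G m S ν) P f ω ∂P ≤
      essSup (condLExp (affectedHistory F G m S ν) P f) P := by
    refine (lintegral_mono_ae (ENNReal.ae_le_essSup _)).trans ?_
    simp
  refine le_trans ?_ h1
  rw [lintegral_condLExp (affectedHistory_le hS ν)]
  have hsub : {ω | (ν : ℕ∞) < T ω} ∩ {ω | ((ν + k : ℕ) : ℕ∞) < T ω} =
      {ω | ((ν + k : ℕ) : ℕ∞) < T ω} := Set.inter_eq_right.2 fun ω hω => by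
    have h3 : ((ν : ℕ) : ℕ∞) ≤ ((ν + k : ℕ) : ℕ∞) := by exact_mod_cast Nat.le_add_right _ _
    exact lt_of_le_of_lt h3 hω
  have h2 : P {ω | ((ν + k : ℕ) : ℕ∞) < T ω} = (changeLaw ρ F G ν {ω | (ν : ℕ∞) < T ω})⁻¹ *
      changeLaw ρ F G ν {ω | ((ν + k : ℕ) : ℕ∞) < T ω} := by
    rw [hP, cond_apply (hT ν), hsub]
  rw [← h2, ← lintegral_indicator_const (hT (ν + k))]
  refine lintegral_mono fun ω => ?_
  refine Set.indicator_le (fun ω hω => ?_) ω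
  have h3 : ((ν + k : ℕ) : ℝ≥0∞) ≤ (T ω : ℝ≥0∞) := by
    have h4 : ((ν + k : ℕ) : ℕ∞) ≤ T ω := le_of_lt hω
    have := ENat.toENNReal_le.2 h4
    simpa using this
  refine ENNReal.le_sub_of_add_le_right (ENNReal.natCast_ne_top ν) ?_
  rw [add_comm]
  exact_mod_cast h3

/-- A lower bound on the delay of an arbitrary policy with few false alarms. -/
theorem le_delay_of_policy {𝒢 : Set (Measure (∀ k, X k))} {m : ℕ} {T : Sample R X → ℕ∞}
    (hpol : IsPolicy ρ F 𝒢 m S T)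
    (hac : ∀ E : Finset (Fin K), E.card = m →
      localLaw G E ≪ localLaw F E ∧ localLaw F E ≪ localLaw G E)
    (hsq : ∀ E : Finset (Fin K), E.card = m →
      Integrable (fun x => llr (localLaw G E) (localLaw F E) x ^ 2) (localLaw G E))
    {σ2 I : ℝ} (hσ : ∀ E : Finset (Fin K), E.card = m →
      ∫ x, llr (localLaw G E) (localLaw F E) x ^ 2 ∂localLaw G E ≤ σ2)
    (hI : ∀ E : Finset (Fin K), E.card = m → infoNumber F G E ≤ I)
    {γ δ c : ℝ} (hδ : 0 < δ) (hγ : ENNReal.ofReal γ ≤ expNoChange ρ F T) {k : ℕ} (hk : k < δ * γ)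
    (hc : k * I < c) :
    ENNReal.ofReal (k * (1 - (Real.exp c * δ + k * σ2 / (c - k * I) ^ 2))) ≤ delay ρ F G m S T := by
  have hS := hpol.adapted
  have hobs := obsFiltration_le_past hS
  have hSp : ∀ n E, MeasurableSet[past n] {ω | S n ω = E} := fun n E => hobs n _ (hS n E)
  have hTo := measurableSet_lt_of_stopping hpol.stopping
  have hTp : ∀ n : ℕ, MeasurableSet[past n] {ω | (n : ℕ∞) < T ω} := fun n => hobs n _ (hTo n)
  have hT : ∀ n : ℕ, MeasurableSet {ω | (n : ℕ∞) < T ω} := fun n => past_le _ _ (hTp n)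
  have hσ0 : 0 ≤ σ2 := by
    obtain ⟨r⟩ : Nonempty R := ρ.nonempty_of_neZero
    obtain ⟨x⟩ : Nonempty (∀ k, X k) := F.nonempty_of_neZero
    exact (integral_nonneg fun x => sq_nonneg _).trans (hσ _ (hpol.card_eq 0 (r, fun _ => x)))
  have hQp : IsProbabilityMeasure (noChangeLaw (X := X) ρ F) :=
    inferInstanceAs (IsProbabilityMeasure (seqLaw ρ fun _ => F))
  obtain ⟨ν, hν⟩ := exists_unlikely_alarm (noChangeLaw ρ F) hT k (δ := ENNReal.ofReal δ) (by
    refine lt_of_lt_of_le ?_ (mul_le_mul_right hγ _)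
    rw [← ENNReal.ofReal_mul hδ.le, ← ENNReal.ofReal_natCast]
    exact (ENNReal.ofReal_lt_ofReal_iff_of_nonneg k.cast_nonneg).2 hk)
  set Q := noChangeLaw ρ F with hQ
  set P := changeLaw ρ F G ν with hP
  have hPp : IsProbabilityMeasure P := by rw [hP, changeLaw_eq]; infer_instance
  set V : Set (Sample R X) := {ω | (ν : ℕ∞) < T ω} with hV
  set W : Set (Sample R X) := {ω | ((ν + k : ℕ) : ℕ∞) < T ω} with hW
  have hPQ : P V = Q V := seqLaw_congr_apply ρ (changeSeq F G ν) (fun _ => F)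
    (fun i hi => if_pos hi) (hTp ν)
  have hV0 : P V ≠ 0 := by
    rw [hPQ]
    intro h0
    rw [h0, mul_zero] at hν
    exact not_lt_bot hν
  have hVt : P V ≠ ⊤ := measure_ne_top _ _
  have hWV : W ⊆ V := fun ω hω => by
    have h3 : ((ν : ℕ) : ℕ∞) ≤ ((ν + k : ℕ) : ℕ∞) := by exact_mod_cast Nat.le_add_right _ _
    exact lt_of_le_of_lt h3 hω
  have hLm := (measurable_cumLLR (F := F) (G := G) (S := S) ν k)
  have hLm' : Measurable (cumLLR F G S ν k) := (hLm.mono (hobs _) le_rfl).mono (past_le _) le_rfl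
  have hVW : MeasurableSet[obsFiltration S (ν + k)] (V \ W) :=
    @MeasurableSet.diff _ (obsFiltration S (ν + k)) _ _
      (obsFiltration_mono S (Nat.le_add_right _ _) _ (hTo ν)) (hTo (ν + k))
  -- Where the log-likelihood ratio is below `c`, the change of measure costs at most a factor
  -- exp(c) on the probability of a false alarm.
  have hlow : P ((V \ W) ∩ {ω | cumLLR F G S ν k ω < c}) ≤ ENNReal.ofReal (Real.exp c * δ) * P V := by
    have hm : MeasurableSet[obsFiltration S (ν + k)] ((V \ W) ∩ {ω | cumLLR F G S ν k ω < c}) :=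
      @MeasurableSet.inter _ (obsFiltration S (ν + k)) _ _ hVW (hLm measurableSet_Iio)
    have hm' := past_le _ _ (hobs _ _ hm)
    have := lintegral_changeSeq_eq (F := F) (G := G) ρ hS
      (fun n ω => hac _ (hpol.card_eq n ω)) ν k (f := ((V \ W) ∩ {ω | cumLLR F G S ν k ω < c}).indicator 1)
      (measurable_indicator_one hm)
    rw [lintegral_indicator_one hm'] at this
    calc P ((V \ W) ∩ {ω | cumLLR F G S ν k ω < c})
        = ∫⁻ ω, ((V \ W) ∩ {ω | cumLLR F G S ν k ω < c}).indicator 1 ω *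
            ENNReal.ofReal (Real.exp (cumLLR F G S ν k ω)) ∂Q := this
      _ ≤ ∫⁻ ω, (V \ W).indicator (fun _ => ENNReal.ofReal (Real.exp c)) ω ∂Q := by
          refine lintegral_mono fun ω => ?_
          by_cases hω : ω ∈ (V \ W) ∩ {ω | cumLLR F G S ν k ω < c}
          · rw [Set.indicator_of_mem hω, Set.indicator_of_mem hω.1, Pi.one_apply, one_mul]
            exact ENNReal.ofReal_le_ofReal (Real.exp_le_exp.2 (le_of_lt hω.2))
          · rw [Set.indicator_of_notMem hω, zero_mul]
            exact zero_le
      _ = ENNReal.ofReal (Real.exp c) * Q (V \ W) :=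
          lintegral_indicator_const (past_le _ _ (hobs _ _ hVW)) _
      _ ≤ ENNReal.ofReal (Real.exp c) * (ENNReal.ofReal δ * Q V) := by gcongr
      _ = ENNReal.ofReal (Real.exp c * δ) * P V := by
          rw [ENNReal.ofReal_mul (Real.exp_pos _).le, hPQ, mul_assoc]
  have hck : 0 < c - k * I := by linarith
  -- Chebyshev: the compensator of the log-likelihood ratio over `k` steps is at most k I, so
  -- reaching `c` requires a deviation of at least c - k I.
  have hhigh : P (V ∩ {ω | c ≤ cumLLR F G S ν k ω}) ≤
      ENNReal.ofReal (k * σ2 / (c - k * I) ^ 2) * P V := by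
    have hsecond := setLIntegral_centered_sq_le (F := F) (G := G) ρ hS (σ2 := σ2)
      (fun n ω => hsq _ (hpol.card_eq n ω)) (fun n ω => hσ _ (hpol.card_eq n ω)) ν k (hTp ν)
    have hsq0 : ENNReal.ofReal ((c - k * I) ^ 2) ≠ 0 := by
      rw [ne_eq, ENNReal.ofReal_eq_zero, not_le]
      positivity
    have hmark : ENNReal.ofReal ((c - k * I) ^ 2) * P (V ∩ {ω | c ≤ cumLLR F G S ν k ω}) ≤
        k * ENNReal.ofReal σ2 * P V := by
      refine le_trans ?_ hsecond
      have hm : MeasurableSet {ω | c ≤ cumLLR F G S ν k ω} := hLm' measurableSet_Ici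
      rw [Set.inter_comm, ← Measure.restrict_apply hm, ← lintegral_indicator_const hm]
      refine lintegral_mono fun ω => ?_
      by_cases hω : ω ∈ {ω | c ≤ cumLLR F G S ν k ω}
      swap
      · rw [Set.indicator_of_notMem hω]; exact zero_le
      rw [Set.indicator_of_mem hω]
      refine ENNReal.ofReal_le_ofReal ?_
      have h1 : ∑ i ∈ Finset.range k, centeredLLR F G (observed S (ν + i) ω) =
          cumLLR F G S ν k ω - ∑ i ∈ Finset.range k, infoNumber F G (S (ν + i) ω) := by
        rw [cumLLR, ← Finset.sum_sub_distrib]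
        rfl
      have h2 : ∑ i ∈ Finset.range k, infoNumber F G (S (ν + i) ω) ≤ k * I := by
        refine (Finset.sum_le_card_nsmul _ _ I fun i _ => hI _ (hpol.card_eq _ ω)).trans ?_
        simp
      have h3 : c ≤ cumLLR F G S ν k ω := hω
      rw [h1]
      exact pow_le_pow_left₀ hck.le (by linarith) 2
    rw [ENNReal.ofReal_div_of_pos (by positivity), ENNReal.ofReal_mul k.cast_nonneg,
      ENNReal.ofReal_natCast, ← ENNReal.mul_div_right_comm,
      ENNReal.le_div_iff_mul_le (Or.inl hsq0) (Or.inl ENNReal.ofReal_ne_top), mul_comm]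
    exact hmark
  set q := Real.exp c * δ + k * σ2 / (c - k * I) ^ 2 with hq
  have hq1 : 0 ≤ Real.exp c * δ := by positivity
  have hq2 : 0 ≤ k * σ2 / (c - k * I) ^ 2 := by positivity
  have hdiff : P (V \ W) ≤ ENNReal.ofReal q * P V := by
    rw [hq, ENNReal.ofReal_add hq1 hq2, add_mul]
    refine le_trans ?_ (add_le_add hlow hhigh)
    refine (measure_mono fun ω hω => ?_).trans (measure_union_le _ _)
    rcases lt_or_ge (cumLLR F G S ν k ω) c with h1 | h1
    · exact Or.inl ⟨hω, h1⟩
    · exact Or.inr ⟨hω.1, h1⟩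
  have hPV : P V ≤ P W + ENNReal.ofReal q * P V := by
    calc P V ≤ P (W ∪ (V \ W)) := measure_mono fun ω hω => by
          by_cases h : ω ∈ W
          · exact Or.inl h
          · exact Or.inr ⟨hω, h⟩
      _ ≤ P W + P (V \ W) := measure_union_le _ _
      _ ≤ _ := by gcongr
  refine le_trans ?_ (mul_prob_le_delay ρ (m := m) hSp hT ν k hV0)
  rw [ENNReal.ofReal_mul k.cast_nonneg, ENNReal.ofReal_natCast]
  gcongr
  rw [mul_comm, ← div_eq_mul_inv, ENNReal.le_div_iff_mul_le (Or.inl hV0) (Or.inl hVt),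
    ENNReal.ofReal_sub _ (add_nonneg hq1 hq2), ENNReal.ofReal_one,
    ENNReal.sub_mul fun _ _ => hVt, one_mul]
  exact tsub_le_iff_right.2 hPV

end Policies

/-- The parameters of the lower bound can be chosen so that it is asymptotically sharp. -/
lemma eventually_exists_params {I c σ2 : ℝ} (hI : 0 < I) (hc0 : 0 < c) (hc : c * I < 1)
    (hσ : 0 ≤ σ2) :
    ∀ᶠ a : ℝ in atTop, ∃ (k : ℕ) (δ b : ℝ), 0 < δ ∧ k < δ * Real.exp a ∧ k * I < b ∧
      c * a ≤ k * (1 - (Real.exp b * δ + k * σ2 / (b - k * I) ^ 2)) := by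
  -- Rates with c < θ < 1 / I and, below, θ I < l < 1: the window is θ a steps long, and the
  -- threshold l a lies strictly between the largest drift over it and a.
  obtain ⟨θ, hcθ, hθ⟩ : ∃ θ, c < θ ∧ θ * I < 1 := by
    refine ⟨(c + 1 / I) / 2, ?_, ?_⟩
    · have : c < 1 / I := by rwa [lt_div_iff₀ hI]
      linarith
    · have : (c + 1 / I) / 2 * I = (c * I + 1) / 2 := by field_simp
      rw [this]; linarith
  have hθ0 : 0 < θ := hc0.trans hcθ
  obtain ⟨l, hθl, hl⟩ := exists_between hθ
  -- Vanishing bounds for the two error terms, from the false alarms and from Chebyshev's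
  -- inequality.
  let q : ℝ → ℝ := fun a => (θ * a + 1) * Real.exp (-((1 - l) * a)) +
    θ * σ2 / (l - θ * I) ^ 2 * a⁻¹
  have hq : Tendsto q atTop (𝓝 0) := by
    have h1l : 0 < 1 - l := by linarith
    have h1 : Tendsto (fun a : ℝ => a * Real.exp (-((1 - l) * a))) atTop (𝓝 0) := by
      have := tendsto_rpow_mul_exp_neg_mul_atTop_nhds_zero 1 (1 - l) h1l
      refine this.congr fun a => ?_
      rw [Real.rpow_one, neg_mul]
    have h2 : Tendsto (fun a : ℝ => Real.exp (-((1 - l) * a))) atTop (𝓝 0) :=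
      Real.tendsto_exp_neg_atTop_nhds_zero.comp (tendsto_id.const_mul_atTop h1l)
    have h3 := ((h1.const_mul θ).add h2).add
      (tendsto_inv_atTop_zero.const_mul (θ * σ2 / (l - θ * I) ^ 2))
    simp only [mul_zero, add_zero] at h3
    refine h3.congr fun a => ?_
    simp only [q]
    ring
  have hlim : Tendsto (fun a => (θ - a⁻¹) * (1 - q a)) atTop (𝓝 θ) := by
    have h1 : Tendsto (fun a : ℝ => θ - a⁻¹) atTop (𝓝 (θ - 0)) :=
      tendsto_inv_atTop_zero.const_sub θ
    have := h1.mul (hq.const_sub 1)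
    simpa using this
  filter_upwards [hlim.eventually_const_le hcθ, hq.eventually_lt_const one_pos,
    eventually_gt_atTop 0] with a ha hqa ha0
  have hθa : 0 ≤ θ * a := by positivity
  set k := ⌊θ * a⌋₊ with hk
  have hk1 : (k : ℝ) ≤ θ * a := Nat.floor_le hθa
  have hk2 : θ * a < k + 1 := Nat.lt_floor_add_one _
  have hgap : (l - θ * I) * a ≤ l * a - k * I := by
    have := mul_le_mul_of_nonneg_right hk1 hI.le
    nlinarith
  have hgap0 : 0 < (l - θ * I) * a := mul_pos (by linarith) ha0
  -- This δ gives δ exp(a) = k + 1, just above `k`. Rounding θ a down to `k` is the cause of the θ -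
  -- 1 / a in `hlim`.
  refine ⟨k, (k + 1) * Real.exp (-a), l * a, by positivity, ?_, by linarith, ?_⟩
  · rw [mul_assoc, ← Real.exp_add]
    simp
  · have hq' : Real.exp (l * a) * ((k + 1) * Real.exp (-a)) + k * σ2 / (l * a - k * I) ^ 2 ≤ q a := by
      refine add_le_add ?_ ?_
      · have : Real.exp (l * a) * ((k + 1) * Real.exp (-a)) =
            (k + 1) * Real.exp (-((1 - l) * a)) := by
          rw [mul_left_comm, ← Real.exp_add]
          ring_nf
        rw [this]
        gcongr
      · calc k * σ2 / (l * a - k * I) ^ 2 ≤ θ * a * σ2 / ((l - θ * I) * a) ^ 2 := by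
              gcongr
          _ = θ * σ2 / (l - θ * I) ^ 2 * a⁻¹ := by
              have : l - θ * I ≠ 0 := by linarith
              field_simp
    calc c * a ≤ (θ - a⁻¹) * (1 - q a) * a := mul_le_mul_of_nonneg_right ha ha0.le
      _ = (θ * a - 1) * (1 - q a) := by
          have := ha0.ne'
          field_simp
      _ ≤ k * (1 - q a) := mul_le_mul_of_nonneg_right (by linarith) (by linarith)
      _ ≤ _ := mul_le_mul_of_nonneg_left (by linarith) k.cast_nonneg

/-! ### Asymptotic lower bound on the optimal delay. -/

section Policies

variable {R : Type*} [MeasurableSpace R] {K : ℕ} {X : Fin K → Type*} [∀ k, MeasurableSpace (X k)]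
  {F G : Measure (∀ k, X k)} [IsProbabilityMeasure F] [IsProbabilityMeasure G]

/-- The optimal delay is asymptotically at least the logarithm of the mean time between false alarms
divided by the largest information number. -/
theorem eventually_le_optimalDelay (ρ : Measure R) [IsProbabilityMeasure ρ]
    (𝒢 : Set (Measure (∀ k, X k))) {m : ℕ}
    (hac : ∀ E : Finset (Fin K), E.card = m →
      localLaw G E ≪ localLaw F E ∧ localLaw F E ≪ localLaw G E)
    (hsq : ∀ E : Finset (Fin K), E.card = m →
      Integrable (fun x => llr (localLaw G E) (localLaw F E) x ^ 2) (localLaw G E))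
    {I : ℝ} (hI0 : 0 < I) (hI : ∀ E : Finset (Fin K), E.card = m → infoNumber F G E ≤ I)
    {c : ℝ} (hc0 : 0 < c) (hc : c * I < 1) :
    ∀ᶠ γ : ℝ in atTop, ENNReal.ofReal (c * Real.log γ) ≤ optimalDelay ρ F 𝒢 G m γ := by
  -- The sum runs over sets of every size. Where the square is not integrable the integral is 0 by
  -- convention; only nonnegativity of the extra terms matters.
  set σ2 : ℝ := ∑ E : Finset (Fin K),
    ∫ x, llr (localLaw G E) (localLaw F E) x ^ 2 ∂localLaw G E with hσ2
  have hnn : ∀ E : Finset (Fin K), 0 ≤ ∫ x, llr (localLaw G E) (localLaw F E) x ^ 2 ∂localLaw G E :=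
    fun E => integral_nonneg fun x => sq_nonneg _
  have hσ : ∀ E : Finset (Fin K), E.card = m →
      ∫ x, llr (localLaw G E) (localLaw F E) x ^ 2 ∂localLaw G E ≤ σ2 := fun E _ =>
    Finset.single_le_sum (f := fun E : Finset (Fin K) =>
      ∫ x, llr (localLaw G E) (localLaw F E) x ^ 2 ∂localLaw G E) (fun E _ => hnn E)
      (Finset.mem_univ E)
  have hparams := Real.tendsto_log_atTop.eventually
    (eventually_exists_params hI0 hc0 hc (Finset.sum_nonneg fun E _ => hnn E : 0 ≤ σ2))
  filter_upwards [hparams, eventually_gt_atTop 0] with γ hγ hγ0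
  obtain ⟨k, δ, b, hδ, hk, hb, hle⟩ := hγ
  rw [Real.exp_log hγ0] at hk
  refine le_iInf fun S => le_iInf fun T => le_iInf fun h => ?_
  exact (ENNReal.ofReal_le_ofReal hle).trans
    (le_delay_of_policy ρ h.1 hac hsq hσ hI hδ h.2 hk hb)

end Policies

/-! ### Information numbers. -/

section Information

variable {K : ℕ} {X : Fin K → Type*} [∀ k, MeasurableSpace (X k)] {F G : Measure (∀ k, X k)}
  [IsProbabilityMeasure F] [IsProbabilityMeasure G] {E : Finset (Fin K)}

/-- The information number is the Kullback-Leibler divergence, which vanishes only for equal laws.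
The second moment makes it finite, so that its real value is positive. -/
lemma infoNumber_pos (hne : localLaw G E ≠ localLaw F E) (hac : localLaw G E ≪ localLaw F E)
    (hsq : Integrable (fun x => llr (localLaw G E) (localLaw F E) x ^ 2) (localLaw G E)) :
    0 < infoNumber F G E := by
  have hint : Integrable (llr (localLaw G E) (localLaw F E)) (localLaw G E) :=
    ((memLp_two_iff_integrable_sq (measurable_llr _ _).aestronglyMeasurable).2 hsq).integrable
      one_le_two
  have h1 := InformationTheory.toReal_klDiv_of_measure_eq hac (by simp)
  rw [infoNumber, ← h1]
  refine ENNReal.toReal_pos ?_ (InformationTheory.klDiv_ne_top hac hint)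
  rwa [ne_eq, InformationTheory.klDiv_eq_zero_iff]

lemma llr_ae_eq_zero (h : localLaw G E = localLaw F E) :
    llr (localLaw G E) (localLaw F E) =ᵐ[localLaw G E] 0 := by
  rw [← h]
  exact llr_self _

lemma infoNumber_eq_zero (h : localLaw G E = localLaw F E) : infoNumber F G E = 0 := by
  rw [infoNumber, integral_congr_ae (llr_ae_eq_zero h)]
  simp

lemma integrable_llr_sq (h : localLaw G E = localLaw F E) :
    Integrable (fun x => llr (localLaw G E) (localLaw F E) x ^ 2) (localLaw G E) := by
  refine (integrable_zero _ ℝ _).congr ?_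
  filter_upwards [llr_ae_eq_zero h] with x hx
  simp [hx]

lemma postDrift_eq_infoNumber {𝒢 : Set (Measure (∀ k, X k))} (hG : G ∈ 𝒢)
    (hne : localLaw G E ≠ localLaw F E) (h : ∃ P, localFamily F 𝒢 E = {P}) :
    postDrift F 𝒢 G E = infoNumber F G E := by
  obtain ⟨P, hP⟩ := h
  have hGP : localLaw G E = P := by
    have : localLaw G E ∈ localFamily F 𝒢 E := ⟨G, hG, rfl, hne⟩
    rw [hP] at this
    exact this
  have hmix : mixture F 𝒢 E = localLaw G E := by
    ext s hs
    rw [mixture_apply s hs, hP, hGP]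
    simp
  rw [postDrift, mixLLR, hmix, infoNumber]

end Information

/-- If the delay of Round Robin is eventually at most `c log γ` for all `c > 1 / J`, and the optimal
delay at least `c log γ` for all `c < 1 / I`, then the quotient is eventually below every number
larger than `I / J`. -/
lemma eventually_div_le {D O : ℝ → ℝ≥0∞} {I J : ℝ} (hI : 0 < I) (hJ : 0 < J)
    (hD : ∀ c, 1 / J < c → ∀ᶠ γ in atTop, D γ ≤ ENNReal.ofReal (c * Real.log γ))
    (hO : ∀ c, 0 < c → c * I < 1 → ∀ᶠ γ in atTop, ENNReal.ofReal (c * Real.log γ) ≤ O γ)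
    {r : ℝ} (hr : I / J < r) : ∀ᶠ γ in atTop, D γ / O γ ≤ ENNReal.ofReal r := by
  have hr0 : 0 < r := lt_trans (by positivity) hr
  -- With 1 / J < c < r / I, the rate c / r is below 1 / I, and the quotient of the rates `c` and `c
  -- / r` is `r`.
  obtain ⟨c, hc, hcr⟩ : ∃ c, 1 / J < c ∧ c < r / I := exists_between (by
    rw [div_lt_div_iff₀ hJ hI]
    rw [div_lt_iff₀ hJ] at hr
    linarith)
  have hc0 : 0 < c := lt_trans (by positivity) hc
  have hcI : c / r * I < 1 := by
    rw [lt_div_iff₀ hI] at hcr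
    rw [div_mul_eq_mul_div, div_lt_one hr0]
    exact hcr
  filter_upwards [hD c hc, hO (c / r) (by positivity) hcI, eventually_gt_atTop 1] with γ h1 h2 h3
  have hlog := Real.log_pos h3
  refine (ENNReal.div_le_div h1 h2).trans ?_
  rw [← ENNReal.ofReal_div_of_pos (by positivity)]
  refine ENNReal.ofReal_le_ofReal (le_of_eq ?_)
  field_simp

end QuickestDetection

/-! ### The two bounds combined. -/

theorem theorem4 {K m N : ℕ} [NeZero N] {X : Fin K → Type*} [∀ k, MeasurableSpace (X k)]
    {R : Type*} [MeasurableSpace R] (ρ : Measure R) [IsProbabilityMeasure ρ]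
    -- pre-change distribution, family of plausible post-change distributions, the true one
    (F : Measure (∀ k, X k)) [IsProbabilityMeasure F]
    (𝒢 : Set (Measure (∀ k, X k))) (h𝒢 : ∀ G' ∈ 𝒢, IsProbabilityMeasure G')
    (hac : ∀ G' ∈ 𝒢, ∀ E ∈ affected F G' m,
      localLaw G' E ≪ localLaw F E ∧ localLaw F E ≪ localLaw G' E)
    (G : Measure (∀ k, X k)) (hG : G ∈ 𝒢)
    -- the units, enumerated in an arbitrary order
    (U : Finset (Finset (Fin K))) (hU : ∀ E ∈ U, E.card = m) (e : Fin N ≃ U)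
    (hfam : ∀ E ∈ U, (localFamily F 𝒢 E).Nonempty ∧ (localFamily F 𝒢 E).Finite)
    -- second moments of the log-likelihood ratios
    (hsq : ∀ E ∈ affected F G m,
      Integrable (fun x => (llr (localLaw G E) (localLaw F E) x) ^ 2) (localLaw G E))
    -- some unit is affected; drifts before and after the change
    (hne : (affected F G m ∩ U).Nonempty)
    (hpre : ∀ E ∈ U, Integrable (llr (localLaw F E) (mixture F 𝒢 E)) (localLaw F E) ∧
      0 < preDrift F 𝒢 E)
    (hpost : ∀ E ∈ affected F G m ∩ U, Integrable (mixLLR F 𝒢 E) (localLaw G E) ∧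
      0 < postDrift F 𝒢 G E) :
    ((∀ᶠ γ : ℝ in atTop, rrDelay ρ F 𝒢 G m e γ ≠ ⊤ ∧ optimalDelay ρ F 𝒢 G m γ ≠ 0) ∧
      rrARE ρ F 𝒢 G m e ≤ ENNReal.ofReal
        ((affected F G m).sup' (hne.mono Finset.inter_subset_left) (infoNumber F G) /
          (affected F G m ∩ U).inf' hne (postDrift F 𝒢 G))) ∧
    ((∀ E ∈ affected F G m ∩ U, ∃ P, localFamily F 𝒢 E = {P}) →
      (affected F G m).sup' (hne.mono Finset.inter_subset_left) (infoNumber F G) =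
        (affected F G m ∩ U).inf' hne (infoNumber F G) →
      rrAsymptoticallyOptimal ρ F 𝒢 G m e) := by
  have hGp := h𝒢 G hG
  set I := (affected F G m).sup' (hne.mono Finset.inter_subset_left) (infoNumber F G) with hIdef
  set J := (affected F G m ∩ U).inf' hne (postDrift F 𝒢 G) with hJdef
  have hreg : ∀ E ∈ U, RegularUnit F 𝒢 E := fun E hE =>
    { nonempty := (hfam E hE).1
      finite := (hfam E hE).2
      prob := by
        rintro _ ⟨G', hG', rfl, -⟩
        have := h𝒢 G' hG'
        infer_instance
      ac := by
        rintro _ ⟨G', hG', rfl, h⟩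
        exact (hac G' hG' E (mem_affected.2 ⟨hU E hE, h⟩)).1
      ac' := by
        rintro _ ⟨G', hG', rfl, h⟩
        exact (hac G' hG' E (mem_affected.2 ⟨hU E hE, h⟩)).2
      integrable := (hpre E hE).1
      pos := (hpre E hE).2 }
  have hregd : ∀ d : Fin N, RegularUnit F 𝒢 (e d) := fun d => hreg _ (e d).2
  have hJ : 0 < J := (Finset.lt_inf'_iff hne).2 fun E hE => (hpost E hE).2
  have hI : 0 < I := by
    obtain ⟨E, hE⟩ := hne.mono Finset.inter_subset_left
    exact (infoNumber_pos (mem_affected.1 hE).2 (hac G hG E hE).1 (hsq E hE)).trans_le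
      (Finset.le_sup' (infoNumber F G) hE)
  -- A policy may sample any set of size `m`. For an unaffected one the two local laws coincide, so
  -- the assumptions on affected sets extend to all sets of this size.
  have hac' : ∀ E : Finset (Fin K), E.card = m →
      localLaw G E ≪ localLaw F E ∧ localLaw F E ≪ localLaw G E := fun E hE => by
    by_cases h : E ∈ affected F G m
    · exact hac G hG E h
    · rw [localLaw_eq_of_notMem_affected hE h]
      exact ⟨Measure.AbsolutelyContinuous.rfl, Measure.AbsolutelyContinuous.rfl⟩
  have hsq' : ∀ E : Finset (Fin K), E.card = m →
      Integrable (fun x => llr (localLaw G E) (localLaw F E) x ^ 2) (localLaw G E) := fun E hE => by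
    by_cases h : E ∈ affected F G m
    · exact hsq E h
    · exact integrable_llr_sq (localLaw_eq_of_notMem_affected hE h)
  have hI' : ∀ E : Finset (Fin K), E.card = m → infoNumber F G E ≤ I := fun E hE => by
    by_cases h : E ∈ affected F G m
    · exact Finset.le_sup' (infoNumber F G) h
    · rw [infoNumber_eq_zero (localLaw_eq_of_notMem_affected hE h)]
      exact hI.le
  have hD : ∀ c, 1 / J < c → ∀ᶠ γ in atTop,
      rrDelay ρ F 𝒢 G m e γ ≤ ENNReal.ofReal (c * Real.log γ) := by
    intro c hc
    have hc0 : 0 < c := lt_trans (by positivity) hc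
    -- The potential needs a rate strictly below all drifts, so `J` is lowered slightly within the
    -- slack left by `c`.
    obtain ⟨J', h1, h2⟩ : ∃ J', 1 / c < J' ∧ J' < J := exists_between (by
      rwa [one_div_lt hc0 hJ])
    have hJ' : 0 < J' := lt_trans (by positivity) h1
    exact Real.tendsto_log_atTop.eventually (eventually_delay_rr_le ρ hG hU hregd hne
      (fun E hE => (hpost E hE).1) hJ' (fun E hE => h2.trans_le (Finset.inf'_le _ hE))
      (by rwa [one_div_lt hJ' hc0]))
  have hO : ∀ c, 0 < c → c * I < 1 → ∀ᶠ γ in atTop,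
      ENNReal.ofReal (c * Real.log γ) ≤ optimalDelay ρ F 𝒢 G m γ := fun c hc0 hc =>
    eventually_le_optimalDelay ρ 𝒢 hac' hsq' hI hI' hc0 hc
  have hratio := fun r (hr : I / J < r) => eventually_div_le hI hJ hD hO hr
  have hfin : ∀ᶠ γ : ℝ in atTop, rrDelay ρ F 𝒢 G m e γ ≠ ⊤ := by
    filter_upwards [hD (2 / J) (by gcongr; norm_num)] with γ h
    exact (h.trans_lt ENNReal.ofReal_lt_top).ne
  have hpos : ∀ᶠ γ : ℝ in atTop, optimalDelay ρ F 𝒢 G m γ ≠ 0 := by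
    filter_upwards [hO (1 / (2 * I)) (by positivity) (by field_simp; norm_num),
      eventually_gt_atTop 1] with γ h h1
    have hlog := Real.log_pos h1
    exact (lt_of_lt_of_le (ENNReal.ofReal_pos.2 (by positivity)) h).ne'
  refine ⟨⟨hfin.and hpos, ?_⟩, fun hsing hIeq => ?_⟩
  · have hlim : Tendsto (fun r : ℝ => ENNReal.ofReal r) (𝓝[>] (I / J)) (𝓝 (ENNReal.ofReal (I / J))) :=
      (ENNReal.continuous_ofReal.tendsto _).mono_left nhdsWithin_le_nhds
    refine ge_of_tendsto hlim ?_
    filter_upwards [self_mem_nhdsWithin] with r hr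
    exact limsup_le_of_le (h := hratio r hr)
  · have hIJ : I / J = 1 := by
      have : J = I := by
        rw [hIeq, hJdef]
        exact Finset.inf'_congr hne rfl fun E hE => postDrift_eq_infoNumber hG
          (mem_affected.1 (Finset.mem_inter.1 hE).1).2 (hsing E hE)
      rw [this, div_self hI.ne']
    rw [hIJ] at hratio
    -- Round Robin is itself one of the policies in the infimum. The finite numerator makes the
    -- denominator finite too, and with the latter nonzero the division is legitimate.
    have hge : ∀ᶠ γ : ℝ in atTop,
        1 ≤ rrDelay ρ F 𝒢 G m e γ / optimalDelay ρ F 𝒢 G m γ := by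
      filter_upwards [hfin, hpos, eventually_gt_atTop 1] with γ h1 h2 h3
      have hlog := Real.log_pos h3
      have hle : optimalDelay ρ F 𝒢 G m γ ≤ rrDelay ρ F 𝒢 G m e γ := by
        refine iInf_le_of_le (rrS F 𝒢 e) (iInf_le_of_le (rrT F 𝒢 e (Real.log γ))
          (iInf_le_of_le ⟨isPolicy_rr ρ h𝒢 hU hregd hlog, ?_⟩ le_rfl))
        have := le_expNoChange_rr ρ hregd hlog
        rwa [Real.exp_log (by linarith)] at this
      have ht : optimalDelay ρ F 𝒢 G m γ ≠ ⊤ := (hle.trans_lt h1.lt_top).ne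
      rw [ENNReal.le_div_iff_mul_le (Or.inl h2) (Or.inl ht), one_mul]
      exact hle
    refine tendsto_order.2 ⟨fun b hb => hge.mono fun γ h => hb.trans_le h, fun b hb => ?_⟩
    have hlim : Tendsto (fun r : ℝ => ENNReal.ofReal r) (𝓝[>] 1) (𝓝 (ENNReal.ofReal 1)) :=
      (ENNReal.continuous_ofReal.tendsto _).mono_left nhdsWithin_le_nhds
    rw [ENNReal.ofReal_one] at hlim
    obtain ⟨r, hr1, hr2⟩ := ((hlim.eventually_lt_const hb).and self_mem_nhdsWithin).exists
    exact (hratio r hr2).mono fun γ h => h.trans_lt hr1
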